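/- **Setup.** For a simplicial $D$-polytope $R$, with $f_{j}(R)$ the number of $j$-dimensional proper faces of $R$ (so $f_{-1}(R)=1$), let $\sum_i h_i(R)t^i=\sum_{j=0}^{D}f_{j-1}(R)\,t^j(1-t)^{D-j}$, and let $g_0(R)=h_0(R)$ and $g_i(R)=h_i(R)-h_{i-1}(R)$ for $i\ge 1$. For integers $m,i\ge0$ let $\left(\!\binom{m}{i}\!\right)$ be the number of multisets of size $i$ from a set of size $m$ (so $\left(\!\binom{0}{i}\!\right)=0$ for $i\ge1$). Let $2\le K\le D<N$. A polytope $\mathsf{MW}(K,D,N)$ is $\mathrm{conv}(C\cup T)\subset\mathbb{R}^D$, where $C$ is a cyclic $K$-polytope with $N-D+K$ vertices (an image, under an injective affine map $\mathbb{R}^K\to\mathbb{R}^D$, of the convex hull of points $x(t_1),\dots,x(t_{N-D+K})$ with $t_1<\dots<t_{N-D+K}$ on the moment curve $x(t)=(t,t^2,\dots,t^K)$), and $T$ is a $(D-K)$-simplex whose relative interior meets the affine hull of $C$ exactly in the last vertex of $C$. Its vertices $v_1<\dots<v_N$ are ordered by listing the vertices of $C$ other than the last one in the order of their parameters, and then the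 vertices of $T$ in any order. Let $P\subset\mathbb{R}^{D}$ be a $D$-polytope with ordered vertices $v_1,\dots,v_{m}$, and let $P_j=\mathrm{conv}(v_{j+1},\dots,v_{m})$. The $a$-th lexicographic subdivision $\mathrm{Lex}_a(P)$ is obtained by successively pushing $v_1,\dots,v_{a-1}$ and then pulling $v_a$. Its maximal cells are the pyramids $\mathrm{conv}(\{v_j\}\cup F)$, with $1\le j\le a-1$ and $F$ a facet of $P_j$ that is not a facet of $P_{j-1}$, together with the pyramids $\mathrm{conv}(\{v_a\}\cup F)$, with $F$ a facet of $P_{a-1}$ not containing $v_a$. Heights $w\in\mathbb{R}^{m}$ *induce* the subdivision of $P$ whose maximal cells are the full-dimensional sets $\mathrm{conv}\{v_i:\ell(v_i)=w_i\}$, for $\ell$ an affine function with $\ell(v_i)\le w_i$ for all $i$. Call $w$ *$a$-lexicographic* if $$w_1>\dots>w_{a-1}>0>w_a,\qquad w_{a+1}=\dots=w_{m}=0,$$ and $w$ induces $\mathrm{Lex}_a(P)$. The $a$-th lexicographic diamond $D_a$ over $P$ is the polytope $$\mathrm{conv}\{(w_0,v_0'),(w_1,v_1),\dots,(w_{m},v_{m})\}\subset\mathbb{R}\times\mathbb{R}^{D},$$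 where $w$ is $a$-lexicographic, $v_0'\in\mathbb{R}^{D}$ is arbitrary, and $w_0$ is sufficiently large (depending on $v_1,\dots,v_m$, $w$ and $v_0'$). **Proposition.** Let $k\ge1$, $n\ge d\ge 2k+2$ and $1\le a\le n-d+1$, and let $P$ be a polytope $\mathsf{MW}(2k,d-2,n-1)$ with its ordered vertices. Then $a$-lexicographic heights for $P$ exist. Moreover, for all $a$-lexicographic heights $w$ and all $v_0'\in\mathbb{R}^{d-2}$ there is $W\in\mathbb{R}$ such that for every $w_0>W$ the diamond $D_a$ over $P$ with heights $w$ and apex $(w_0,v_0')$ is a simplicial $(d-1)$-polytope, and for all $0\le i\le\lfloor\frac{d-1}{2}\rfloor$ $$g_i(D_a)=\begin{cases}0,& i>k+1;\\[2pt] \left(\!\binom{n-d-a+1}{k}\!\right),& i=k+1;\\[2pt] \left(\!\binom{n-d}{i}\!\right),& i\le k.\end{cases}$$ -/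

import Mathlib

namespace LexDiamond

noncomputable section

/-! ### Faces, f-, h- and g-numbers of polytopes -/

section Faces

variable {E : Type*} [NormedAddCommGroup E] [NormedSpace ℝ E]

/-- A proper face of the polytope `P`: an intersection of `P` with a supporting hyperplane,
different from `P`. The empty set is a proper face (of dimension `-1`). -/
def IsProperFace (P F : Set E) : Prop :=
  IsExposed ℝ P F ∧ F ≠ P

open Classical in
/-- The dimension of a (convex) set: the dimension of its affine span, and `-1` if it is empty. -/
def polyDim (F : Set E) : ℤ :=
  if F = ∅ then -1 else (Module.finrank ℝ (vectorSpan ℝ F) : ℤ)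

/-- A facet: a proper face of codimension one. -/
def IsFacet (P F : Set E) : Prop :=
  IsProperFace P F ∧ polyDim F = polyDim P - 1

/-- A (possibly empty) simplex: the convex hull of a finite affinely independent set. -/
def IsSimplex (F : Set E) : Prop :=
  ∃ s : Finset E, AffineIndependent ℝ (fun x : s => (x : E)) ∧ F = convexHull ℝ (s : Set E)

/-- `P` is a simplicial `D`-dimensional polytope. -/
def IsSimplicialPolytope (D : ℕ) (P : Set E) : Prop :=
  (∃ s : Finset E, P = convexHull ℝ (s : Set E)) ∧ polyDim P = D ∧
    ∀ F, IsProperFace P F → IsSimplex F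

/-- `f_i(P)`, the number of `i`-dimensional faces of the boundary complex of `P`. -/
def fNum (P : Set E) (i : ℤ) : ℕ :=
  {F : Set E | IsProperFace P F ∧ polyDim F = i}.ncard

/-- The `h`-polynomial `(1 - t)^D f(∂P, t / (1 - t)) = ∑ⱼ fⱼ₋₁ t^j (1 - t)^(D - j)`,
where `D = dim P`. -/
def hPoly (P : Set E) : Polynomial ℤ :=
  ∑ j ∈ Finset.range ((polyDim P).toNat + 1),
    Polynomial.C (fNum P ((j : ℤ) - 1) : ℤ) * Polynomial.X ^ j *
      (1 - Polynomial.X) ^ ((polyDim P).toNat - j)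

/-- The entries `h_i(P)` of the `h`-vector. -/
def hNum (P : Set E) (i : ℕ) : ℤ := (hPoly P).coeff i

/-- The entries of the simplicial `g`-vector: `g_0 = h_0` and `g_i = h_i - h_{i-1}`. -/
def gNum (P : Set E) (i : ℕ) : ℤ :=
  if i = 0 then hNum P 0 else hNum P i - hNum P (i - 1)

end Faces

/-! ### McMullen–Walkup polytopes -/

/-- The moment curve `t ↦ (t, t², …, t^K)`. -/
def momentCurve (K : ℕ) (t : ℝ) : EuclideanSpace ℝ (Fin K) :=
  WithLp.toLp 2 (fun j : Fin K => t ^ ((j : ℕ) + 1))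

/-- The data of a McMullen–Walkup polytope `MW(K, D, N)` in `ℝ^D`: a cyclic `K`-polytope `C` with
`N - D + K` vertices, placed in `ℝ^D` by an injective affine map, and a `(D - K)`-simplex `T`
whose relative interior meets the affine hull of `C` exactly in the last vertex of `C`. -/
structure MWPolytope (K D N : ℕ) where
  two_le : 2 ≤ K
  le_dim : K ≤ D
  dim_lt : D < N
  /-- the parameters on the moment curve -/
  param : Fin (N - D + K) → ℝ
  param_strictMono : StrictMono param
  /-- the placement of the cyclic polytope in `ℝ^D` -/
  place : EuclideanSpace ℝ (Fin K) →ᵃ[ℝ] EuclideanSpace ℝ (Fin D)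
  place_injective : Function.Injective place
  /-- the vertices of the simplex `T` -/
  simplexVertex : Fin (D - K + 1) → EuclideanSpace ℝ (Fin D)
  simplexVertex_indep : AffineIndependent ℝ simplexVertex
  relint_inter : intrinsicInterior ℝ (convexHull ℝ (Set.range simplexVertex)) ∩
      (affineSpan ℝ (Set.range fun j => place (momentCurve K (param j))) :
        Set (EuclideanSpace ℝ (Fin D))) =
    {place (momentCurve K (param ⟨N - D + K - 1, by omega⟩))}

namespace MWPolytope

variable {K D N : ℕ} (P : MWPolytope K D N)

/-- The vertices of the cyclic polytope `C`, in the order of their parameters. -/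
def cyclicVertex (j : Fin (N - D + K)) : EuclideanSpace ℝ (Fin D) :=
  P.place (momentCurve K (P.param j))

/-- The polytope itself, `conv (C ∪ T)`. -/
def toSet : Set (EuclideanSpace ℝ (Fin D)) :=
  convexHull ℝ (convexHull ℝ (Set.range P.cyclicVertex) ∪
    convexHull ℝ (Set.range P.simplexVertex))

/-- The ordered vertices of `MW(K, D, N)`: first the vertices of `C` without the last one,
in their order, and then the vertices of `T`. (Indices start at `0`.) -/
def vertex (i : Fin N) : EuclideanSpace ℝ (Fin D) :=
  if h : (i : ℕ) < N - D + K - 1 then P.cyclicVertex ⟨i, by omega⟩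
  else P.simplexVertex ⟨(i : ℕ) - (N - D + K - 1), by
    have := P.two_le; have := P.le_dim; have := P.dim_lt; have := i.isLt; omega⟩

/-- `MW(K, D, N)` is the convex hull of its ordered vertex list. -/
theorem convexHull_range_vertex : convexHull ℝ (Set.range P.vertex) = P.toSet := by
  have h1 := P.two_le
  have h2 := P.le_dim
  have h3 := P.dim_lt
  have hT : Set.range P.simplexVertex ⊆ Set.range P.vertex := by
    rintro _ ⟨j, rfl⟩
    refine ⟨⟨N - D + K - 1 + j, by have := j.isLt; omega⟩, ?_⟩
    simp [vertex]
  apply Set.Subset.antisymm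
  · refine convexHull_min ?_ (convex_convexHull ℝ _)
    rintro _ ⟨i, rfl⟩
    apply subset_convexHull
    unfold vertex
    split_ifs with h
    · exact Or.inl (subset_convexHull ℝ _ ⟨_, rfl⟩)
    · exact Or.inr (subset_convexHull ℝ _ ⟨_, rfl⟩)
  · refine convexHull_min ?_ (convex_convexHull ℝ _)
    refine Set.union_subset ?_ (convexHull_mono hT)
    refine convexHull_min ?_ (convex_convexHull ℝ _)
    rintro _ ⟨j, rfl⟩
    by_cases hj : (j : ℕ) < N - D + K - 1
    · refine subset_convexHull ℝ _ ⟨⟨j, by omega⟩, ?_⟩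
      simp [vertex, hj]
    · have hj' : j = ⟨N - D + K - 1, by omega⟩ := by
        ext; have := j.isLt; simp; omega
      rw [hj']
      have hx : P.cyclicVertex ⟨N - D + K - 1, by omega⟩ ∈
          intrinsicInterior ℝ (convexHull ℝ (Set.range P.simplexVertex)) := by
        have := P.relint_inter.symm.subset rfl
        exact this.1
      exact convexHull_mono hT (intrinsicInterior_subset hx)

end MWPolytope

/-! ### Lexicographic subdivisions and diamonds

Throughout, `v 0, v 1, …, v (m - 1)` is the ordered vertex list of a polytope `P`, so that the
vertex called `v_i` in one-based numbering is `v (i - 1)`. -/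

section Diamonds

variable {E : Type*} [NormedAddCommGroup E] [NormedSpace ℝ E] {m : ℕ}

/-- The polytope `P_j` spanned by all vertices but the first `j` ones. -/
def tailPolytope (v : Fin m → E) (j : ℕ) : Set E :=
  convexHull ℝ (v '' {i | j ≤ (i : ℕ)})

/-- The maximal cells of the `a`-th lexicographic subdivision: push the first `a - 1` vertices
one after the other, and then pull the `a`-th one. Pushing the first vertex `v j` of `P_j` creates
the pyramids with apex `v j` over those facets of `P_{j+1}` that are not facets of `P_j`, and the
cell `P_{j+1}`, which is subdivided further. Pulling the first vertex `v j` of `P_j` creates the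
pyramids with apex `v j` over the facets of `P_j` that do not contain `v j`. -/
def lexCells (v : Fin m → E) (a : ℕ) : Set (Set E) :=
  {S | (∃ j : Fin m, (j : ℕ) + 1 < a ∧ ∃ F, IsFacet (tailPolytope v (j + 1)) F ∧
          ¬ IsFacet (tailPolytope v j) F ∧ S = convexHull ℝ (insert (v j) F)) ∨
       (∃ j : Fin m, (j : ℕ) + 1 = a ∧ ∃ F, IsFacet (tailPolytope v j) F ∧
          v j ∉ F ∧ S = convexHull ℝ (insert (v j) F))}

/-- The maximal cells of the polytopal subdivision of `P` induced by the heights `w`: the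
full-dimensional projections of the faces of the lower envelope of the lifted points
`(w i, v i)`, each cut out by an affine function that supports the lifted points from below. -/
def inducedCells (v : Fin m → E) (w : Fin m → ℝ) : Set (Set E) :=
  {S | affineSpan ℝ S = ⊤ ∧ ∃ l : E →ᵃ[ℝ] ℝ, (∀ i, l (v i) ≤ w i) ∧
    S = convexHull ℝ (v '' {i | l (v i) = w i})}

/-- Heights `w_1 > ⋯ > w_{a-1} > 0 > w_a`, `w_{a+1} = ⋯ = w_m = 0` that induce the `a`-th
lexicographic subdivision. -/
structure IsLexHeights (v : Fin m → E) (a : ℕ) (w : Fin m → ℝ) : Prop where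
  anti : ∀ i j : Fin m, i < j → (j : ℕ) + 1 < a → w j < w i
  pos : ∀ i : Fin m, (i : ℕ) + 1 < a → 0 < w i
  neg : ∀ i : Fin m, (i : ℕ) + 1 = a → w i < 0
  zero : ∀ i : Fin m, a < (i : ℕ) + 1 → w i = 0
  induces : inducedCells v w = lexCells v a

/-- The diamond with heights `w` and apex `p`: the convex hull of `p` and the lifted vertices. -/
def diamond (v : Fin m → E) (w : Fin m → ℝ) (p : ℝ × E) : Set (ℝ × E) :=
  convexHull ℝ (insert p (Set.range fun i => (w i, v i)))

end Diamonds

end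

end LexDiamond

/-!
The diamond is a simplicial polytope, so its `g`-vector is a property of the simplicial complex of
its faces. All geometry is therefore translated into statements on index sets of vertices, and the
`h`-polynomials of the resulting complexes are then computed.

Geometry. Faces of a polytope spanned by points `x i` are zero sets of nonnegative affine
functionals (`IsFaceSet`, `IsFacetSet`), and cells of a regular subdivision are contact sets of
affine functionals with the heights (`IsLowerCell`). One fact on very high points (`HighApex`)
carries everything: if a point `o` is lifted high enough over a configuration, then the facets of
the lifted polytope through `o` are the pyramids over the facets of the base, the other ones are
the lower cells, and the lower cells through `o` are the pyramids over the facets that are visible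
from `o`. The latter is pushing: it gives the existence of lexicographic heights by backwards
induction (`exists_lexHeights`). The former describes the boundary of the diamond: it is the
lexicographic subdivision, together with the cone from the apex over the boundary complex of `P`
(`IsCurveModel.mem_diamondFaces_iff`).

Facets of the tails. The first `m` vertices of `P = MW(2k, D, N)` are those of the cyclic polytope
without its last one, which is a convex combination with positive coefficients of the remaining
vertices of `P`, those of the simplex `T`. On the curve an affine functional is a polynomial of
degree at most `2k`, so Gale's evenness argument applies to all tails `j, …, N - 1`
(`IsCurveModel.isFacetSet_iff`): the facets are unions of `k` pairs of adjacent elements of `[j,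
m)` with a facet of `T`, and the sets `T ∪ {j} ∪ S` and `T ∪ {m - 1} ∪ S`, where `S` is a union of
`k - 1` pairs. In particular, the facets of a tail that become visible when `j` is pushed are the
sets `T ∪ {j + 1} ∪ S` (`isBoundarySet_visible_iff`).

Counting. The complex of subsets of unions of `k` pairs in a path with `2k + q` elements has the
`h`-polynomial `G k q = ∑ ((q multichoose i)) t ^ i`, over `i ≤ k` (`hSum_pairFaces`), by Pascal's
rule `G k (q + 1) = G k q + t G (k - 1) (q + 1)`. Joins multiply and cones preserve
`h`-polynomials. Hence each push adds `(1 - t) t G (k - 1) (q + 1)` to the lexicographic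
subdivision, which turns `(1 - t) G k q` into `(1 - t) G k (q + 1)`, whereas the final pull
replaces `(1 - t) G k (n - d + 1 - a)` by its part of degree at most `k`, up to terms of high
degree (`hSum_lexFaces`). The cone over the boundary of `P` contributes `t G k (n - d)`, again up
to terms of high degree: here neighborliness of the cyclic polytope enters
(`X_pow_dvd_hSum_linkFaces_sub`). In total, `(1 - t) h(t) = G k (n - d) + ((n - d + 1 - a
multichoose k)) t ^ (k + 1)`, up to terms of degree above half the dimension
(`IsCurveModel.exists_hPoly_diamond`), and the coefficients on the left-hand side are the numbers
`g i`.
-/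

namespace LexDiamond

open Module

/-! ### Affine functionals on point configurations -/

section Functionals

variable {E : Type*} [NormedAddCommGroup E] [NormedSpace ℝ E] {ι : Type*}

/-- The points `x i`, `i ∈ Z`, affinely span the whole space, phrased dually: no nonzero affine
functional vanishes on all of them. -/
def Spans (x : ι → E) (Z : Finset ι) : Prop :=
  ∀ B : E →ᵃ[ℝ] ℝ, (∀ i ∈ Z, B (x i) = 0) → B = 0

/-- `S` indexes the points of a face of the polytope spanned by the points `x i`, `i ∈ I`: it is
the zero set of an affine functional that is nonnegative on the points. -/
def IsFaceSet (x : ι → E) (I S : Finset ι) : Prop :=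
  S ⊆ I ∧ ∃ A : E →ᵃ[ℝ] ℝ, (∀ i ∈ I, 0 ≤ A (x i)) ∧ ∀ i ∈ I, A (x i) = 0 ↔ i ∈ S

/-- `A` is a functional defining the facet with index set `Z` of the polytope spanned by the points
`x i`, `i ∈ I`. That the points of `Z` span a hyperplane is phrased dually: up to scaling, `A` is
the only affine functional vanishing on them. -/
structure DefinesFacet (x : ι → E) (I Z : Finset ι) (A : E →ᵃ[ℝ] ℝ) : Prop where
  subset : Z ⊆ I
  ne_zero : A ≠ 0
  nonneg : ∀ i ∈ I, 0 ≤ A (x i)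
  eq_zero_iff : ∀ i ∈ I, A (x i) = 0 ↔ i ∈ Z
  unique : ∀ B : E →ᵃ[ℝ] ℝ, (∀ i ∈ Z, B (x i) = 0) → ∃ c : ℝ, B = c • A

/-- `Z` indexes the points of a facet of the polytope spanned by the points `x i`, `i ∈ I`. -/
def IsFacetSet (x : ι → E) (I Z : Finset ι) : Prop :=
  ∃ A, DefinesFacet x I Z A

/-- Every facet of the polytope spanned by the points `x i`, `i ∈ I`, contains only as many of the
points as are needed to span it. -/
def Simplicial (x : ι → E) (I : Finset ι) : Prop :=
  ∀ Z, IsFacetSet x I Z → Z.card = finrank ℝ E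

/-- Evaluation of affine functionals at the points `x i`, `i ∈ Z`. -/
def evalMap (x : ι → E) (Z : Finset ι) : (E →ᵃ[ℝ] ℝ) →ₗ[ℝ] (Z → ℝ) where
  toFun A i := A (x i)
  map_add' _ _ := rfl
  map_smul' _ _ := rfl

theorem mem_ker_evalMap {x : ι → E} {Z : Finset ι} {B : E →ᵃ[ℝ] ℝ} :
    B ∈ LinearMap.ker (evalMap x Z) ↔ ∀ i ∈ Z, B (x i) = 0 := by
  rw [LinearMap.mem_ker, funext_iff]
  simp [evalMap]

theorem Spans.nonempty {x : ι → E} {Z : Finset ι} (h : Spans x Z) : Z.Nonempty := by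
  by_contra hZ
  rw [Finset.not_nonempty_iff_eq_empty] at hZ
  subst hZ
  have h1 := h (AffineMap.const ℝ E 1) (by simp)
  have := congrArg (fun f : E →ᵃ[ℝ] ℝ => f 0) h1
  simp at this

theorem Spans.exists_ne_zero {x : ι → E} {Z : Finset ι} (h : Spans x Z) {B : E →ᵃ[ℝ] ℝ}
    (hB : B ≠ 0) : ∃ i ∈ Z, B (x i) ≠ 0 := by
  by_contra! hc
  exact hB (h B hc)

theorem DefinesFacet.pos {x : ι → E} {I Z : Finset ι} {A : E →ᵃ[ℝ] ℝ} (h : DefinesFacet x I Z A)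
    {i : ι} (hi : i ∈ I) (hiZ : i ∉ Z) : 0 < A (x i) :=
  lt_of_le_of_ne (h.nonneg i hi) fun h0 => hiZ ((h.eq_zero_iff i hi).1 h0.symm)

theorem DefinesFacet.zero {x : ι → E} {I Z : Finset ι} {A : E →ᵃ[ℝ] ℝ} (h : DefinesFacet x I Z A)
    {i : ι} (hi : i ∈ Z) : A (x i) = 0 :=
  (h.eq_zero_iff i (h.subset hi)).2 hi

theorem IsFacetSet.isFaceSet {x : ι → E} {I Z : Finset ι} (h : IsFacetSet x I Z) :
    IsFaceSet x I Z := by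
  obtain ⟨A, hA⟩ := h
  exact ⟨hA.subset, A, hA.nonneg, hA.eq_zero_iff⟩

/-- The index of a facet is a proper subset of the index set of the polytope. -/
theorem DefinesFacet.exists_notMem {x : ι → E} {I Z : Finset ι} {A : E →ᵃ[ℝ] ℝ}
    (h : DefinesFacet x I Z A) (hI : Spans x I) : ∃ i ∈ I, i ∉ Z := by
  obtain ⟨i, hi, h0⟩ := hI.exists_ne_zero h.ne_zero
  exact ⟨i, hi, fun hz => h0 (h.zero hz)⟩

/-- If an affine functional vanishes on `S` without being a multiple of the functional `A`
supporting the face `S`, then `A` can be tilted until its zero set grows. -/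
theorem exists_larger_faceSet {x : ι → E} {I S : Finset ι} (hI : Spans x I) {A B : E →ᵃ[ℝ] ℝ}
    (hA : ∀ i ∈ I, 0 ≤ A (x i)) (hAS : ∀ i ∈ I, A (x i) = 0 ↔ i ∈ S) (hSI : S ⊆ I) (hA0 : A ≠ 0)
    (hB : ∀ i ∈ S, B (x i) = 0) (hBA : ∀ c : ℝ, B ≠ c • A) :
    ∃ S', S ⊂ S' ∧ IsFaceSet x I S' ∧ S' ≠ I := by
  classical
  obtain ⟨i₀, hi₀, hAi₀⟩ := hI.exists_ne_zero hA0
  set B₁ : E →ᵃ[ℝ] ℝ := B - (B (x i₀) / A (x i₀)) • A with hB₁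
  have hB₁0 : B₁ ≠ 0 := fun h => hBA _ (sub_eq_zero.1 h)
  have hB₁S : ∀ i ∈ S, B₁ (x i) = 0 := fun i hi => by
    simp [hB₁, hB i hi, (hAS i (hSI hi)).2 hi]
  have hB₁i₀ : B₁ (x i₀) = 0 := by
    simp only [hB₁, AffineMap.coe_sub, AffineMap.coe_smul, Pi.sub_apply, Pi.smul_apply,
      smul_eq_mul]
    field_simp
    ring
  -- up to replacing the functional by its negative, it is negative at some point
  obtain ⟨B₂, hB₂S, hB₂i₀, hneg⟩ : ∃ B₂ : E →ᵃ[ℝ] ℝ, (∀ i ∈ S, B₂ (x i) = 0) ∧ B₂ (x i₀) = 0 ∧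
      ∃ i ∈ I, B₂ (x i) < 0 := by
    obtain ⟨i, hi, h⟩ := hI.exists_ne_zero hB₁0
    rcases lt_or_gt_of_ne h with h | h
    · exact ⟨B₁, hB₁S, hB₁i₀, i, hi, h⟩
    · exact ⟨-B₁, fun j hj => by simp [hB₁S j hj], by simp [hB₁i₀], i, hi, by simpa using h⟩
  have hne : (I.filter fun i => B₂ (x i) < 0).Nonempty := by
    obtain ⟨i, hi, h⟩ := hneg
    exact ⟨i, Finset.mem_filter.2 ⟨hi, h⟩⟩
  obtain ⟨i₁, hi₁, hmin⟩ := Finset.exists_min_image _ (fun i => A (x i) / -B₂ (x i)) hne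
  rw [Finset.mem_filter] at hi₁
  set t := A (x i₁) / -B₂ (x i₁) with ht
  have ht0 : 0 ≤ t := div_nonneg (hA i₁ hi₁.1) (by linarith [hi₁.2])
  have hval : ∀ i, (A + t • B₂) (x i) = A (x i) + t * B₂ (x i) := fun i => by simp
  refine ⟨I.filter fun i => (A + t • B₂) (x i) = 0, ?_, ⟨Finset.filter_subset _ _, A + t • B₂,
    fun i hi => ?_, fun i hi => by simp [hi]⟩, ?_⟩
  · rw [Finset.ssubset_iff_of_subset]
    · refine ⟨i₁, Finset.mem_filter.2 ⟨hi₁.1, ?_⟩, fun h => ?_⟩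
      · rw [hval, ht]
        have := hi₁.2.ne
        field_simp
        ring
      · exact hi₁.2.ne (hB₂S _ h)
    · intro i hi
      exact Finset.mem_filter.2 ⟨hSI hi, by rw [hval, (hAS i (hSI hi)).2 hi, hB₂S i hi]; simp⟩
  · rw [hval]
    by_cases h : B₂ (x i) < 0
    · have := hmin i (Finset.mem_filter.2 ⟨hi, h⟩)
      rw [le_div_iff₀ (by linarith)] at this
      linarith
    · have := mul_nonneg ht0 (not_lt.1 h)
      linarith [hA i hi]
  · intro h
    have : i₀ ∈ I.filter fun i => (A + t • B₂) (x i) = 0 := by rw [h]; exact hi₀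
    rw [Finset.mem_filter, hval, hB₂i₀] at this
    exact hAi₀ (by simpa using this.2)

/-- Every proper face is contained in a facet. -/
theorem exists_facetSet_superset {x : ι → E} {I : Finset ι} (hI : Spans x I) {S : Finset ι}
    (hS : IsFaceSet x I S) (hSI : S ≠ I) : ∃ Z, IsFacetSet x I Z ∧ S ⊆ Z := by
  induction hn : I.card - S.card using Nat.strong_induction_on generalizing S with
  | _ n ih =>
    obtain ⟨hsub, A, hA, hAS⟩ := hS
    have hA0 : A ≠ 0 := by
      rintro rfl
      exact hSI (Finset.Subset.antisymm hsub fun i hi => (hAS i hi).1 rfl)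
    by_cases hu : ∀ B : E →ᵃ[ℝ] ℝ, (∀ i ∈ S, B (x i) = 0) → ∃ c : ℝ, B = c • A
    · exact ⟨S, ⟨A, hsub, hA0, hA, hAS, hu⟩, subset_rfl⟩
    · push Not at hu
      obtain ⟨B, hB, hBA⟩ := hu
      obtain ⟨S', hSS', hS', hS'I⟩ := exists_larger_faceSet hI hA hAS hsub hA0 hB hBA
      have h1 := Finset.card_lt_card hSS'
      have h2 := Finset.card_le_card hS'.1
      obtain ⟨Z, hZ, hSZ⟩ := ih (I.card - S'.card) (by omega) hS' hS'I rfl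
      exact ⟨Z, hZ, hSS'.subset.trans hSZ⟩

theorem finrank_range_evalMap_le (x : ι → E) (Z : Finset ι) :
    finrank ℝ (LinearMap.range (evalMap x Z)) ≤ Z.card := by
  simpa using Submodule.finrank_le (LinearMap.range (evalMap x Z))

theorem finrank_ker_evalMap_le_one {x : ι → E} {Z : Finset ι} {A : E →ᵃ[ℝ] ℝ}
    (h : ∀ B : E →ᵃ[ℝ] ℝ, (∀ i ∈ Z, B (x i) = 0) → ∃ c : ℝ, B = c • A) :
    finrank ℝ (LinearMap.ker (evalMap x Z)) ≤ 1 := by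
  have hle : LinearMap.ker (evalMap x Z) ≤ Submodule.span ℝ {A} := by
    intro B hB
    obtain ⟨c, rfl⟩ := h B (mem_ker_evalMap.1 hB)
    exact Submodule.smul_mem _ _ (Submodule.mem_span_singleton_self A)
  exact (Submodule.finrank_mono hle).trans ((finrank_span_le_card _).trans (by simp))

variable [FiniteDimensional ℝ E]

theorem finrank_affineFunctional : finrank ℝ (E →ᵃ[ℝ] ℝ) = finrank ℝ E + 1 := by
  simp [AffineMap.finrank_eq]

theorem finrank_ker_evalMap (x : ι → E) (Z : Finset ι) :
    finrank ℝ (LinearMap.range (evalMap x Z)) + finrank ℝ (LinearMap.ker (evalMap x Z)) =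
      finrank ℝ E + 1 := by
  rw [LinearMap.finrank_range_add_finrank_ker, finrank_affineFunctional]

/-- Through at most `dim E` points there is a hyperplane. -/
theorem exists_vanishing_of_card_le (x : ι → E) (Z : Finset ι) (hZ : Z.card ≤ finrank ℝ E) :
    ∃ B : E →ᵃ[ℝ] ℝ, B ≠ 0 ∧ ∀ i ∈ Z, B (x i) = 0 := by
  have h1 := finrank_ker_evalMap x Z
  have h2 := finrank_range_evalMap_le x Z
  have h3 : 0 < finrank ℝ (LinearMap.ker (evalMap x Z)) := by omega
  rw [finrank_pos_iff_exists_ne_zero] at h3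
  obtain ⟨⟨B, hB⟩, hB0⟩ := h3
  exact ⟨B, fun h => hB0 (Subtype.ext h), mem_ker_evalMap.1 hB⟩

theorem Spans.finrank_lt_card {x : ι → E} {Z : Finset ι} (h : Spans x Z) :
    finrank ℝ E < Z.card := by
  by_contra! hc
  obtain ⟨B, hB, hB0⟩ := exists_vanishing_of_card_le x Z hc
  exact hB (h B hB0)

theorem finrank_le_card_of_unique {x : ι → E} {Z : Finset ι} {A : E →ᵃ[ℝ] ℝ}
    (h : ∀ B : E →ᵃ[ℝ] ℝ, (∀ i ∈ Z, B (x i) = 0) → ∃ c : ℝ, B = c • A) :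
    finrank ℝ E ≤ Z.card := by
  have h1 := finrank_ker_evalMap x Z
  have h2 := finrank_range_evalMap_le x Z
  have h3 := finrank_ker_evalMap_le_one h
  omega

/-- On a facet with as few points as possible, affine functionals take arbitrary values. -/
theorem exists_extension {x : ι → E} {Z : Finset ι} {A : E →ᵃ[ℝ] ℝ}
    (h : ∀ B : E →ᵃ[ℝ] ℝ, (∀ i ∈ Z, B (x i) = 0) → ∃ c : ℝ, B = c • A)
    (hZ : Z.card = finrank ℝ E) (f : ι → ℝ) :
    ∃ m : E →ᵃ[ℝ] ℝ, ∀ i ∈ Z, m (x i) = f i := by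
  have h1 := finrank_ker_evalMap x Z
  have h2 := finrank_range_evalMap_le x Z
  have h3 := finrank_ker_evalMap_le_one h
  have htop : LinearMap.range (evalMap x Z) = ⊤ := by
    apply Submodule.eq_top_of_finrank_eq
    simp only [finrank_fintype_fun_eq_card, Fintype.card_coe]
    omega
  obtain ⟨m, hm⟩ := LinearMap.range_eq_top.1 htop (fun i => f i)
  exact ⟨m, fun i hi => congrFun hm ⟨i, hi⟩⟩

/-- In a simplicial polytope every subset of a facet is a face. -/
theorem Simplicial.isFaceSet {x : ι → E} {I Z S : Finset ι} (hs : Simplicial x I)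
    (hZ : IsFacetSet x I Z) (hSZ : S ⊆ Z) : IsFaceSet x I S := by
  classical
  have hcard := hs Z hZ
  obtain ⟨A, hA⟩ := hZ
  obtain ⟨m, hm⟩ := exists_extension hA.unique hcard (fun i => if i ∈ S then 0 else 1)
  -- `m` is positive on `Z \ S`, and a large multiple of `A` makes up for its values elsewhere
  obtain ⟨t, ht⟩ : ∃ t : ℝ, ∀ i ∈ I \ Z, 0 < m (x i) + t * A (x i) := by
    have : ∀ᶠ t : ℝ in Filter.atTop, ∀ i ∈ I \ Z, 0 < m (x i) + t * A (x i) := by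
      rw [Filter.eventually_all_finset]
      intro i hi
      rw [Finset.mem_sdiff] at hi
      have hpos := hA.pos hi.1 hi.2
      filter_upwards [Filter.eventually_gt_atTop (-m (x i) / A (x i))] with t ht
      rw [div_lt_iff₀ hpos] at ht
      linarith
    exact this.exists
  have hval : ∀ i, (m + t • A) (x i) = m (x i) + t * A (x i) := fun i => by simp
  refine ⟨hSZ.trans hA.subset, m + t • A, fun i hi => ?_, fun i hi => ?_⟩
  · rw [hval]
    by_cases hiZ : i ∈ Z
    · rw [hA.zero hiZ, hm i hiZ]
      split_ifs <;> simp
    · exact (ht i (Finset.mem_sdiff.2 ⟨hi, hiZ⟩)).le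
  · rw [hval]
    by_cases hiZ : i ∈ Z
    · rw [hA.zero hiZ, hm i hiZ]
      split_ifs with h <;> simp [h]
    · exact ⟨fun h => absurd h (ht i (Finset.mem_sdiff.2 ⟨hi, hiZ⟩)).ne',
        fun h => absurd (hSZ h) hiZ⟩

theorem Simplicial.affineIndependent {x : ι → E} {I Z : Finset ι} (hs : Simplicial x I)
    (hZ : IsFacetSet x I Z) : AffineIndependent ℝ fun i : Z => x i := by
  classical
  have hcard := hs Z hZ
  obtain ⟨A, hA⟩ := hZ
  rw [affineIndependent_iff]
  intro s w hw hwx i hi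
  obtain ⟨m, hm⟩ := exists_extension hA.unique hcard (fun j => if j = i then 1 else 0)
  have hlin : ∑ j ∈ s, w j * m (x j) = 0 := by
    have h1 : ∀ j : Z, m (x j) = m.linear (x j) + m 0 := fun j => by
      conv_lhs => rw [AffineMap.decomp m]
      simp
    simp only [h1, mul_add, Finset.sum_add_distrib, ← Finset.sum_mul, hw, zero_mul, add_zero]
    have := congrArg m.linear hwx
    simpa using this
  rw [Finset.sum_eq_single i] at hlin
  · simpa [hm i i.2] using hlin
  · intro j _ hji
    rw [hm j j.2, if_neg (fun h => hji (Subtype.ext h)), mul_zero]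
  · exact fun h => absurd hi h

end Functionals

end LexDiamond

namespace LexDiamond

open Module

/-! ### Faces of a polytope as index sets -/

section Polytopes

variable {E : Type*} [NormedAddCommGroup E] [NormedSpace ℝ E] {ι : Type*}

/-- The polytope spanned by the points `x i`, `i ∈ Z`. -/
def hull (x : ι → E) (Z : Finset ι) : Set E := convexHull ℝ (x '' Z)

theorem mem_hull {x : ι → E} {Z : Finset ι} {i : ι} (hi : i ∈ Z) : x i ∈ hull x Z :=
  subset_convexHull ℝ _ ⟨i, hi, rfl⟩

theorem hull_mono {x : ι → E} {Z Z' : Finset ι} (h : Z ⊆ Z') : hull x Z ⊆ hull x Z' :=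
  convexHull_mono (Set.image_mono (Finset.coe_subset.2 h))

theorem mem_hull_iff {x : ι → E} {Z : Finset ι} {y : E} :
    y ∈ hull x Z ↔ ∃ c : ι → ℝ, (∀ i ∈ Z, 0 ≤ c i) ∧ ∑ i ∈ Z, c i = 1 ∧ ∑ i ∈ Z, c i • x i = y := by
  classical
  constructor
  · intro hy
    have : hull x Z ⊆ {y | ∃ c : ι → ℝ, (∀ i ∈ Z, 0 ≤ c i) ∧ ∑ i ∈ Z, c i = 1 ∧
        ∑ i ∈ Z, c i • x i = y} := by
      refine convexHull_min ?_ ?_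
      · rintro _ ⟨i, hi, rfl⟩
        refine ⟨fun j => if j = i then 1 else 0, fun j _ => by dsimp only; split_ifs <;> simp,
          ?_, ?_⟩
        · simpa using hi
        · simpa using fun h : i ∉ Z => absurd (Finset.mem_coe.1 hi) h
      · rintro _ ⟨c, hc, hc1, rfl⟩ _ ⟨d, hd, hd1, rfl⟩ a b ha hb hab
        refine ⟨fun i => a * c i + b * d i, fun i hi =>
          add_nonneg (mul_nonneg ha (hc i hi)) (mul_nonneg hb (hd i hi)), ?_, ?_⟩
        · rw [Finset.sum_add_distrib, ← Finset.mul_sum, ← Finset.mul_sum, hc1, hd1]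
          simpa using hab
        · simp only [add_smul, Finset.sum_add_distrib, Finset.smul_sum, smul_smul]
    exact this hy
  · rintro ⟨c, hc, hc1, rfl⟩
    exact (convex_convexHull ℝ _).sum_mem hc hc1 fun i hi => mem_hull hi

theorem affine_apply_sum (A : E →ᵃ[ℝ] ℝ) {Z : Finset ι} {c : ι → ℝ} (hc : ∑ i ∈ Z, c i = 1)
    (x : ι → E) : A (∑ i ∈ Z, c i • x i) = ∑ i ∈ Z, c i * A (x i) := by
  have h : ∀ y : E, A y = A.linear y + A 0 := fun y => by
    conv_lhs => rw [AffineMap.decomp A]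
    simp
  have h' : ∀ i ∈ Z, c i * A (x i) = A.linear (c i • x i) + c i * A 0 := fun i _ => by
    rw [h (x i), mul_add, map_smul, smul_eq_mul]
  rw [h, map_sum, Finset.sum_congr rfl h', Finset.sum_add_distrib, ← Finset.sum_mul, hc, one_mul]

theorem affine_nonneg_of_mem_hull {A : E →ᵃ[ℝ] ℝ} {x : ι → E} {Z : Finset ι}
    (hA : ∀ i ∈ Z, 0 ≤ A (x i)) {y : E} (hy : y ∈ hull x Z) : 0 ≤ A y := by
  obtain ⟨c, hc, hc1, rfl⟩ := mem_hull_iff.1 hy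
  rw [affine_apply_sum A hc1]
  exact Finset.sum_nonneg fun i hi => mul_nonneg (hc i hi) (hA i hi)

theorem affine_pos_of_mem_hull {A : E →ᵃ[ℝ] ℝ} {x : ι → E} {Z : Finset ι}
    (hA : ∀ i ∈ Z, 0 < A (x i)) {y : E} (hy : y ∈ hull x Z) : 0 < A y := by
  obtain ⟨c, hc, hc1, rfl⟩ := mem_hull_iff.1 hy
  rw [affine_apply_sum A hc1]
  obtain ⟨i, hi, h⟩ : ∃ i ∈ Z, 0 < c i := by
    by_contra! hcon
    have := Finset.sum_nonpos hcon
    linarith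
  exact Finset.sum_pos' (fun i hi => mul_nonneg (hc i hi) (hA i hi).le)
    ⟨i, hi, mul_pos h (hA i hi)⟩

theorem affine_zero_of_mem_hull {A : E →ᵃ[ℝ] ℝ} {x : ι → E} {Z : Finset ι}
    (hA : ∀ i ∈ Z, A (x i) = 0) {y : E} (hy : y ∈ hull x Z) : A y = 0 := by
  obtain ⟨c, hc, hc1, rfl⟩ := mem_hull_iff.1 hy
  rw [affine_apply_sum A hc1]
  exact Finset.sum_eq_zero fun i hi => by rw [hA i hi, mul_zero]

/-- The zero set on a polytope of a functional that is nonnegative on its points. -/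
theorem mem_hull_zeroSet_iff {A : E →ᵃ[ℝ] ℝ} {x : ι → E} {I S : Finset ι} (hSI : S ⊆ I)
    (hA : ∀ i ∈ I, 0 ≤ A (x i)) (hAS : ∀ i ∈ I, A (x i) = 0 ↔ i ∈ S) {y : E} :
    y ∈ hull x S ↔ y ∈ hull x I ∧ A y = 0 := by
  classical
  constructor
  · exact fun hy => ⟨hull_mono hSI hy,
      affine_zero_of_mem_hull (fun i hi => (hAS i (hSI hi)).2 hi) hy⟩
  · rintro ⟨hy, hAy⟩
    obtain ⟨c, hc, hc1, rfl⟩ := mem_hull_iff.1 hy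
    rw [affine_apply_sum A hc1, Finset.sum_eq_zero_iff_of_nonneg
      fun i hi => mul_nonneg (hc i hi) (hA i hi)] at hAy
    have hc0 : ∀ i ∈ I, i ∉ S → c i = 0 := fun i hi hiS =>
      (mul_eq_zero.1 (hAy i hi)).resolve_right fun h => hiS ((hAS i hi).1 h)
    refine mem_hull_iff.2 ⟨c, fun i hi => hc i (hSI hi), ?_, ?_⟩
    · rw [← hc1]
      exact Finset.sum_subset hSI hc0
    · exact Finset.sum_subset hSI fun i hi hiS => by rw [hc0 i hi hiS, zero_smul]

theorem IsFaceSet.mem_iff {x : ι → E} {I S : Finset ι} (hS : IsFaceSet x I S) {i : ι}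
    (hi : i ∈ I) : x i ∈ hull x S ↔ i ∈ S := by
  obtain ⟨hSI, A, hA, hAS⟩ := hS
  rw [mem_hull_zeroSet_iff hSI hA hAS, hAS i hi, and_iff_right (mem_hull hi)]

theorem IsFaceSet.hull_injective {x : ι → E} {I S S' : Finset ι} (hS : IsFaceSet x I S)
    (hS' : IsFaceSet x I S') (h : hull x S = hull x S') : S = S' := by
  ext i
  constructor
  · exact fun hi => (hS'.mem_iff (hS.1 hi)).1 (h ▸ mem_hull hi)
  · exact fun hi => (hS.mem_iff (hS'.1 hi)).1 (h ▸ mem_hull hi)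

theorem hull_empty (x : ι → E) : hull x ∅ = ∅ := by simp [hull]

theorem hull_eq_empty_iff {x : ι → E} {S : Finset ι} : hull x S = ∅ ↔ S = ∅ := by
  constructor
  · intro h
    by_contra hS
    obtain ⟨i, hi⟩ := Finset.nonempty_iff_ne_empty.2 hS
    have := mem_hull (x := x) hi
    rw [h] at this
    exact this
  · rintro rfl
    exact hull_empty x

theorem isProperFace_hull_iff [FiniteDimensional ℝ E] {x : ι → E} {I : Finset ι}
    {F : Set E} (hI : I.Nonempty) :
    IsProperFace (hull x I) F ↔ ∃ S, IsFaceSet x I S ∧ S ≠ I ∧ F = hull x S := by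
  classical
  constructor
  · rintro ⟨hexp, hne⟩
    rcases F.eq_empty_or_nonempty with rfl | hF
    · refine ⟨∅, ⟨Finset.empty_subset _, AffineMap.const ℝ E 1, by simp, by simp⟩, ?_,
        (hull_empty x).symm⟩
      rintro rfl
      exact hI.ne_empty rfl
    · obtain ⟨l, rfl⟩ := hexp hF
      obtain ⟨y₀, hy₀, hmax⟩ := hF
      let A : E →ᵃ[ℝ] ℝ := AffineMap.const ℝ E (l y₀) - (l : E →ₗ[ℝ] ℝ).toAffineMap
      have hAv : ∀ y, A y = l y₀ - l y := fun y => by simp [A]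
      have hA : ∀ i ∈ I, 0 ≤ A (x i) := fun i hi => by
        rw [hAv]
        linarith [hmax _ (mem_hull (x := x) hi)]
      have hS : IsFaceSet x I (I.filter fun i => A (x i) = 0) :=
        ⟨Finset.filter_subset _ _, A, hA, fun i hi => by simp [hi]⟩
      have heq : {y | y ∈ hull x I ∧ ∀ z ∈ hull x I, l z ≤ l y} =
          hull x (I.filter fun i => A (x i) = 0) := by
        ext y
        rw [mem_hull_zeroSet_iff (Finset.filter_subset _ _) hA (fun i hi => by simp [hi]), hAv]
        constructor
        · exact fun h => ⟨h.1, by linarith [hmax y h.1, h.2 y₀ hy₀]⟩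
        · exact fun h => ⟨h.1, fun z hz => by linarith [hmax z hz, h.2]⟩
      exact ⟨_, hS, fun h => hne (heq.trans (by rw [h])), heq⟩
  · rintro ⟨S, hS, hSI, rfl⟩
    refine ⟨?_, fun h => ?_⟩
    · rintro ⟨y₀, hy₀⟩
      obtain ⟨hsub, A, hA, hAS⟩ := hS
      have hlin : ∀ y, A y = A.linear y + A 0 := fun y => by
        conv_lhs => rw [AffineMap.decomp A]
        simp
      refine ⟨LinearMap.toContinuousLinearMap (-A.linear), ?_⟩
      ext y
      rw [mem_hull_zeroSet_iff hsub hA hAS] at hy₀ ⊢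
      simp only [LinearMap.coe_toContinuousLinearMap', LinearMap.neg_apply, neg_le_neg_iff]
      constructor
      · rintro ⟨hy, hAy⟩
        refine ⟨hy, fun z hz => ?_⟩
        linarith [hlin y, hlin z, affine_nonneg_of_mem_hull hA hz]
      · rintro ⟨hy, hmax⟩
        refine ⟨hy, le_antisymm ?_ (affine_nonneg_of_mem_hull hA hy)⟩
        linarith [hlin y, hlin y₀, hmax y₀ hy₀.1, hy₀.2]
    · apply hSI
      refine Finset.Subset.antisymm hS.1 fun i hi => (hS.mem_iff hi).1 ?_
      rw [h]
      exact mem_hull hi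

theorem polyDim_hull {x : ι → E} {S : Finset ι} (hS : S.Nonempty) :
    polyDim (hull x S) = finrank ℝ (vectorSpan ℝ (x '' S)) := by
  rw [polyDim, if_neg (fun h => hS.ne_empty (hull_eq_empty_iff.1 h)), hull,
    ← direction_affineSpan, affineSpan_convexHull, direction_affineSpan]

theorem spans_iff_affineSpan {x : ι → E} {Z : Finset ι} :
    Spans x Z ↔ affineSpan ℝ (x '' Z) = ⊤ := by
  classical
  constructor
  · intro h
    obtain ⟨i₀, hi₀⟩ := h.nonempty
    have hne : (x '' (Z : Set ι)).Nonempty := ⟨x i₀, i₀, hi₀, rfl⟩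
    rw [AffineSubspace.affineSpan_eq_top_iff_vectorSpan_eq_top_of_nonempty ℝ E E hne]
    by_contra hlt
    obtain ⟨f, hf, hle⟩ := Submodule.exists_le_ker_of_lt_top _ (lt_top_iff_ne_top.2 hlt)
    have hB := h (f.toAffineMap - AffineMap.const ℝ E (f (x i₀))) fun i hi => by
      have hm : x i - x i₀ ∈ vectorSpan ℝ (x '' (Z : Set ι)) :=
        vsub_mem_vectorSpan ℝ ⟨i, hi, rfl⟩ ⟨i₀, hi₀, rfl⟩
      have := hle hm
      rw [LinearMap.mem_ker, map_sub] at this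
      simpa using this
    apply hf
    have := congrArg AffineMap.linear hB
    simpa using this
  · intro h B hB
    ext y
    have hy : y ∈ affineSpan ℝ (x '' (Z : Set ι)) := h ▸ AffineSubspace.mem_top ℝ E y
    refine affineSpan_induction (p := fun y => B y = 0) hy ?_ ?_
    · rintro _ ⟨i, hi, rfl⟩
      exact hB i hi
    · intro c u v w hu hv hw
      have : B (c • (u -ᵥ v) +ᵥ w) = c • (B u -ᵥ B v) +ᵥ B w := by
        rw [AffineMap.map_vadd, map_smul, AffineMap.linearMap_vsub]
      simpa [hu, hv, hw] using this

theorem Spans.polyDim_hull {x : ι → E} {I : Finset ι} (h : Spans x I) :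
    polyDim (hull x I) = finrank ℝ E := by
  rw [LexDiamond.polyDim_hull h.nonempty, ← direction_affineSpan, spans_iff_affineSpan.1 h,
    AffineSubspace.direction_top, finrank_top]

theorem affineIndependent_mono_finset {x : ι → E} {Z S : Finset ι}
    (h : AffineIndependent ℝ fun i : Z => x i) (hSZ : S ⊆ Z) :
    AffineIndependent ℝ fun i : S => x i :=
  h.comp_embedding ⟨fun i : S => (⟨i, hSZ i.2⟩ : Z), fun _ _ hab =>
    Subtype.ext (congrArg (fun z : Z => (z : ι)) hab)⟩

theorem polyDim_hull_of_affineIndependent {x : ι → E} {S : Finset ι}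
    (h : AffineIndependent ℝ fun i : S => x i) : polyDim (hull x S) = (S.card : ℤ) - 1 := by
  rcases S.eq_empty_or_nonempty with rfl | hS
  · simp [polyDim, hull_empty]
  · rw [polyDim_hull hS]
    have hpos := Finset.card_pos.2 hS
    have h1 : Fintype.card S = (S.card - 1) + 1 := by simp; omega
    have h2 := h.finrank_vectorSpan h1
    have h3 : Set.range (fun i : S => x i) = x '' S := by
      ext y; simp
    rw [h3] at h2
    rw [h2]
    omega

theorem isSimplex_hull_of_affineIndependent {x : ι → E} {S : Finset ι}
    (h : AffineIndependent ℝ fun i : S => x i) : IsSimplex (hull x S) := by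
  classical
  refine ⟨S.image x, ?_, by rw [hull, Finset.coe_image]⟩
  have h1 := h.range
  have h3 : Set.range (fun i : S => x i) = ((S.image x : Finset E) : Set E) := by
    ext y; simp
  rw [h3] at h1
  exact h1

section Simplicial

variable [FiniteDimensional ℝ E] {x : ι → E} {I : Finset ι}

theorem Simplicial.affineIndependent_of_subset (hs : Simplicial x I) {S Z : Finset ι}
    (hZ : IsFacetSet x I Z) (hSZ : S ⊆ Z) : AffineIndependent ℝ fun i : S => x i :=
  affineIndependent_mono_finset (hs.affineIndependent hZ) hSZ

/-- The proper faces of a simplicial polytope are the sets spanned by subsets of facets. -/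
theorem Simplicial.isProperFace_iff (hs : Simplicial x I) (hI : Spans x I) {F : Set E} :
    IsProperFace (hull x I) F ↔ ∃ S Z, IsFacetSet x I Z ∧ S ⊆ Z ∧ F = hull x S := by
  rw [isProperFace_hull_iff hI.nonempty]
  constructor
  · rintro ⟨S, hS, hSI, rfl⟩
    obtain ⟨Z, hZ, hSZ⟩ := exists_facetSet_superset hI hS hSI
    exact ⟨S, Z, hZ, hSZ, rfl⟩
  · rintro ⟨S, Z, hZ, hSZ, rfl⟩
    refine ⟨S, hs.isFaceSet hZ hSZ, ?_, rfl⟩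
    rintro rfl
    obtain ⟨A, hA⟩ := hZ
    obtain ⟨i, hi, hiZ⟩ := hA.exists_notMem hI
    exact hiZ (hSZ hi)

theorem Simplicial.isFacet_iff (hs : Simplicial x I) (hI : Spans x I) {F : Set E} :
    IsFacet (hull x I) F ↔ ∃ Z, IsFacetSet x I Z ∧ F = hull x Z := by
  rw [IsFacet, hI.polyDim_hull, hs.isProperFace_iff hI]
  constructor
  · rintro ⟨⟨S, Z, hZ, hSZ, rfl⟩, hdim⟩
    rw [polyDim_hull_of_affineIndependent (hs.affineIndependent_of_subset hZ hSZ), ← hs Z hZ]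
      at hdim
    have : S = Z := Finset.eq_of_subset_of_card_le hSZ (by omega)
    subst this
    exact ⟨S, hZ, rfl⟩
  · rintro ⟨Z, hZ, rfl⟩
    refine ⟨⟨Z, Z, hZ, subset_rfl, rfl⟩, ?_⟩
    rw [polyDim_hull_of_affineIndependent (hs.affineIndependent hZ), hs Z hZ]

theorem Simplicial.isSimplicialPolytope (hs : Simplicial x I) (hI : Spans x I) :
    IsSimplicialPolytope (finrank ℝ E) (hull x I) := by
  classical
  refine ⟨⟨I.image x, by rw [hull, Finset.coe_image]⟩, hI.polyDim_hull, fun F hF => ?_⟩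
  obtain ⟨S, Z, hZ, hSZ, rfl⟩ := (hs.isProperFace_iff hI).1 hF
  exact isSimplex_hull_of_affineIndependent (hs.affineIndependent_of_subset hZ hSZ)

/-- The face poset of a simplicial polytope is described by the simplicial complex `X` of all
subsets of facets. -/
theorem Simplicial.fNum_eq [DecidableEq ι] (hs : Simplicial x I) (hI : Spans x I)
    {X : Finset (Finset ι)} (hX : ∀ S, S ∈ X ↔ ∃ Z, IsFacetSet x I Z ∧ S ⊆ Z) (j : ℕ) :
    fNum (hull x I) ((j : ℤ) - 1) = (X.filter fun S => S.card = j).card := by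
  have hset : {F : Set E | IsProperFace (hull x I) F ∧ polyDim F = (j : ℤ) - 1} =
      hull x '' ((X.filter fun S => S.card = j : Finset (Finset ι)) : Set (Finset ι)) := by
    ext F
    simp only [Set.mem_ofPred_eq, Set.mem_image, Finset.coe_filter, hX]
    constructor
    · rintro ⟨hF, hdim⟩
      obtain ⟨S, Z, hZ, hSZ, rfl⟩ := (hs.isProperFace_iff hI).1 hF
      rw [polyDim_hull_of_affineIndependent (hs.affineIndependent_of_subset hZ hSZ)] at hdim
      exact ⟨S, ⟨⟨Z, hZ, hSZ⟩, by omega⟩, rfl⟩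
    · rintro ⟨S, ⟨⟨Z, hZ, hSZ⟩, hj⟩, rfl⟩
      refine ⟨(hs.isProperFace_iff hI).2 ⟨S, Z, hZ, hSZ, rfl⟩, ?_⟩
      rw [polyDim_hull_of_affineIndependent (hs.affineIndependent_of_subset hZ hSZ), hj]
  rw [fNum, hset, Set.InjOn.ncard_image, Set.ncard_coe_finset]
  intro S hS S' hS' h
  simp only [Finset.coe_filter, Set.mem_ofPred_eq, hX] at hS hS'
  obtain ⟨⟨Z, hZ, hSZ⟩, -⟩ := hS
  obtain ⟨⟨Z', hZ', hSZ'⟩, -⟩ := hS'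
  exact (hs.isFaceSet hZ hSZ).hull_injective (hs.isFaceSet hZ' hSZ') h

end Simplicial

end Polytopes

/-! ### The `h`-polynomial of a family of finite sets -/

section HSum

open Polynomial

variable {ι : Type*}

/-- The polynomial `∑ t ^ |S| (1 - t) ^ (n - |S|)`, over the members `S` of the family `X`. For the
family of faces of a simplicial complex of dimension `n - 1` it is the `h`-polynomial. -/
noncomputable def hSum (X : Finset (Finset ι)) (n : ℕ) : ℤ[X] :=
  ∑ S ∈ X, Polynomial.X ^ S.card * (1 - Polynomial.X) ^ (n - S.card)

theorem Simplicial.hPoly_eq {E : Type*} [NormedAddCommGroup E] [NormedSpace ℝ E]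
    [FiniteDimensional ℝ E] [DecidableEq ι] {x : ι → E} {I : Finset ι}
    (hs : Simplicial x I) (hI : Spans x I)
    {X : Finset (Finset ι)} (hX : ∀ S, S ∈ X ↔ ∃ Z, IsFacetSet x I Z ∧ S ⊆ Z) :
    hPoly (hull x I) = hSum X (finrank ℝ E) := by
  have hD : (polyDim (hull x I)).toNat = finrank ℝ E := by rw [hI.polyDim_hull]; simp
  have hcard : ∀ S ∈ X, S.card ∈ Finset.range (finrank ℝ E + 1) := fun S hS => by
    obtain ⟨Z, hZ, hSZ⟩ := (hX S).1 hS
    rw [Finset.mem_range, ← hs Z hZ]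
    exact Nat.lt_succ_of_le (Finset.card_le_card hSZ)
  rw [hPoly, hD, hSum, ← Finset.sum_fiberwise_of_maps_to hcard]
  refine Finset.sum_congr rfl fun j _ => ?_
  rw [hs.fNum_eq hI hX, Finset.sum_congr rfl (g := fun _ =>
    (Polynomial.X ^ j * (1 - Polynomial.X) ^ (finrank ℝ E - j) : ℤ[X]))
    (fun S hS => by rw [(Finset.mem_filter.1 hS).2])]
  rw [Finset.sum_const, nsmul_eq_mul, mul_assoc]
  simp

end HSum

end LexDiamond

namespace LexDiamond

open Module Filter

/-! ### Lifted configurations and lower cells -/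

section Lifting

variable {E : Type*} [NormedAddCommGroup E] [NormedSpace ℝ E] {ι : Type*}

/-- The points `x i`, lifted to the heights `w i`. -/
def lift (w : ι → ℝ) (x : ι → E) : ι → ℝ × E := fun i => (w i, x i)

/-- The affine functional `(h, e) ↦ α h + l e` on `ℝ × E`. -/
def liftFun (α : ℝ) (l : E →ᵃ[ℝ] ℝ) : ℝ × E →ᵃ[ℝ] ℝ :=
  α • (LinearMap.fst ℝ ℝ E).toAffineMap + l.comp (LinearMap.snd ℝ ℝ E).toAffineMap

theorem liftFun_apply (α : ℝ) (l : E →ᵃ[ℝ] ℝ) (p : ℝ × E) : liftFun α l p = α * p.1 + l p.2 := by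
  simp [liftFun]

theorem liftFun_lift (α : ℝ) (l : E →ᵃ[ℝ] ℝ) (w : ι → ℝ) (x : ι → E) (i : ι) :
    liftFun α l (lift w x i) = α * w i + l (x i) :=
  liftFun_apply _ _ _

theorem exists_eq_liftFun (L : ℝ × E →ᵃ[ℝ] ℝ) : ∃ α l, L = liftFun α l := by
  refine ⟨L.linear (1, 0), L.comp (LinearMap.inr ℝ ℝ E).toAffineMap, ?_⟩
  ext ⟨h, e⟩
  rw [liftFun_apply]
  have h1 : L (h, e) = L.linear (h, 0) + L (0, e) := by
    have := L.map_vadd (0, e) (h, (0 : E))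
    simpa using this
  have h2 : L.linear (h, 0) = h * L.linear (1, 0) := by
    rw [← smul_eq_mul, ← map_smul]
    simp
  simp [h1, h2, mul_comm]

theorem smul_liftFun (c α : ℝ) (l : E →ᵃ[ℝ] ℝ) : c • liftFun α l = liftFun (c * α) (c • l) := by
  ext p
  simp [liftFun_apply, mul_add, mul_assoc]

theorem liftFun_inj {α α' : ℝ} {l l' : E →ᵃ[ℝ] ℝ} :
    liftFun α l = liftFun α' l' ↔ α = α' ∧ l = l' := by
  constructor
  · intro h
    have hv : ∀ p : ℝ × E, α * p.1 + l p.2 = α' * p.1 + l' p.2 := fun p => by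
      rw [← liftFun_apply, ← liftFun_apply, h]
    have hl : l = l' := by
      ext e
      simpa using hv (0, e)
    subst hl
    exact ⟨by simpa using hv (1, 0), rfl⟩
  · rintro ⟨rfl, rfl⟩
    rfl

theorem liftFun_eq_zero {α : ℝ} {l : E →ᵃ[ℝ] ℝ} : liftFun α l = 0 ↔ α = 0 ∧ l = 0 := by
  rw [show (0 : ℝ × E →ᵃ[ℝ] ℝ) = liftFun 0 0 by ext p; simp [liftFun_apply], liftFun_inj]

/-- `Z` indexes a maximal cell of the subdivision of the points `x i`, `i ∈ I`, induced by the
heights `w`. -/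
def IsLowerCell (x : ι → E) (w : ι → ℝ) (I Z : Finset ι) : Prop :=
  Z ⊆ I ∧ Spans x Z ∧ ∃ l : E →ᵃ[ℝ] ℝ, (∀ i ∈ I, l (x i) ≤ w i) ∧ ∀ i ∈ I, l (x i) = w i ↔ i ∈ Z

theorem IsLowerCell.congr {x : ι → E} {w w' : ι → ℝ} {I Z : Finset ι} (h : IsLowerCell x w I Z)
    (hw : ∀ i ∈ I, w i = w' i) : IsLowerCell x w' I Z := by
  obtain ⟨h1, h2, l, h3, h4⟩ := h
  exact ⟨h1, h2, l, fun i hi => hw i hi ▸ h3 i hi, fun i hi => hw i hi ▸ h4 i hi⟩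

/-- The height `w₀` of an apex over the point `x o` is large compared with the heights `w` of the
points `x i`, `i ∈ I`: it lies above every hyperplane through lifted points, and every hyperplane
through the apex and a lifted ridge `Z` is so steep that, at the points off the vertical hyperplane
over `Z`, its position relative to the lifted points is that of this vertical hyperplane. -/
structure HighApex (x : ι → E) (w : ι → ℝ) (I : Finset ι) (o : ι) (w₀ : ℝ) : Prop where
  above : ∀ Z ⊆ I, Spans x Z → ∀ m : E →ᵃ[ℝ] ℝ, (∀ i ∈ Z, m (x i) = w i) → m (x o) < w₀
  steep : ∀ Z ⊆ I, ∀ A : E →ᵃ[ℝ] ℝ, (∀ i ∈ Z, A (x i) = 0) →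
    (∀ B : E →ᵃ[ℝ] ℝ, (∀ i ∈ Z, B (x i) = 0) → ∃ c : ℝ, B = c • A) →
    (∃ m : E →ᵃ[ℝ] ℝ, ∀ i ∈ Z, m (x i) = w i) →
    ∃ m : E →ᵃ[ℝ] ℝ, (∀ i ∈ Z, m (x i) = w i) ∧ m (x o) < w₀ ∧ ∀ i ∈ I, A (x i) ≠ 0 →
      |A (x o)| * |w i - m (x i)| < |A (x i)| * (w₀ - m (x o))

theorem HighApex.congr {x : ι → E} {w w' : ι → ℝ} {I : Finset ι} {o : ι} {w₀ : ℝ}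
    (h : HighApex x w I o w₀) (hw : ∀ i ∈ I, w i = w' i) : HighApex x w' I o w₀ := by
  refine ⟨fun Z hZ hs m hm => h.above Z hZ hs m fun i hi => (hm i hi).trans (hw i (hZ hi)).symm,
    fun Z hZ A hA0 hA hm => ?_⟩
  obtain ⟨m, hm⟩ := hm
  obtain ⟨m, h1, h2, h3⟩ := h.steep Z hZ A hA0 hA
    ⟨m, fun i hi => (hm i hi).trans (hw i (hZ hi)).symm⟩
  exact ⟨m, fun i hi => (h1 i hi).trans (hw i (hZ hi)), h2, fun i hi h0 => hw i hi ▸ h3 i hi h0⟩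

theorem eventually_highApex (x : ι → E) (w : ι → ℝ) (I : Finset ι) (o : ι) :
    ∀ᶠ w₀ in atTop, HighApex x w I o w₀ := by
  classical
  have h1 : ∀ᶠ w₀ : ℝ in atTop, ∀ Z ∈ I.powerset, Spans x Z → ∀ m : E →ᵃ[ℝ] ℝ,
      (∀ i ∈ Z, m (x i) = w i) → m (x o) < w₀ := by
    rw [eventually_all_finset]
    intro Z _
    by_cases hm : ∃ m : E →ᵃ[ℝ] ℝ, ∀ i ∈ Z, m (x i) = w i
    · obtain ⟨m, hm⟩ := hm
      filter_upwards [eventually_gt_atTop (m (x o))] with w₀ hw₀ hs m' hm'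
      have : m' = m := sub_eq_zero.1 (hs (m' - m) fun i hi => by simp [hm i hi, hm' i hi])
      rwa [this]
    · exact Eventually.of_forall fun w₀ _ m hm' => absurd ⟨m, hm'⟩ hm
  have h2 : ∀ᶠ w₀ : ℝ in atTop, ∀ Z ∈ I.powerset, ∀ A : E →ᵃ[ℝ] ℝ, (∀ i ∈ Z, A (x i) = 0) →
      (∀ B : E →ᵃ[ℝ] ℝ, (∀ i ∈ Z, B (x i) = 0) → ∃ c : ℝ, B = c • A) →
      (∃ m : E →ᵃ[ℝ] ℝ, ∀ i ∈ Z, m (x i) = w i) →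
      ∃ m : E →ᵃ[ℝ] ℝ, (∀ i ∈ Z, m (x i) = w i) ∧ m (x o) < w₀ ∧ ∀ i ∈ I, A (x i) ≠ 0 →
        |A (x o)| * |w i - m (x i)| < |A (x i)| * (w₀ - m (x o)) := by
    rw [eventually_all_finset]
    intro Z _
    by_cases hm : ∃ m : E →ᵃ[ℝ] ℝ, ∀ i ∈ Z, m (x i) = w i
    swap
    · exact Eventually.of_forall fun w₀ A _ _ hm' => absurd hm' hm
    obtain ⟨m, hm⟩ := hm
    -- the condition is invariant under scaling of `A`, so that one choice of `A` suffices
    by_cases hA : ∃ A : E →ᵃ[ℝ] ℝ, (∀ i ∈ Z, A (x i) = 0) ∧ A ≠ 0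
    swap
    · filter_upwards [eventually_gt_atTop (m (x o))] with w₀ hw₀ A hA0 _ _
      have : A = 0 := by
        by_contra hne
        exact hA ⟨A, hA0, hne⟩
      exact ⟨m, hm, hw₀, fun i _ h0 => absurd (by simp [this]) h0⟩
    obtain ⟨A₀, hA₀Z, hA₀⟩ := hA
    have hsteep : ∀ᶠ w₀ : ℝ in atTop, ∀ i ∈ I, A₀ (x i) ≠ 0 →
        |A₀ (x o)| * |w i - m (x i)| < |A₀ (x i)| * (w₀ - m (x o)) := by
      rw [eventually_all_finset]
      intro i _
      by_cases h0 : A₀ (x i) = 0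
      · exact Eventually.of_forall fun _ h => absurd h0 h
      · have hpos : 0 < |A₀ (x i)| := abs_pos.2 h0
        filter_upwards [eventually_gt_atTop
          (|A₀ (x o)| * |w i - m (x i)| / |A₀ (x i)| + m (x o))] with w₀ hw₀ _
        have h' : |A₀ (x o)| * |w i - m (x i)| / |A₀ (x i)| < w₀ - m (x o) := by linarith
        rw [div_lt_iff₀ hpos] at h'
        linarith
    filter_upwards [eventually_gt_atTop (m (x o)), hsteep] with w₀ hw₀ hst A _ hu _
    refine ⟨m, hm, hw₀, fun i hi h0 => ?_⟩
    obtain ⟨c, hc⟩ := hu A₀ hA₀Z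
    have hc0 : c ≠ 0 := by
      rintro rfl
      exact hA₀ (by simpa using hc)
    have hv : ∀ e, A₀ e = c * A e := fun e => by rw [hc]; simp
    have := hst i hi (by rw [hv]; exact mul_ne_zero hc0 h0)
    rw [hv, hv, abs_mul, abs_mul, mul_assoc, mul_assoc] at this
    exact lt_of_mul_lt_mul_left this (abs_nonneg c)
  filter_upwards [h1, h2] with w₀ h1 h2
  exact ⟨fun Z hZ => h1 Z (Finset.mem_powerset.2 hZ), fun Z hZ => h2 Z (Finset.mem_powerset.2 hZ)⟩

variable {x : ι → E} {w : ι → ℝ} {I : Finset ι} {o : ι}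

theorem HighApex.spans_lift [DecidableEq ι] (h : HighApex x w I o (w o)) (hI : Spans x I) :
    Spans (lift w x) (insert o I) := by
  intro L hL
  obtain ⟨α, l, rfl⟩ := exists_eq_liftFun L
  have hL' : ∀ i ∈ insert o I, α * w i + l (x i) = 0 := fun i hi => by
    rw [← liftFun_lift]
    exact hL i hi
  by_cases hα : α = 0
  · subst hα
    rw [liftFun_eq_zero]
    exact ⟨rfl, hI l fun i hi => by simpa using hL' i (Finset.mem_insert_of_mem hi)⟩
  · have hm : ∀ i ∈ insert o I, ((-α⁻¹) • l) (x i) = w i := fun i hi => by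
      simp only [AffineMap.coe_smul, Pi.smul_apply, smul_eq_mul]
      field_simp
      linarith [hL' i hi]
    exact absurd (hm o (Finset.mem_insert_self _ _)) (h.above I subset_rfl hI _ fun i hi =>
      hm i (Finset.mem_insert_of_mem hi)).ne

/-- Pushing: lifting a point high does not affect the cells of the other points. -/
theorem HighApex.isLowerCell_iff [DecidableEq ι] (h : HighApex x w I o (w o))
    {Z : Finset ι} (hoZ : o ∉ Z) :
    IsLowerCell x w (insert o I) Z ↔ IsLowerCell x w I Z := by
  constructor
  · rintro ⟨hZI, hsp, l, hl, hlZ⟩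
    exact ⟨fun i hi => (Finset.mem_insert.1 (hZI hi)).resolve_left fun h => hoZ (h ▸ hi), hsp, l,
      fun i hi => hl i (Finset.mem_insert_of_mem hi),
      fun i hi => hlZ i (Finset.mem_insert_of_mem hi)⟩
  · rintro ⟨hZI, hsp, l, hl, hlZ⟩
    have ho' := h.above Z hZI hsp l fun i hi => (hlZ i (hZI hi)).2 hi
    refine ⟨hZI.trans (Finset.subset_insert _ _), hsp, l, fun i hi => ?_, fun i hi => ?_⟩
    · rcases Finset.mem_insert.1 hi with rfl | hi
      · exact ho'.le
      · exact hl i hi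
    · rcases Finset.mem_insert.1 hi with rfl | hi
      · simp [hoZ, ho'.ne]
      · exact hlZ i hi

/-- A non-vertical hyperplane through a high apex that supports the lifted points, and is determined
by the apex and the lifted points of `Z`, lies over a facet `Z` of the base. -/
theorem HighApex.definesFacet_of_supports (h : HighApex x w I o (w o)) (hs : Simplicial x I)
    {Z : Finset ι} (hZI : Z ⊆ I) (hcard : finrank ℝ E ≤ Z.card) {α : ℝ} {l : E →ᵃ[ℝ] ℝ}
    (hα : α ≠ 0) (hZ : ∀ i ∈ Z, α * w i + l (x i) = 0) (ho : α * w o + l (x o) = 0)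
    (hu : ∀ B : E →ᵃ[ℝ] ℝ, (∀ i ∈ Z, B (x i) = 0) → B (x o) = 0 → B = 0)
    (hnonneg : ∀ i ∈ I, 0 ≤ α * w i + l (x i)) :
    ∃ A, DefinesFacet x I Z A ∧ A (x o) * α < 0 := by
  have hm₀ : ∀ i, ((-α⁻¹) • l) (x i) = -α⁻¹ * l (x i) := fun i => by simp
  have hm₀Z : ∀ i ∈ Z, ((-α⁻¹) • l) (x i) = w i := fun i hi => by
    rw [hm₀]
    field_simp
    linarith [hZ i hi]
  have hm₀o : ((-α⁻¹) • l) (x o) = w o := by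
    rw [hm₀]
    field_simp
    linarith
  have hns : ¬ Spans x Z := fun hsp => (h.above Z hZI hsp _ hm₀Z).ne hm₀o
  simp only [Spans, not_forall] at hns
  obtain ⟨B, hBZ, hB0⟩ := hns
  have hBo : B (x o) ≠ 0 := fun h0 => hB0 (hu B hBZ h0)
  have huB : ∀ B' : E →ᵃ[ℝ] ℝ, (∀ i ∈ Z, B' (x i) = 0) → ∃ c : ℝ, B' = c • B := fun B' hB' => by
    refine ⟨B' (x o) / B (x o), sub_eq_zero.1 (hu _ (fun i hi => ?_) ?_)⟩
    · simp [hB' i hi, hBZ i hi]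
    · simp [hBo]
  obtain ⟨m, hmZ, hmo, hst⟩ := h.steep Z hZI B hBZ huB ⟨_, hm₀Z⟩
  obtain ⟨β, hβ⟩ := huB (l + α • m) fun i hi => by
    simp only [AffineMap.coe_add, AffineMap.coe_smul, Pi.add_apply, Pi.smul_apply, smul_eq_mul,
      hmZ i hi]
    linarith [hZ i hi]
  set A := l + α • m with hAdef
  have hA : ∀ i, A (x i) = l (x i) + α * m (x i) := fun i => by simp [hAdef]
  have hAB : ∀ i, A (x i) = β * B (x i) := fun i => by rw [hβ]; simp
  have hAo : A (x o) = -(α * (w o - m (x o))) := by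
    rw [hA]
    linarith
  have hgap : 0 < w o - m (x o) := by linarith
  have hAo0 : A (x o) ≠ 0 := by
    rw [hAo]
    exact neg_ne_zero.2 (mul_ne_zero hα hgap.ne')
  have hβ0 : β ≠ 0 := by
    rintro rfl
    exact hAo0 (by rw [hAB]; simp)
  have hst' : ∀ i ∈ I, A (x i) ≠ 0 → |α * (w i - m (x i))| < |A (x i)| := fun i hi h0 => by
    have h1 := hst i hi fun hb => h0 (by rw [hAB, hb, mul_zero])
    have h2 := mul_lt_mul_of_pos_left h1 (abs_pos.2 hβ0)
    rw [← mul_assoc, ← mul_assoc, ← abs_mul, ← abs_mul β, ← hAB, ← hAB, hAo, abs_neg, abs_mul,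
      abs_of_pos hgap] at h2
    rw [abs_mul]
    refine lt_of_mul_lt_mul_right ?_ hgap.le
    linarith
  have hAnonneg : ∀ i ∈ I, 0 ≤ A (x i) := fun i hi => by
    by_contra! hneg
    have h1 := hst' i hi hneg.ne
    have h2 := hnonneg i hi
    rw [abs_of_neg hneg] at h1
    have h3 := le_abs_self (α * (w i - m (x i)))
    rw [hA] at h1
    linarith
  have hAZ : ∀ i ∈ Z, A (x i) = 0 := fun i hi => by rw [hAB, hBZ i hi, mul_zero]
  have huA : ∀ B' : E →ᵃ[ℝ] ℝ, (∀ i ∈ Z, B' (x i) = 0) → ∃ c : ℝ, B' = c • A := fun B' hB' => by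
    obtain ⟨c, rfl⟩ := huB B' hB'
    exact ⟨c / β, by rw [hβ, smul_smul, div_mul_cancel₀ _ hβ0]⟩
  have hsub : Z ⊆ I.filter fun i => A (x i) = 0 := fun i hi =>
    Finset.mem_filter.2 ⟨hZI hi, hAZ i hi⟩
  have hdef : DefinesFacet x I (I.filter fun i => A (x i) = 0) A :=
    ⟨Finset.filter_subset _ _, fun h0 => hAo0 (by rw [h0]; rfl), hAnonneg,
      fun i hi => by simp [hi], fun B' hB' => huA B' fun i hi => hB' i (hsub hi)⟩
  have heq := Finset.eq_of_subset_of_card_le hsub ((hs _ ⟨A, hdef⟩).trans_le hcard)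
  rw [← heq] at hdef
  refine ⟨A, hdef, ?_⟩
  rw [hAo]
  have := mul_pos (mul_self_pos.2 hα) hgap
  linarith

variable [FiniteDimensional ℝ E]

/-- The functional through a high apex and a facet `Z` of the base supports the lifted points,
with zero set exactly `Z`. -/
theorem HighApex.exists_supports (h : HighApex x w I o (w o)) (hs : Simplicial x I)
    {Z : Finset ι} {A : E →ᵃ[ℝ] ℝ} (hA : DefinesFacet x I Z A) :
    ∃ m : E →ᵃ[ℝ] ℝ, (∀ i ∈ Z, m (x i) = w i) ∧ m (x o) < w o ∧
      ∀ i ∈ I, i ∉ Z → |A (x o)| * |w i - m (x i)| < A (x i) * (w o - m (x o)) := by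
  obtain ⟨m, h1, h2, h3⟩ := h.steep Z hA.subset A (fun i hi => hA.zero hi) hA.unique
    (exists_extension hA.unique (hs Z ⟨A, hA⟩) w)
  refine ⟨m, h1, h2, fun i hi hiZ => ?_⟩
  have hpos := hA.pos hi hiZ
  simpa [abs_of_pos hpos] using h3 i hi hpos.ne'

variable [DecidableEq ι]

/-- The facets of a configuration with a high apex that contain the apex are the pyramids over the
facets of the base. -/
theorem HighApex.isFacetSet_insert_iff (h : HighApex x w I o (w o)) (hs : Simplicial x I)
    (hI : Spans x I) (ho : o ∉ I) {Z : Finset ι} (hZI : Z ⊆ I) :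
    IsFacetSet (lift w x) (insert o I) (insert o Z) ↔ IsFacetSet x I Z := by
  constructor
  · rintro ⟨L, hL⟩
    obtain ⟨α, l, rfl⟩ := exists_eq_liftFun L
    have hcard : finrank ℝ E ≤ Z.card := by
      have h1 := finrank_le_card_of_unique hL.unique
      rw [finrank_prod, finrank_self, Finset.card_insert_of_notMem fun hz => ho (hZI hz)] at h1
      omega
    have hzero : ∀ i ∈ insert o Z, α * w i + l (x i) = 0 := fun i hi => by
      rw [← liftFun_lift]
      exact hL.zero hi
    have hnn : ∀ i ∈ I, 0 ≤ α * w i + l (x i) := fun i hi => by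
      rw [← liftFun_lift]
      exact hL.nonneg i (Finset.mem_insert_of_mem hi)
    by_cases hα : α = 0
    · subst hα
      have hl0 : l ≠ 0 := by
        rintro rfl
        exact hL.ne_zero (liftFun_eq_zero.2 ⟨rfl, rfl⟩)
      have hface : IsFaceSet x I Z := ⟨hZI, l, fun i hi => by simpa using hnn i hi,
        fun i hi => by
          have := hL.eq_zero_iff i (Finset.mem_insert_of_mem hi)
          rw [liftFun_lift, zero_mul, zero_add, Finset.mem_insert] at this
          rw [this, or_iff_right]
          rintro rfl
          exact ho hi⟩
      have hne : Z ≠ I := by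
        rintro rfl
        exact hl0 (hI l fun i hi => by simpa using hzero i (Finset.mem_insert_of_mem hi))
      obtain ⟨F, hF, hZF⟩ := exists_facetSet_superset hI hface hne
      rwa [Finset.eq_of_subset_of_card_le hZF ((hs F hF).trans_le hcard)]
    · have hu : ∀ B : E →ᵃ[ℝ] ℝ, (∀ i ∈ Z, B (x i) = 0) → B (x o) = 0 → B = 0 :=
        fun B hB hBo => by
          obtain ⟨c, hc⟩ := hL.unique (liftFun 0 B) fun i hi => by
            rw [liftFun_lift, zero_mul, zero_add]
            rcases Finset.mem_insert.1 hi with rfl | hi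
            · exact hBo
            · exact hB i hi
          rw [smul_liftFun, liftFun_inj] at hc
          have hc0 : c = 0 := (mul_eq_zero.1 hc.1.symm).resolve_right hα
          rw [hc.2, hc0, zero_smul]
      obtain ⟨A, hA, -⟩ := h.definesFacet_of_supports hs hZI hcard hα
        (fun i hi => hzero i (Finset.mem_insert_of_mem hi)) (hzero o (Finset.mem_insert_self _ _))
        hu hnn
      exact ⟨A, hA⟩
  · rintro ⟨A, hA⟩
    obtain ⟨m, hmZ, hmo, hst⟩ := h.exists_supports hs hA
    have hgap : 0 < w o - m (x o) := by linarith
    set α := -(A (x o) / (w o - m (x o))) with hα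
    have hval : ∀ i, liftFun α (A - α • m) (lift w x i) = A (x i) + α * (w i - m (x i)) :=
      fun i => by
        rw [liftFun_lift]
        simp only [AffineMap.coe_sub, AffineMap.coe_smul, Pi.sub_apply, Pi.smul_apply, smul_eq_mul]
        ring
    have hvalo : liftFun α (A - α • m) (lift w x o) = 0 := by
      rw [hval, hα]
      field_simp
      ring
    have hvalZ : ∀ i ∈ Z, liftFun α (A - α • m) (lift w x i) = 0 := fun i hi => by
      rw [hval, hA.zero hi, hmZ i hi]
      simp
    have hvalpos : ∀ i ∈ I, i ∉ Z → 0 < liftFun α (A - α • m) (lift w x i) := fun i hi hiZ => by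
      rw [hval]
      have h1 := hst i hi hiZ
      have h2 : |α * (w i - m (x i))| < A (x i) := by
        rw [abs_mul, hα, abs_neg, abs_div, abs_of_pos hgap, div_mul_eq_mul_div,
          div_lt_iff₀ hgap]
        exact h1
      linarith [(abs_lt.1 h2).1]
    refine ⟨liftFun α (A - α • m), Finset.insert_subset_insert _ hA.subset, fun h0 => ?_,
      fun i hi => ?_, fun i hi => ?_, fun B hB => ?_⟩
    · obtain ⟨i, hi, hiZ⟩ := hA.exists_notMem hI
      have := hvalpos i hi hiZ
      rw [h0] at this
      exact lt_irrefl _ this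
    · rcases Finset.mem_insert.1 hi with rfl | hi
      · exact hvalo.ge
      · by_cases hiZ : i ∈ Z
        · exact (hvalZ i hiZ).ge
        · exact (hvalpos i hi hiZ).le
    · rcases Finset.mem_insert.1 hi with rfl | hi
      · simp [hvalo]
      · have hio : i ≠ o := fun h => ho (h ▸ hi)
        by_cases hiZ : i ∈ Z
        · simp [hvalZ i hiZ, hiZ]
        · simp [(hvalpos i hi hiZ).ne', hiZ, hio]
    · obtain ⟨α', l', rfl⟩ := exists_eq_liftFun B
      obtain ⟨c, hc⟩ := hA.unique (l' + α' • m) fun i hi => by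
        have := hB i (Finset.mem_insert_of_mem hi)
        rw [liftFun_lift] at this
        simp only [AffineMap.coe_add, AffineMap.coe_smul, Pi.add_apply, Pi.smul_apply, smul_eq_mul,
          hmZ i hi]
        linarith
      have hl' : l' = c • A - α' • m := by rw [← hc]; simp
      have ho' := hB o (Finset.mem_insert_self _ _)
      rw [liftFun_lift, hl'] at ho'
      simp only [AffineMap.coe_sub, AffineMap.coe_smul, Pi.sub_apply, Pi.smul_apply,
        smul_eq_mul] at ho'
      have hα' : α' = c * α := by
        rw [hα]
        field_simp
        linarith
      refine ⟨c, ?_⟩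
      rw [smul_liftFun, liftFun_inj]
      exact ⟨hα', by rw [hl', hα', smul_sub, smul_smul]⟩

/-- The facets of a configuration with a high apex that do not contain the apex are the lower
cells. -/
theorem HighApex.isFacetSet_iff (h : HighApex x w I o (w o)) (hs : Simplicial x I)
    (hI : Spans x I) (ho : o ∉ I) {Z : Finset ι} (hoZ : o ∉ Z) :
    IsFacetSet (lift w x) (insert o I) Z ↔ IsLowerCell x w I Z := by
  constructor
  · rintro ⟨L, hL⟩
    obtain ⟨α, l, rfl⟩ := exists_eq_liftFun L
    have hZI : Z ⊆ I := fun i hi => (Finset.mem_insert.1 (hL.subset hi)).resolve_left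
      fun h => hoZ (h ▸ hi)
    have hcard : finrank ℝ E + 1 ≤ Z.card := by
      have h1 := finrank_le_card_of_unique hL.unique
      rw [finrank_prod, finrank_self] at h1
      omega
    have hiff : ∀ i ∈ I, α * w i + l (x i) = 0 ↔ i ∈ Z := fun i hi => by
      rw [← liftFun_lift]
      exact hL.eq_zero_iff i (Finset.mem_insert_of_mem hi)
    have hnn : ∀ i ∈ insert o I, 0 ≤ α * w i + l (x i) := fun i hi => by
      rw [← liftFun_lift]
      exact hL.nonneg i hi
    have hα : α ≠ 0 := by
      rintro rfl
      have hl0 : l ≠ 0 := by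
        rintro rfl
        exact hL.ne_zero (liftFun_eq_zero.2 ⟨rfl, rfl⟩)
      have hface : IsFaceSet x I Z := ⟨hZI, l,
        fun i hi => by simpa using hnn i (Finset.mem_insert_of_mem hi),
        fun i hi => by simpa using hiff i hi⟩
      have hne : Z ≠ I := by
        rintro rfl
        exact hl0 (hI l fun i hi => by simpa using (hiff i hi).2 hi)
      obtain ⟨F, hF, hZF⟩ := exists_facetSet_superset hI hface hne
      have := Finset.card_le_card hZF
      rw [hs F hF] at this
      omega
    have hsp : Spans x Z := fun B hB => by
      obtain ⟨c, hc⟩ := hL.unique (liftFun 0 B) fun i hi => by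
        rw [liftFun_lift, zero_mul, zero_add, hB i hi]
      rw [smul_liftFun, liftFun_inj] at hc
      have hc0 : c = 0 := (mul_eq_zero.1 hc.1.symm).resolve_right hα
      rw [hc.2, hc0, zero_smul]
    have hm : ∀ i, ((-α⁻¹) • l) (x i) = w i - α⁻¹ * (α * w i + l (x i)) := fun i => by
      simp only [AffineMap.coe_smul, Pi.smul_apply, smul_eq_mul]
      field_simp
      ring
    have hpos : 0 < α := by
      by_contra! hneg
      have h1 := h.above Z hZI hsp ((-α⁻¹) • l) fun i hi => by
        rw [hm, (hiff i (hZI hi)).2 hi]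
        simp
      rw [hm] at h1
      have h2 := hnn o (Finset.mem_insert_self _ _)
      have h3 : α⁻¹ ≤ 0 := inv_nonpos.2 hneg
      have := mul_nonpos_of_nonpos_of_nonneg h3 h2
      linarith
    refine ⟨hZI, hsp, (-α⁻¹) • l, fun i hi => ?_, fun i hi => ?_⟩
    · rw [hm]
      have := mul_nonneg (inv_nonneg.2 hpos.le) (hnn i (Finset.mem_insert_of_mem hi))
      linarith
    · rw [hm, ← hiff i hi, sub_eq_self, mul_eq_zero, or_iff_right (inv_ne_zero hα)]
  · rintro ⟨hZI, hsp, l, hl, hlZ⟩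
    have hval : ∀ i, liftFun 1 (-l) (lift w x i) = w i - l (x i) := fun i => by
      rw [liftFun_lift]
      simp [sub_eq_add_neg]
    have hvalo : 0 < w o - l (x o) := by
      have := h.above Z hZI hsp l fun i hi => (hlZ i (hZI hi)).2 hi
      linarith
    refine ⟨liftFun 1 (-l), hZI.trans (Finset.subset_insert _ _), fun h0 => ?_, fun i hi => ?_,
      fun i hi => ?_, fun B hB => ?_⟩
    · exact one_ne_zero (liftFun_eq_zero.1 h0).1
    · rw [hval]
      rcases Finset.mem_insert.1 hi with rfl | hi
      · exact hvalo.le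
      · linarith [hl i hi]
    · rw [hval]
      rcases Finset.mem_insert.1 hi with rfl | hi
      · simp [hoZ, hvalo.ne']
      · rw [← hlZ i hi, sub_eq_zero, eq_comm]
    · obtain ⟨α, l', rfl⟩ := exists_eq_liftFun B
      have h0 := hsp (l' + α • l) fun i hi => by
        have := hB i hi
        rw [liftFun_lift] at this
        simp only [AffineMap.coe_add, AffineMap.coe_smul, Pi.add_apply, Pi.smul_apply, smul_eq_mul,
          (hlZ i (hZI hi)).2 hi]
        linarith
      refine ⟨α, ?_⟩
      rw [smul_liftFun, liftFun_inj]
      exact ⟨by simp, by rw [smul_neg]; exact eq_neg_of_add_eq_zero_left h0⟩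

theorem HighApex.simplicial_lift (h : HighApex x w I o (w o)) (hs : Simplicial x I)
    (hI : Spans x I) (ho : o ∉ I) (hcard : ∀ Z, IsLowerCell x w I Z → Z.card = finrank ℝ E + 1) :
    Simplicial (lift w x) (insert o I) := by
  intro Z hZ
  rw [finrank_prod, finrank_self, add_comm]
  by_cases hoZ : o ∈ Z
  · obtain ⟨L, hL⟩ := id hZ
    have hsub : Z.erase o ⊆ I := fun i hi => by
      rw [Finset.mem_erase] at hi
      exact (Finset.mem_insert.1 (hL.subset hi.2)).resolve_left hi.1
    rw [← Finset.insert_erase hoZ, h.isFacetSet_insert_iff hs hI ho hsub] at hZ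
    rw [← hs _ hZ, Finset.card_erase_add_one hoZ]
  · exact hcard Z ((h.isFacetSet_iff hs hI ho hoZ).1 hZ)

/-- Pushing: the new cells are the pyramids over those facets of the remaining polytope that are no
facets of the whole polytope. -/
theorem HighApex.isLowerCell_insert_iff (h : HighApex x w I o (w o)) (hs : Simplicial x I)
    (hs' : Simplicial x (insert o I)) (hI : Spans x I) (ho : o ∉ I) {Z : Finset ι} (hZI : Z ⊆ I) :
    IsLowerCell x w (insert o I) (insert o Z) ↔
      IsFacetSet x I Z ∧ ¬ IsFacetSet x (insert o I) Z := by
  have hoZ : o ∉ Z := fun hz => ho (hZI hz)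
  constructor
  · rintro ⟨-, hsp, l, hl, hlZ⟩
    have hcard : finrank ℝ E ≤ Z.card := by
      have h1 := hsp.finrank_lt_card
      rw [Finset.card_insert_of_notMem hoZ] at h1
      omega
    obtain ⟨A, hA, hAo⟩ := h.definesFacet_of_supports hs hZI hcard (α := 1) (l := -l) one_ne_zero
      (fun i hi => by
        have := (hlZ i (Finset.mem_insert_of_mem (hZI hi))).2 (Finset.mem_insert_of_mem hi)
        simp [this])
      (by
        have := (hlZ o (Finset.mem_insert_self _ _)).2 (Finset.mem_insert_self _ _)
        simp [this])
      (fun B hB hBo => hsp B fun i hi => by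
        rcases Finset.mem_insert.1 hi with rfl | hi
        · exact hBo
        · exact hB i hi)
      (fun i hi => by
        have := hl i (Finset.mem_insert_of_mem hi)
        simpa using this)
    refine ⟨⟨A, hA⟩, ?_⟩
    rintro ⟨A', hA'⟩
    obtain ⟨c, rfl⟩ := hA'.unique A fun i hi => hA.zero hi
    have h1 := hA'.nonneg o (Finset.mem_insert_self _ _)
    have h2 : c * A' (x o) < 0 := by simpa using hAo
    have hc : c < 0 := by
      by_contra! hc
      have := mul_nonneg hc h1
      linarith
    -- `A` and `A'` have opposite signs, so no point of `I` lies off the facet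
    obtain ⟨i, hi, hiZ⟩ := hA.exists_notMem hI
    have h3 := hA.pos hi hiZ
    have h4 := hA'.nonneg i (Finset.mem_insert_of_mem hi)
    have h5 : 0 < c * A' (x i) := by simpa using h3
    have := mul_nonpos_of_nonpos_of_nonneg hc.le h4
    linarith
  · rintro ⟨⟨A, hA⟩, hnot⟩
    obtain ⟨m, hmZ, hmo, hst⟩ := h.exists_supports hs hA
    have hgap : 0 < w o - m (x o) := by linarith
    have hAo : A (x o) < 0 := by
      by_contra! hge
      apply hnot
      rcases hge.eq_or_lt with h0 | hpos
      · exfalso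
        have hdef : DefinesFacet x (insert o I) (insert o Z) A := by
          refine ⟨Finset.insert_subset_insert _ hA.subset, hA.ne_zero, fun i hi => ?_,
            fun i hi => ?_, fun B hB => hA.unique B fun i hi => hB i (Finset.mem_insert_of_mem hi)⟩
          · rcases Finset.mem_insert.1 hi with rfl | hi
            · exact hge
            · exact hA.nonneg i hi
          · rcases Finset.mem_insert.1 hi with rfl | hi
            · simp [← h0]
            · have hio : i ≠ o := fun h => ho (h ▸ hi)
              rw [hA.eq_zero_iff i hi, Finset.mem_insert, or_iff_right hio]
        have h1 := hs' _ ⟨A, hdef⟩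
        rw [Finset.card_insert_of_notMem hoZ, hs Z ⟨A, hA⟩] at h1
        omega
      · refine ⟨A, hA.subset.trans (Finset.subset_insert _ _), hA.ne_zero, fun i hi => ?_,
          fun i hi => ?_, hA.unique⟩
        · rcases Finset.mem_insert.1 hi with rfl | hi
          · exact hge
          · exact hA.nonneg i hi
        · rcases Finset.mem_insert.1 hi with rfl | hi
          · simp [hoZ, hpos.ne']
          · exact hA.eq_zero_iff i hi
    set β := (w o - m (x o)) / -A (x o) with hβ
    have hβpos : 0 < β := div_pos hgap (by linarith)
    have hval : ∀ i, (m - β • A) (x i) = m (x i) - β * A (x i) := fun i => by simp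
    have hvalo : (m - β • A) (x o) = w o := by
      rw [hval, hβ]
      have := hAo.ne
      field_simp
      ring
    have hvalZ : ∀ i ∈ Z, (m - β • A) (x i) = w i := fun i hi => by
      rw [hval, hA.zero hi, hmZ i hi]
      simp
    have hvallt : ∀ i ∈ I, i ∉ Z → (m - β • A) (x i) < w i := fun i hi hiZ => by
      rw [hval]
      have h1 := hst i hi hiZ
      rw [abs_of_neg hAo] at h1
      have h2 : |w i - m (x i)| < β * A (x i) := by
        rw [hβ, div_mul_eq_mul_div, lt_div_iff₀ (by linarith)]
        linarith
      linarith [(abs_lt.1 h2).1]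
    refine ⟨Finset.insert_subset_insert _ hA.subset, fun B hB => ?_, m - β • A, fun i hi => ?_,
      fun i hi => ?_⟩
    · obtain ⟨c, rfl⟩ := hA.unique B fun i hi => hB i (Finset.mem_insert_of_mem hi)
      have h1 : c * A (x o) = 0 := by simpa using hB o (Finset.mem_insert_self _ _)
      rw [(mul_eq_zero.1 h1).resolve_right hAo.ne, zero_smul]
    · rcases Finset.mem_insert.1 hi with rfl | hi
      · exact hvalo.le
      · by_cases hiZ : i ∈ Z
        · exact (hvalZ i hiZ).le
        · exact (hvallt i hi hiZ).le
    · rcases Finset.mem_insert.1 hi with rfl | hi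
      · simp [hvalo]
      · have hio : i ≠ o := fun h => ho (h ▸ hi)
        by_cases hiZ : i ∈ Z
        · simp [hvalZ i hiZ, hiZ]
        · exact iff_of_false (hvallt i hi hiZ).ne (by simp [hiZ, hio])

/-- Every facet of the polytope is contained in a lower cell: tilt a nearly vertical hyperplane
over the facet until it meets another lifted point. -/
theorem exists_isLowerCell_superset (hs : Simplicial x I) (hI : Spans x I) (w : ι → ℝ)
    {F : Finset ι} (hF : IsFacetSet x I F) : ∃ Z, IsLowerCell x w I Z ∧ F ⊆ Z := by
  obtain ⟨A, hA⟩ := hF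
  obtain ⟨m, hm⟩ := exists_extension hA.unique (hs F ⟨A, hA⟩) w
  have hne : (I \ F).Nonempty := by
    obtain ⟨i, hi, hiF⟩ := hA.exists_notMem hI
    exact ⟨i, Finset.mem_sdiff.2 ⟨hi, hiF⟩⟩
  obtain ⟨i₀, hi₀, hmax⟩ := Finset.exists_max_image _ (fun i => (m (x i) - w i) / A (x i)) hne
  rw [Finset.mem_sdiff] at hi₀
  set β := (m (x i₀) - w i₀) / A (x i₀) with hβ
  have hval : ∀ i, (m - β • A) (x i) = m (x i) - β * A (x i) := fun i => by simp
  have hvalF : ∀ i ∈ F, (m - β • A) (x i) = w i := fun i hi => by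
    rw [hval, hA.zero hi, hm i hi]
    simp
  have hpos₀ := hA.pos hi₀.1 hi₀.2
  have hval₀ : (m - β • A) (x i₀) = w i₀ := by
    rw [hval, hβ]
    field_simp
    ring
  refine ⟨I.filter fun i => (m - β • A) (x i) = w i, ⟨Finset.filter_subset _ _, fun B hB => ?_,
    m - β • A, fun i hi => ?_, fun i hi => by simp [hi]⟩,
    fun i hi => Finset.mem_filter.2 ⟨hA.subset hi, hvalF i hi⟩⟩
  · obtain ⟨c, rfl⟩ := hA.unique B fun i hi =>
      hB i (Finset.mem_filter.2 ⟨hA.subset hi, hvalF i hi⟩)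
    have h1 : c * A (x i₀) = 0 := by
      simpa using hB i₀ (Finset.mem_filter.2 ⟨hi₀.1, hval₀⟩)
    rw [(mul_eq_zero.1 h1).resolve_right hpos₀.ne', zero_smul]
  · by_cases hiF : i ∈ F
    · exact (hvalF i hiF).le
    · have h1 := hmax i (Finset.mem_sdiff.2 ⟨hi, hiF⟩)
      rw [div_le_iff₀ (hA.pos hi hiF)] at h1
      rw [hval]
      linarith

/-- Pulling: if one point is lifted to a negative height and all others have height zero, the cells
are the pyramids over the facets that do not contain the point. -/
theorem isLowerCell_pull_iff (hs : Simplicial x I) (hI : Spans x I) (ho : o ∈ I) (hwo : w o < 0)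
    (hw : ∀ i ∈ I, i ≠ o → w i = 0) {Z : Finset ι} :
    IsLowerCell x w I Z ↔ ∃ F, IsFacetSet x I F ∧ o ∉ F ∧ Z = insert o F := by
  constructor
  · rintro ⟨hZI, hsp, l, hl, hlZ⟩
    have hoZ : o ∈ Z := by
      by_contra hoZ
      have h0 := hsp l fun i hi => by
        rw [(hlZ i (hZI hi)).2 hi]
        exact hw i (hZI hi) fun h => hoZ (h ▸ hi)
      have := hl o ho
      rw [h0] at this
      exact absurd hwo (not_lt.2 this)
    have hlo : l (x o) = w o := (hlZ o ho).2 hoZ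
    have hface : IsFaceSet x I (Z.erase o) := by
      refine ⟨(Finset.erase_subset _ _).trans hZI, -l, fun i hi => ?_, fun i hi => ?_⟩
      · have := hl i hi
        rcases eq_or_ne i o with rfl | hio
        · simpa using this.trans hwo.le
        · rw [hw i hi hio] at this
          simpa using this
      · rcases eq_or_ne i o with rfl | hio
        · simp [hlo, hwo.ne]
        · have := hlZ i hi
          rw [hw i hi hio] at this
          simpa [hio] using this
    have hne : Z.erase o ≠ I := fun h => by
      rw [← h] at ho
      simp at ho
    obtain ⟨F, hF, hZF⟩ := exists_facetSet_superset hI hface hne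
    have hcard := hsp.finrank_lt_card
    rw [← Finset.card_erase_add_one hoZ] at hcard
    have heq := Finset.eq_of_subset_of_card_le hZF (by rw [hs F hF]; omega)
    exact ⟨F, hF, by rw [← heq]; simp, by rw [← heq, Finset.insert_erase hoZ]⟩
  · rintro ⟨F, ⟨A, hA⟩, hoF, rfl⟩
    have hpos := hA.pos ho hoF
    have hval : ∀ i, ((w o / A (x o)) • A) (x i) = w o / A (x o) * A (x i) := fun i => by simp
    have hvalo : ((w o / A (x o)) • A) (x o) = w o := by
      rw [hval]
      field_simp
    have hvalF : ∀ i ∈ F, ((w o / A (x o)) • A) (x i) = w i := fun i hi => by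
      rw [hval, hA.zero hi, mul_zero, hw i (hA.subset hi) fun h => hoF (h ▸ hi)]
    have hvallt : ∀ i ∈ I, i ∉ F → i ≠ o → ((w o / A (x o)) • A) (x i) < w i :=
      fun i hi hiF hio => by
        rw [hval, hw i hi hio]
        exact mul_neg_of_neg_of_pos (div_neg_of_neg_of_pos hwo hpos) (hA.pos hi hiF)
    refine ⟨Finset.insert_subset ho hA.subset, fun B hB => ?_, (w o / A (x o)) • A,
      fun i hi => ?_, fun i hi => ?_⟩
    · obtain ⟨c, rfl⟩ := hA.unique B fun i hi => hB i (Finset.mem_insert_of_mem hi)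
      have h1 : c * A (x o) = 0 := by simpa using hB o (Finset.mem_insert_self _ _)
      rw [(mul_eq_zero.1 h1).resolve_right hpos.ne', zero_smul]
    · rcases eq_or_ne i o with rfl | hio
      · exact hvalo.le
      · by_cases hiF : i ∈ F
        · exact (hvalF i hiF).le
        · exact (hvallt i hi hiF hio).le
    · rcases eq_or_ne i o with rfl | hio
      · simp [hvalo]
      · by_cases hiF : i ∈ F
        · simp [hvalF i hiF, hiF]
        · exact iff_of_false (hvallt i hi hiF hio).ne (by simp [hiF, hio])

end Lifting

end LexDiamond

namespace LexDiamond

open Module Filter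

/-! ### The geometry of McMullen–Walkup polytopes -/

section Curve

open Polynomial

/-- The restriction of an affine functional to the moment curve is a polynomial. -/
theorem exists_polynomial_momentCurve {K : ℕ} (B : EuclideanSpace ℝ (Fin K) →ᵃ[ℝ] ℝ) :
    ∃ q : ℝ[X], q.natDegree ≤ K ∧ (∀ t, q.eval t = B (momentCurve K t)) ∧ (q = 0 → B = 0) := by
  set b : Fin K → ℝ := fun j => B.linear (EuclideanSpace.single j 1) with hb
  have hB : ∀ y, B y = B 0 + ∑ j, y j * b j := fun y => by
    have h1 : B y = B.linear y + B 0 := by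
      conv_lhs => rw [AffineMap.decomp B]
      simp
    have h2 : y = ∑ j, y j • EuclideanSpace.single j (1 : ℝ) := by
      ext i
      simp [Finset.sum_apply, Pi.single_apply]
    have h3 : B.linear y = ∑ j, y j * b j := by
      conv_lhs => rw [h2, map_sum]
      simp [hb]
    rw [h1, h3, add_comm]
  refine ⟨C (B 0) + ∑ j : Fin K, C (b j) * X ^ ((j : ℕ) + 1), ?_, fun t => ?_, fun h => ?_⟩
  · refine natDegree_add_le_of_degree_le (by simp) (natDegree_sum_le_of_forall_le _ _ fun j _ => ?_)
    exact (natDegree_C_mul_X_pow_le _ _).trans j.2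
  · rw [hB (momentCurve K t)]
    simp only [eval_add, eval_C, eval_finsetSum, eval_mul, eval_pow, eval_X, momentCurve]
    congr 1
    exact Finset.sum_congr rfl fun j _ => mul_comm (b j) (t ^ ((j : ℕ) + 1))
  · have hcoeff : ∀ n, (C (B 0) + ∑ j : Fin K, C (b j) * X ^ ((j : ℕ) + 1)).coeff n = 0 :=
      fun n => by rw [h, coeff_zero]
    have h0 : B 0 = 0 := by
      have := hcoeff 0
      simpa [coeff_X_pow, finsetSum_coeff] using this
    have hbj : ∀ j, b j = 0 := fun j => by
      have := hcoeff (j + 1)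
      rw [coeff_add, coeff_C_succ, zero_add, finsetSum_coeff, Finset.sum_eq_single j] at this
      · simpa using this
      · intro i _ hij
        rw [coeff_C_mul, coeff_X_pow, if_neg, mul_zero]
        intro h
        exact hij (Fin.ext (by omega))
      · simp
    ext y
    rw [hB, h0]
    simp [hbj]

theorem eq_zero_of_eval_eq_zero {q : ℝ[X]} {n : ℕ} (hq : q.natDegree ≤ n) {t : ℕ → ℝ}
    {S : Finset ℕ} (ht : Set.InjOn t S) (hS : n < S.card) (h : ∀ i ∈ S, q.eval (t i) = 0) :
    q = 0 := by
  refine eq_zero_of_natDegree_lt_card_of_eval_eq_zero' q (S.image t) ?_ ?_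
  · intro y hy
    obtain ⟨i, hi, rfl⟩ := Finset.mem_image.1 hy
    exact h i hi
  · rw [Finset.card_image_of_injOn ht]
    omega

end Curve

section Geometry

variable {E : Type*} [NormedAddCommGroup E] [NormedSpace ℝ E]

/-- From a relative interior point one can move a little in every direction of the affine span. -/
theorem eventually_mem_intrinsicInterior {s : Set E} {p u : E}
    (hp : p ∈ intrinsicInterior ℝ s) (hu : u ∈ (affineSpan ℝ s).direction) :
    ∀ᶠ ε : ℝ in nhds 0, p + ε • u ∈ intrinsicInterior ℝ s := by
  obtain ⟨p', hp', rfl⟩ := mem_intrinsicInterior.1 hp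
  let f : ℝ → affineSpan ℝ s := fun ε =>
    ⟨ε • u +ᵥ (p' : E), AffineSubspace.vadd_mem_of_mem_direction
      (Submodule.smul_mem _ ε hu) p'.2⟩
  have hf : Continuous f := by
    refine Continuous.subtype_mk ?_ _
    simp only [vadd_eq_add]
    fun_prop
  have hf0 : f 0 = p' := Subtype.ext (by simp [f])
  have hopen : ∀ᶠ ε in nhds (0 : ℝ), f ε ∈ interior ((↑) ⁻¹' s : Set (affineSpan ℝ s)) :=
    hf.continuousAt.preimage_mem_nhds (by rw [hf0]; exact isOpen_interior.mem_nhds hp')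
  filter_upwards [hopen] with ε hε
  exact mem_intrinsicInterior.2 ⟨f ε, hε, by simp [f, add_comm]⟩

/-- The barycentric coordinates of a relative interior point of a simplex are positive. -/
theorem exists_pos_weights {n : ℕ} {T : Fin n → E} (hT : AffineIndependent ℝ T) {p : E}
    (hp : p ∈ intrinsicInterior ℝ (convexHull ℝ (Set.range T))) :
    ∃ c : Fin n → ℝ, (∀ s, 0 < c s) ∧ ∑ s, c s = 1 ∧ ∑ s, c s • T s = p := by
  have hconv : ∀ y ∈ convexHull ℝ (Set.range T), ∃ c : Fin n → ℝ, (∀ s, 0 ≤ c s) ∧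
      ∑ s, c s = 1 ∧ ∑ s, c s • T s = y := fun y hy => by
    have : y ∈ hull T Finset.univ := by simpa [hull] using hy
    obtain ⟨c, hc, h1, h2⟩ := mem_hull_iff.1 this
    exact ⟨c, fun s => hc s (Finset.mem_univ s), h1, h2⟩
  obtain ⟨c, hc, hc1, hcp⟩ := hconv p (intrinsicInterior_subset hp)
  refine ⟨c, fun s => ?_, hc1, hcp⟩
  have hmem : ∀ y ∈ convexHull ℝ (Set.range T), y ∈ affineSpan ℝ (convexHull ℝ (Set.range T)) :=
    fun y hy => subset_affineSpan ℝ _ hy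
  have hdir : p - T s ∈ (affineSpan ℝ (convexHull ℝ (Set.range T))).direction :=
    AffineSubspace.vsub_mem_direction (hmem p (intrinsicInterior_subset hp))
      (hmem _ (subset_convexHull ℝ _ ⟨s, rfl⟩))
  have hev := (eventually_mem_intrinsicInterior hp hdir).filter_mono
    (nhdsWithin_le_nhds (s := Set.Ioi 0))
  obtain ⟨ε, hε, hε0⟩ := (hev.and self_mem_nhdsWithin).exists
  obtain ⟨d, hd, hd1, hdp⟩ := hconv _ (intrinsicInterior_subset hε)
  replace hε0 : 0 < ε := hε0
  have hzero := affineIndependent_iff.1 hT Finset.univ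
    (fun r => d r - ((1 + ε) * c r - if r = s then ε else 0))
    (by
      simp only [Finset.sum_sub_distrib, ← Finset.mul_sum, hd1, hc1, Finset.sum_ite_eq',
        Finset.mem_univ, if_true]
      ring)
    (by
      have h1 : ∑ r, ((1 + ε) * c r) • T r = (1 + ε) • p := by
        rw [← hcp, Finset.smul_sum]
        exact Finset.sum_congr rfl fun r _ => mul_smul _ _ _
      have h2 : ∑ r, (if r = s then ε else 0) • T r = ε • T s := by simp
      simp only [sub_smul, Finset.sum_sub_distrib, hdp, h1, h2, add_smul, one_smul, smul_sub]
      abel) s (Finset.mem_univ s)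
  simp only [if_true] at hzero
  have h1 := hd s
  have h2 := hc s
  by_contra! hle
  have : c s = 0 := le_antisymm hle h2
  rw [this] at hzero
  linarith

end Geometry

/-- The properties of the vertices of a McMullen–Walkup polytope on which its face structure
depends. The points `x 0, …, x (m - 1)` lie on a curve with parameters `t 0 < ⋯ < t (m - 1)`, along
which affine functionals are polynomials of degree at most `K`; the value of such a polynomial at
the parameter `t m > t (m - 1)` is a combination with positive weights `c` of the values of the
functional at the remaining points `x m, …, x (N - 1)`; and an affine functional is determined by
its polynomial and by these remaining values. -/
structure IsCurveModel {E : Type*} [NormedAddCommGroup E] [NormedSpace ℝ E] (x : ℕ → E)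
    (K m N : ℕ) (t c : ℕ → ℝ) : Prop where
  t_lt : ∀ i j, i < j → j ≤ m → t i < t j
  c_pos : ∀ s, 0 < c s
  finrank_eq : finrank ℝ E + m + 1 = N + K
  m_lt : m < N
  exists_poly : ∀ A : E →ᵃ[ℝ] ℝ, ∃ q : Polynomial ℝ, q.natDegree ≤ K ∧
    (∀ i < m, q.eval (t i) = A (x i)) ∧
    q.eval (t m) = ∑ s ∈ Finset.Ico m N, c s * A (x s) ∧
    (q = 0 → (∀ s ∈ Finset.Ico m N, A (x s) = 0) → A = 0)

namespace MWPolytope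

variable {K D N : ℕ} (P : MWPolytope K D N)

/-- The vertices indexed by natural numbers, with the dummy value `v₀` from the index `N` on. -/
noncomputable def point (v₀ : EuclideanSpace ℝ (Fin D)) (i : ℕ) : EuclideanSpace ℝ (Fin D) :=
  if h : i < N then P.vertex ⟨i, h⟩ else v₀

/-- The last vertex of the cyclic polytope. -/
noncomputable def apex : EuclideanSpace ℝ (Fin D) :=
  P.place (momentCurve K (P.param ⟨N - D + K - 1, by have := P.two_le; omega⟩))

theorem affineSpan_momentCurve :
    affineSpan ℝ (Set.range fun j => momentCurve K (P.param j)) = ⊤ := by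
  have h := spans_iff_affineSpan (x := fun j => momentCurve K (P.param j)) (Z := Finset.univ)
  rw [Finset.coe_univ, Set.image_univ] at h
  rw [← h]
  intro B hB
  obtain ⟨q, hq, hev, h0⟩ := exists_polynomial_momentCurve B
  refine h0 (Polynomial.eq_zero_of_natDegree_lt_card_of_eval_eq_zero q
    P.param_strictMono.injective (fun j => ?_) ?_)
  · rw [hev]
    exact hB j (Finset.mem_univ j)
  · have := P.dim_lt
    rw [Fintype.card_fin]
    omega

theorem direction_place_disjoint :
    Disjoint (LinearMap.range P.place.linear) (vectorSpan ℝ (Set.range P.simplexVertex)) := by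
  rw [Submodule.disjoint_def]
  intro u hu hu'
  by_contra hne
  have hp : P.apex ∈ intrinsicInterior ℝ (convexHull ℝ (Set.range P.simplexVertex)) :=
    (P.relint_inter.symm.subset rfl).1
  have hdir : u ∈ (affineSpan ℝ (convexHull ℝ (Set.range P.simplexVertex))).direction := by
    rwa [affineSpan_convexHull, direction_affineSpan]
  have hev := (eventually_mem_intrinsicInterior hp hdir).filter_mono
    (nhdsWithin_le_nhds (s := Set.Ioi 0))
  obtain ⟨ε, hε, hε0⟩ := (hev.and self_mem_nhdsWithin).exists
  replace hε0 : 0 < ε := hε0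
  have haff : P.apex + ε • u ∈
      (affineSpan ℝ (Set.range fun j => P.place (momentCurve K (P.param j))) :
        Set (EuclideanSpace ℝ (Fin D))) := by
    have h1 : (Set.range fun j => P.place (momentCurve K (P.param j))) =
        P.place '' Set.range fun j => momentCurve K (P.param j) := by
      rw [← Set.range_comp]
      rfl
    rw [h1, ← AffineSubspace.map_span, P.affineSpan_momentCurve, AffineSubspace.coe_map]
    obtain ⟨z, rfl⟩ := hu
    refine ⟨ε • z +ᵥ momentCurve K (P.param ⟨N - D + K - 1, by have := P.two_le; omega⟩),
      AffineSubspace.mem_top _ _ _, ?_⟩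
    rw [AffineMap.map_vadd, map_smul, vadd_eq_add, add_comm]
    rfl
  have hmem : P.apex + ε • u ∈ ({P.apex} : Set (EuclideanSpace ℝ (Fin D))) :=
    P.relint_inter.subset ⟨hε, haff⟩
  rw [Set.mem_singleton_iff, add_eq_left, smul_eq_zero] at hmem
  exact hmem.elim hε0.ne' hne

theorem eq_zero_of_place_of_simplex (A : EuclideanSpace ℝ (Fin D) →ᵃ[ℝ] ℝ)
    (hC : ∀ y, A (P.place y) = 0) (hT : ∀ s, A (P.simplexVertex s) = 0) : A = 0 := by
  have hlC : LinearMap.range P.place.linear ≤ LinearMap.ker A.linear := by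
    rintro _ ⟨z, rfl⟩
    rw [LinearMap.mem_ker]
    have h1 := hC (z +ᵥ (0 : EuclideanSpace ℝ (Fin K)))
    rw [AffineMap.map_vadd, AffineMap.map_vadd, hC] at h1
    simpa using h1
  have hlT : vectorSpan ℝ (Set.range P.simplexVertex) ≤ LinearMap.ker A.linear := by
    rw [vectorSpan_def, Submodule.span_le]
    rintro _ ⟨_, ⟨s, rfl⟩, _, ⟨s', rfl⟩, rfl⟩
    rw [SetLike.mem_coe, LinearMap.mem_ker, AffineMap.linearMap_vsub, hT, hT]
    simp
  have htop : LinearMap.range P.place.linear ⊔ vectorSpan ℝ (Set.range P.simplexVertex) = ⊤ := by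
    apply Submodule.eq_top_of_disjoint _ _ ?_ P.direction_place_disjoint
    have hinj : Function.Injective P.place.linear :=
      (AffineMap.linear_injective_iff P.place).2 P.place_injective
    rw [LinearMap.finrank_range_of_inj hinj,
      P.simplexVertex_indep.finrank_vectorSpan (Fintype.card_fin _)]
    have := P.le_dim
    simp
    omega
  have hlin : A.linear = 0 := by
    rw [← LinearMap.ker_eq_top, ← top_le_iff, ← htop]
    exact sup_le hlC hlT
  ext y
  have h1 := hC 0
  rw [AffineMap.decomp A] at h1 ⊢
  simp only [hlin] at h1 ⊢
  simpa using h1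

theorem exists_isCurveModel (v₀ : EuclideanSpace ℝ (Fin D)) :
    ∃ t c, IsCurveModel (P.point v₀) K (N - D + K - 1) N t c := by
  have h2 := P.two_le
  have hK := P.le_dim
  have hN := P.dim_lt
  have hp : P.apex ∈ intrinsicInterior ℝ (convexHull ℝ (Set.range P.simplexVertex)) :=
    (P.relint_inter.symm.subset rfl).1
  obtain ⟨c, hc, hc1, hcp⟩ := exists_pos_weights P.simplexVertex_indep hp
  set m := N - D + K - 1 with hm
  have hmN : m + (D - K + 1) = N := by omega
  have hpath : ∀ i (hi : i < m), P.point v₀ i = P.cyclicVertex ⟨i, by omega⟩ := fun i hi => by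
    rw [point, dif_pos (by omega), vertex, dif_pos (by omega)]
  have hsimp : ∀ s (hs : s < D - K + 1), P.point v₀ (m + s) = P.simplexVertex ⟨s, hs⟩ :=
    fun s hs => by
      rw [point, dif_pos (by omega), vertex, dif_neg (by simp; omega)]
      congr 2
      simp
      omega
  have hsum : ∀ f : ℕ → ℝ, ∑ s ∈ Finset.Ico m N, f s = ∑ s : Fin (D - K + 1), f (m + s) :=
    fun f => by
      rw [Finset.sum_Ico_eq_sum_range, show N - m = D - K + 1 by omega, Finset.sum_range]
  refine ⟨fun i => if h : i < N - D + K then P.param ⟨i, h⟩ else 0,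
    fun s => if h : s - m < D - K + 1 then c ⟨s - m, h⟩ else 1, fun i j hij hj => ?_, fun s => ?_,
    ?_, by omega, fun A => ?_⟩
  · rw [dif_pos (by omega), dif_pos (by omega)]
    exact P.param_strictMono hij
  · split_ifs
    · exact hc _
    · exact one_pos
  · rw [finrank_euclideanSpace_fin]
    omega
  · obtain ⟨q, hq, hev, h0⟩ := exists_polynomial_momentCurve (A.comp P.place)
    refine ⟨q, hq, fun i hi => ?_, ?_, fun hq0 hT => ?_⟩
    · rw [dif_pos (by omega), hpath i hi, hev]
      rfl
    · rw [dif_pos (by omega), hev, hsum]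
      have h1 : A P.apex = ∑ s, c s * A (P.simplexVertex s) := by
        rw [← hcp, affine_apply_sum A hc1]
      refine h1.trans (Finset.sum_congr rfl fun s _ => ?_)
      rw [dif_pos (by have := s.2; omega), hsimp s s.2]
      simp
    · refine P.eq_zero_of_place_of_simplex A (fun y => ?_) fun s => ?_
      · have := congrArg (fun f : EuclideanSpace ℝ (Fin K) →ᵃ[ℝ] ℝ => f y) (h0 hq0)
        simpa using this
      · have h1 := hT (m + s) (Finset.mem_Ico.2 ⟨by omega, by have := s.2; omega⟩)
        rwa [hsimp s s.2] at h1

end MWPolytope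

end LexDiamond

namespace LexDiamond

open Module Filter

/-! ### Gale's evenness condition -/

section Sign

open Polynomial

/-- A polynomial of degree at most `n` with `n` known zeros is a multiple of the product of the
corresponding linear factors. -/
theorem exists_eval_eq_mul_prod {q : ℝ[X]} {t : ℕ → ℝ} {S : Finset ℕ} (hq : q.natDegree ≤ S.card)
    (ht : Set.InjOn t S) (h : ∀ i ∈ S, q.eval (t i) = 0) :
    ∃ a : ℝ, ∀ s, q.eval s = a * ∏ z ∈ S, (s - t z) := by
  set p : ℝ[X] := ∏ z ∈ S, (X - C (t z)) with hp
  have hmonic : p.Monic := monic_prod_of_monic _ _ fun z _ => monic_X_sub_C _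
  have hdeg : p.natDegree = S.card := natDegree_finsetProd_X_sub_C_eq_card _ _
  have heval : ∀ s, p.eval s = ∏ z ∈ S, (s - t z) := fun s => by simp [hp, eval_prod]
  refine ⟨q.coeff S.card, fun s => ?_⟩
  have hzero : q - C (q.coeff S.card) * p = 0 := by
    refine eq_zero_of_degree_lt_of_eval_finset_eq_zero (S.image t) ?_ ?_
    · rw [Finset.card_image_of_injOn ht, degree_lt_iff_coeff_zero]
      intro n hn
      rw [coeff_sub, coeff_C_mul]
      rcases hn.eq_or_lt with rfl | hn
      · rw [← hdeg, hmonic.coeff_natDegree, mul_one, sub_self]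
      · rw [coeff_eq_zero_of_natDegree_lt (hq.trans_lt hn),
          coeff_eq_zero_of_natDegree_lt (hdeg.trans_lt hn), mul_zero, sub_zero]
    · intro y hy
      obtain ⟨i, hi, rfl⟩ := Finset.mem_image.1 hy
      rw [eval_sub, eval_mul, heval, h i hi, Finset.prod_eq_zero hi (sub_self _)]
      simp
  have := congrArg (eval s) hzero
  rw [eval_sub, eval_mul, heval, eval_C, eval_zero] at this
  linarith

/-- The number of elements of `S` above `i`. -/
def above (S : Finset ℕ) (i : ℕ) : ℕ := (S.filter fun z => i < z).card

theorem sign_prod {t : ℕ → ℝ} {m : ℕ} (ht : ∀ i j, i < j → j ≤ m → t i < t j) {S : Finset ℕ}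
    (hS : ∀ z ∈ S, z ≤ m) {i : ℕ} (hi : i ≤ m) (hiS : i ∉ S) :
    0 < (-1) ^ above S i * ∏ z ∈ S, (t i - t z) := by
  rw [← Finset.prod_filter_mul_prod_filter_not S (fun z => i < z), ← mul_assoc, above,
    ← Finset.prod_const, ← Finset.prod_mul_distrib]
  refine mul_pos (Finset.prod_pos fun z hz => ?_) (Finset.prod_pos fun z hz => ?_)
  · rw [Finset.mem_filter] at hz
    have := ht i z hz.2 (hS z hz.1)
    linarith
  · rw [Finset.mem_filter] at hz
    have hne : z ≠ i := fun h => hiS (h ▸ hz.1)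
    have := ht z i (by omega) hi
    linarith

/-- The gaps of `S` in `[j, m)` all lie below an even number of elements of `S`. -/
def EvenGaps (j m : ℕ) (S : Finset ℕ) : Prop := ∀ i ∈ Finset.Ico j m, i ∉ S → Even (above S i)

/-- The gaps of `S` in `[j, m)` all lie below an odd number of elements of `S`. -/
def OddGaps (j m : ℕ) (S : Finset ℕ) : Prop := ∀ i ∈ Finset.Ico j m, i ∉ S → Odd (above S i)

/-- The facets of the polytope spanned by the vertices `j, …, N - 1` of a McMullen–Walkup polytope,
where `T` has the vertices `m, …, N - 1`: either a facet of the cyclic polytope avoiding its last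
vertex, joined with a facet of `T`, or a facet of the link of the last vertex, joined with `T`. -/
def IsBoundarySet (k j m N : ℕ) (Z : Finset ℕ) : Prop :=
  (∃ S ⊆ Finset.Ico j m, S.card = 2 * k ∧ EvenGaps j m S ∧
    ∃ s ∈ Finset.Ico m N, Z = S ∪ (Finset.Ico m N).erase s) ∨
  ∃ S ⊆ Finset.Ico j m, S.card + 1 = 2 * k ∧ (EvenGaps j m S ∨ OddGaps j m S) ∧
    Z = S ∪ Finset.Ico m N

theorem disjoint_of_subset_Ico {j m N : ℕ} {S U : Finset ℕ} (hS : S ⊆ Finset.Ico j m)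
    (hU : U ⊆ Finset.Ico m N) : Disjoint S U := by
  rw [Finset.disjoint_left]
  intro i hi hi'
  have h1 := Finset.mem_Ico.1 (hS hi)
  have h2 := Finset.mem_Ico.1 (hU hi')
  omega

end Sign

namespace IsCurveModel

variable {E : Type*} [NormedAddCommGroup E] [NormedSpace ℝ E] {x : ℕ → E} {K k m N : ℕ}
  {t c : ℕ → ℝ}

theorem injOn (hM : IsCurveModel x K m N t c) {S : Finset ℕ} (hS : ∀ z ∈ S, z ≤ m) :
    Set.InjOn t S := by
  intro i hi j hj hij
  rcases lt_trichotomy i j with h | h | h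
  · exact absurd hij (hM.t_lt i j h (hS j hj)).ne
  · exact h
  · exact absurd hij (hM.t_lt j i h (hS i hi)).ne'

/-- An affine functional vanishing on `T` and at `K` further points on the curve is zero. -/
theorem eq_zero_of_vanishing (hM : IsCurveModel x K m N t c) {A : E →ᵃ[ℝ] ℝ} {S : Finset ℕ}
    (hS : ∀ z ∈ S, z < m) (hcard : K ≤ S.card) (hA : ∀ i ∈ S, A (x i) = 0)
    (hT : ∀ s ∈ Finset.Ico m N, A (x s) = 0) : A = 0 := by
  obtain ⟨q, hq, hev, hm, h0⟩ := hM.exists_poly A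
  refine h0 ?_ hT
  have hmS : m ∉ S := fun h => lt_irrefl _ (hS m h)
  refine eq_zero_of_eval_eq_zero hq (hM.injOn (S := insert m S) fun z hz => ?_) ?_ fun i hi => ?_
  · rcases Finset.mem_insert.1 hz with rfl | hz
    · exact le_rfl
    · exact (hS z hz).le
  · rw [Finset.card_insert_of_notMem hmS]
    omega
  · rcases Finset.mem_insert.1 hi with rfl | hi
    · rw [hm]
      exact Finset.sum_eq_zero fun s hs => by rw [hT s hs, mul_zero]
    · rw [hev i (hS i hi), hA i hi]

theorem spans (hM : IsCurveModel x K m N t c) {j : ℕ} (hj : j + K ≤ m) :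
    Spans x (Finset.Ico j N) := by
  intro A hA
  have hmN := hM.m_lt
  refine hM.eq_zero_of_vanishing (S := Finset.Ico j m) (fun z hz => (Finset.mem_Ico.1 hz).2)
    (by rw [Nat.card_Ico]; omega) (fun i hi => hA i ?_) fun i hi => hA i ?_
  · rw [Finset.mem_Ico] at hi ⊢
    omega
  · rw [Finset.mem_Ico] at hi ⊢
    omega

theorem mem_Ico_or (hM : IsCurveModel x K m N t c) {j : ℕ} {i : ℕ} (hj : j ≤ m) :
    i ∈ Finset.Ico j N ↔ i ∈ Finset.Ico j m ∨ i ∈ Finset.Ico m N := by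
  have := hM.m_lt
  simp only [Finset.mem_Ico]
  omega

/-- Gale's evenness condition: a face contains at most `dim E` of the points, and faces with
`dim E` points are boundary sets. -/
theorem card_le_of_supports (hM : IsCurveModel x (2 * k) m N t c) {j : ℕ} (hj : j ≤ m)
    {A : E →ᵃ[ℝ] ℝ} (hA0 : A ≠ 0) {Z : Finset ℕ} (hZ : Z ⊆ Finset.Ico j N)
    (hA : ∀ i ∈ Finset.Ico j N, 0 ≤ A (x i)) (hAZ : ∀ i ∈ Finset.Ico j N, A (x i) = 0 ↔ i ∈ Z) :
    Z.card ≤ finrank ℝ E ∧ (Z.card = finrank ℝ E → IsBoundarySet k j m N Z) := by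
  obtain ⟨q, hq, hev, hm, h0⟩ := hM.exists_poly A
  have hmN := hM.m_lt
  have hD := hM.finrank_eq
  set S := Z ∩ Finset.Ico j m with hSdef
  set U := Z ∩ Finset.Ico m N with hUdef
  have hSI : S ⊆ Finset.Ico j m := Finset.inter_subset_right
  have hUI : U ⊆ Finset.Ico m N := Finset.inter_subset_right
  have hZSU : Z = S ∪ U := by
    ext i
    simp only [hSdef, hUdef, Finset.mem_union, Finset.mem_inter, ← and_or_left, ← hM.mem_Ico_or hj]
    exact ⟨fun h => ⟨h, hZ h⟩, fun h => h.1⟩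
  have hcard : Z.card = S.card + U.card := by
    rw [hZSU, Finset.card_union_of_disjoint (disjoint_of_subset_Ico hSI hUI)]
  have hpath : ∀ i ∈ Finset.Ico j m, i ∈ Finset.Ico j N := fun i hi =>
    (hM.mem_Ico_or hj).2 (.inl hi)
  have hsimp : ∀ i ∈ Finset.Ico m N, i ∈ Finset.Ico j N := fun i hi =>
    (hM.mem_Ico_or hj).2 (.inr hi)
  have hSlt : ∀ i ∈ S, i < m := fun i hi => (Finset.mem_Ico.1 (hSI hi)).2
  have hSev : ∀ i ∈ S, q.eval (t i) = 0 := fun i hi => by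
    rw [hev i (hSlt i hi)]
    exact (hAZ i (hpath i (hSI hi))).2 (Finset.mem_inter.1 hi).1
  have hgap : ∀ i ∈ Finset.Ico j m, i ∉ S → 0 < q.eval (t i) := fun i hi hiS => by
    rw [hev i (Finset.mem_Ico.1 hi).2]
    refine lt_of_le_of_ne (hA i (hpath i hi)) fun h => hiS ?_
    exact Finset.mem_inter.2 ⟨(hAZ i (hpath i hi)).1 h.symm, hi⟩
  have hterm : ∀ s ∈ Finset.Ico m N, 0 ≤ c s * A (x s) := fun s hs =>
    mul_nonneg (hM.c_pos s).le (hA s (hsimp s hs))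
  have hpval : 0 ≤ q.eval (t m) := by
    rw [hm]
    exact Finset.sum_nonneg hterm
  rcases hpval.eq_or_lt with hp | hp
  · have hTall : ∀ s ∈ Finset.Ico m N, A (x s) = 0 := fun s hs => by
      rw [hm, eq_comm, Finset.sum_eq_zero_iff_of_nonneg hterm] at hp
      exact (mul_eq_zero.1 (hp s hs)).resolve_left (hM.c_pos s).ne'
    have hU : U = Finset.Ico m N := Finset.inter_eq_right.2 fun s hs =>
      (hAZ s (hsimp s hs)).1 (hTall s hs)
    have hUcard : U.card = N - m := by rw [hU, Nat.card_Ico]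
    have hmS : m ∉ S := fun h => lt_irrefl _ (hSlt m h)
    have hSle : ∀ z ∈ insert m S, z ≤ m := fun z hz => by
      rcases Finset.mem_insert.1 hz with rfl | hz
      · exact le_rfl
      · exact (hSlt z hz).le
    have hroots : ∀ z ∈ insert m S, q.eval (t z) = 0 := fun z hz => by
      rcases Finset.mem_insert.1 hz with rfl | hz
      · exact hp.symm
      · exact hSev z hz
    have hScard : S.card + 1 ≤ 2 * k := by
      by_contra! hc
      refine hA0 (h0 (eq_zero_of_eval_eq_zero hq (hM.injOn hSle) ?_ hroots) hTall)
      rwa [Finset.card_insert_of_notMem hmS]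
    refine ⟨by omega, fun heq => Or.inr ⟨S, hSI, by omega, ?_, by rw [← hU]; exact hZSU⟩⟩
    obtain ⟨a, ha⟩ := exists_eval_eq_mul_prod (q := q) (S := insert m S)
      (by rw [Finset.card_insert_of_notMem hmS]; omega) (hM.injOn hSle) hroots
    -- the sign of `q` on a gap determines the parity of the number of roots above it
    have hsign : ∀ i ∈ Finset.Ico j m, i ∉ S → 0 < a * (-1) ^ (above S i + 1) := fun i hi hiS => by
      have him := (Finset.mem_Ico.1 hi).2
      have h1 := hgap i hi hiS
      have h2 := sign_prod hM.t_lt hSle him.le (i := i) (by simp [hiS, him.ne])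
      have h3 : above (insert m S) i = above S i + 1 := by
        rw [above, Finset.filter_insert, if_pos him, Finset.card_insert_of_notMem (by simp [hmS]),
          above]
      rw [ha] at h1
      rw [h3] at h2
      generalize ∏ z ∈ insert m S, (t i - t z) = p at h1 h2
      have h4 : 0 < a * (-1) ^ (above S i + 1) * p ^ 2 := by
        have := mul_pos h1 h2
        calc 0 < a * p * ((-1) ^ (above S i + 1) * p) := this
          _ = a * (-1) ^ (above S i + 1) * p ^ 2 := by ring
      exact pos_of_mul_pos_left h4 (sq_nonneg _)
    by_cases hapos : 0 < a
    · right
      intro i hi hiS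
      by_contra hodd
      rw [Nat.not_odd_iff_even] at hodd
      have := hsign i hi hiS
      rw [hodd.add_one.neg_one_pow] at this
      linarith
    · left
      intro i hi hiS
      by_contra heven
      rw [Nat.not_even_iff_odd] at heven
      have := hsign i hi hiS
      rw [heven.add_one.neg_one_pow] at this
      linarith
  · obtain ⟨s, hs, hAs⟩ : ∃ s ∈ Finset.Ico m N, A (x s) ≠ 0 := by
      by_contra! hall
      rw [hm, Finset.sum_eq_zero fun s hs => by rw [hall s hs, mul_zero]] at hp
      exact lt_irrefl _ hp
    have hUs : U ⊆ (Finset.Ico m N).erase s := fun i hi => by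
      refine Finset.mem_erase.2 ⟨?_, hUI hi⟩
      rintro rfl
      exact hAs ((hAZ i (hsimp i hs)).2 (Finset.mem_inter.1 hi).1)
    have hUcard := Finset.card_le_card hUs
    have hecard : ((Finset.Ico m N).erase s).card = N - m - 1 := by
      rw [Finset.card_erase_of_mem hs, Nat.card_Ico]
    have hSle : ∀ z ∈ S, z ≤ m := fun z hz => (hSlt z hz).le
    have hScard : S.card ≤ 2 * k := by
      by_contra! hc
      have := eq_zero_of_eval_eq_zero hq (hM.injOn hSle) hc hSev
      rw [this] at hp
      simp at hp
    refine ⟨by omega, fun heq => Or.inl ⟨S, hSI, by omega, ?_, s, hs, ?_⟩⟩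
    · obtain ⟨a, ha⟩ := exists_eval_eq_mul_prod (q := q) (S := S) (by omega) (hM.injOn hSle) hSev
      have ham : 0 < a := by
        rw [ha] at hp
        refine pos_of_mul_pos_left hp (Finset.prod_nonneg fun z hz => ?_)
        have := hM.t_lt z m (hSlt z hz) le_rfl
        linarith
      intro i hi hiS
      by_contra hodd
      rw [Nat.not_even_iff_odd] at hodd
      have h1 := hgap i hi hiS
      have h2 := sign_prod hM.t_lt hSle (Finset.mem_Ico.1 hi).2.le hiS
      rw [hodd.neg_one_pow] at h2
      rw [ha] at h1
      have h3 := pos_of_mul_pos_right h1 ham.le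
      linarith
    · rw [← Finset.eq_of_subset_of_card_le hUs (by omega)]
      exact hZSU

variable [FiniteDimensional ℝ E]

theorem simplicial (hM : IsCurveModel x (2 * k) m N t c) {j : ℕ} (hj : j ≤ m) :
    Simplicial x (Finset.Ico j N) := by
  rintro Z ⟨A, hA⟩
  exact le_antisymm
    (hM.card_le_of_supports hj hA.ne_zero hA.subset hA.nonneg hA.eq_zero_iff).1
    (finrank_le_card_of_unique hA.unique)

/-- Boundary sets are facets. -/
theorem isFacetSet_of_isBoundarySet (hM : IsCurveModel x (2 * k) m N t c) {j : ℕ}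
    (hj : j + 2 * k ≤ m) {Z : Finset ℕ} (hZ : IsBoundarySet k j m N Z) :
    IsFacetSet x (Finset.Ico j N) Z := by
  have hmN := hM.m_lt
  have hD := hM.finrank_eq
  have hmem : ∀ i, i ∈ Finset.Ico j N ↔ i ∈ Finset.Ico j m ∨ i ∈ Finset.Ico m N := fun i =>
    hM.mem_Ico_or (by omega)
  rcases hZ with ⟨S, hSI, hScard, hgaps, s, hs, rfl⟩ | ⟨S, hSI, hScard, hgaps, rfl⟩
  · have hSlt : ∀ i ∈ S, i < m := fun i hi => (Finset.mem_Ico.1 (hSI hi)).2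
    have hSle : ∀ z ∈ S, z ≤ m := fun z hz => (hSlt z hz).le
    have hUI := Finset.erase_subset s (Finset.Ico m N)
    have hcard : (S ∪ (Finset.Ico m N).erase s).card = finrank ℝ E := by
      rw [Finset.card_union_of_disjoint (disjoint_of_subset_Ico hSI hUI), hScard,
        Finset.card_erase_of_mem hs, Nat.card_Ico]
      omega
    -- a functional vanishing on `Z` is determined by its value at the remaining vertex of `T`
    have hdet : ∀ B : E →ᵃ[ℝ] ℝ, (∀ i ∈ S ∪ (Finset.Ico m N).erase s, B (x i) = 0) →
        B (x s) = 0 → B = 0 := fun B hB hBs => by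
      refine hM.eq_zero_of_vanishing hSlt hScard.ge
        (fun i hi => hB i (Finset.mem_union_left _ hi)) fun i hi => ?_
      rcases eq_or_ne i s with rfl | his
      · exact hBs
      · exact hB i (Finset.mem_union_right _ (Finset.mem_erase.2 ⟨his, hi⟩))
    obtain ⟨A, hAs, hAZ⟩ : ∃ A : E →ᵃ[ℝ] ℝ, 0 < A (x s) ∧
        ∀ i ∈ S ∪ (Finset.Ico m N).erase s, A (x i) = 0 := by
      obtain ⟨A, hA0, hA⟩ := exists_vanishing_of_card_le x _ hcard.le
      rcases lt_trichotomy (A (x s)) 0 with h | h | h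
      · exact ⟨-A, by simpa using h, fun i hi => by simp [hA i hi]⟩
      · exact absurd (hdet A hA h) hA0
      · exact ⟨A, h, hA⟩
    obtain ⟨q, hq, hev, hm, h0⟩ := hM.exists_poly A
    obtain ⟨a, ha⟩ := exists_eval_eq_mul_prod (q := q) (S := S) (by omega)
      (hM.injOn hSle) fun i hi => by
      rw [hev i (hSlt i hi)]
      exact hAZ i (Finset.mem_union_left _ hi)
    have hapos : 0 < a := by
      have h1 : 0 < q.eval (t m) := by
        rw [hm, Finset.sum_eq_single_of_mem s hs fun i hi his => by
          rw [hAZ i (Finset.mem_union_right _ (Finset.mem_erase.2 ⟨his, hi⟩)), mul_zero]]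
        exact mul_pos (hM.c_pos s) hAs
      rw [ha] at h1
      refine pos_of_mul_pos_left h1 (Finset.prod_nonneg fun z hz => ?_)
      have := hM.t_lt z m (hSlt z hz) le_rfl
      linarith
    have hpos : ∀ i ∈ Finset.Ico j N, i ∉ S ∪ (Finset.Ico m N).erase s → 0 < A (x i) :=
      fun i hi hiZ => by
        rw [Finset.mem_union, Finset.mem_erase, not_or] at hiZ
        rcases (hmem i).1 hi with hi | hi
        · have him := (Finset.mem_Ico.1 hi).2
          have h1 := sign_prod hM.t_lt hSle him.le hiZ.1
          rw [(hgaps i hi hiZ.1).neg_one_pow, one_mul] at h1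
          rw [← hev i him, ha]
          exact mul_pos hapos h1
        · have his : i = s := by
            by_contra his
            exact hiZ.2 ⟨his, hi⟩
          rwa [his]
    refine ⟨A, Finset.union_subset (fun i hi => (hmem i).2 (.inl (hSI hi))) fun i hi =>
      (hmem i).2 (.inr (hUI hi)), ?_, fun i hi => ?_, fun i hi => ?_, fun B hB => ?_⟩
    · rintro rfl
      exact lt_irrefl _ hAs
    · by_cases hiZ : i ∈ S ∪ (Finset.Ico m N).erase s
      · exact (hAZ i hiZ).ge
      · exact (hpos i hi hiZ).le
    · by_cases hiZ : i ∈ S ∪ (Finset.Ico m N).erase s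
      · exact iff_of_true (hAZ i hiZ) hiZ
      · exact iff_of_false (hpos i hi hiZ).ne' hiZ
    · refine ⟨B (x s) / A (x s), sub_eq_zero.1 (hdet _ (fun i hi => ?_) ?_)⟩
      · simp [hB i hi, hAZ i hi]
      · simp [hAs.ne']
  · have hSlt : ∀ i ∈ S, i < m := fun i hi => (Finset.mem_Ico.1 (hSI hi)).2
    have hmS : m ∉ S := fun h => lt_irrefl _ (hSlt m h)
    have hSle : ∀ z ∈ insert m S, z ≤ m := fun z hz => by
      rcases Finset.mem_insert.1 hz with rfl | hz
      · exact le_rfl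
      · exact (hSlt z hz).le
    have hcard : (S ∪ Finset.Ico m N).card = finrank ℝ E := by
      rw [Finset.card_union_of_disjoint (disjoint_of_subset_Ico hSI subset_rfl), Nat.card_Ico]
      omega
    obtain ⟨s, hs, hsS⟩ : ∃ s ∈ Finset.Ico j m, s ∉ S := by
      by_contra! hall
      have := Finset.card_le_card hall
      rw [Nat.card_Ico] at this
      omega
    have hsm := (Finset.mem_Ico.1 hs).2
    -- a functional vanishing on `Z` is determined by its value at any other point of the curve
    have hdet : ∀ B : E →ᵃ[ℝ] ℝ, (∀ i ∈ S ∪ Finset.Ico m N, B (x i) = 0) →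
        B (x s) = 0 → B = 0 := fun B hB hBs => by
      refine hM.eq_zero_of_vanishing (S := insert s S) (fun i hi => ?_) ?_ (fun i hi => ?_)
        fun i hi => hB i (Finset.mem_union_right _ hi)
      · rcases Finset.mem_insert.1 hi with rfl | hi
        · exact hsm
        · exact hSlt i hi
      · rw [Finset.card_insert_of_notMem hsS]
        omega
      · rcases Finset.mem_insert.1 hi with rfl | hi
        · exact hBs
        · exact hB i (Finset.mem_union_left _ hi)
    obtain ⟨A, hAs, hAZ⟩ : ∃ A : E →ᵃ[ℝ] ℝ, 0 < A (x s) ∧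
        ∀ i ∈ S ∪ Finset.Ico m N, A (x i) = 0 := by
      obtain ⟨A, hA0, hA⟩ := exists_vanishing_of_card_le x _ hcard.le
      rcases lt_trichotomy (A (x s)) 0 with h | h | h
      · exact ⟨-A, by simpa using h, fun i hi => by simp [hA i hi]⟩
      · exact absurd (hdet A hA h) hA0
      · exact ⟨A, h, hA⟩
    obtain ⟨q, hq, hev, hm, h0⟩ := hM.exists_poly A
    obtain ⟨a, ha⟩ := exists_eval_eq_mul_prod (q := q) (S := insert m S)
      (by rw [Finset.card_insert_of_notMem hmS]; omega) (hM.injOn hSle) fun i hi => by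
        rcases Finset.mem_insert.1 hi with rfl | hi
        · rw [hm]
          exact Finset.sum_eq_zero fun r hr => by
            rw [hAZ r (Finset.mem_union_right _ hr), mul_zero]
        · rw [hev i (hSlt i hi)]
          exact hAZ i (Finset.mem_union_left _ hi)
    have hpos : ∀ i ∈ Finset.Ico j N, i ∉ S ∪ Finset.Ico m N → 0 < A (x i) := fun i hi hiZ => by
      rw [Finset.mem_union, not_or] at hiZ
      have hi' := ((hmem i).1 hi).resolve_right hiZ.2
      have him := (Finset.mem_Ico.1 hi').2
      have habove : ∀ r < m, above (insert m S) r = above S r + 1 := fun r hr => by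
        rw [above, Finset.filter_insert, if_pos hr, Finset.card_insert_of_notMem (by simp [hmS]),
          above]
      have h1 := sign_prod hM.t_lt hSle him.le (i := i) (by simp [hiZ.1, him.ne])
      have h2 := sign_prod hM.t_lt hSle hsm.le (i := s) (by simp [hsS, hsm.ne])
      rw [habove _ him] at h1
      rw [habove _ hsm] at h2
      have hpar : ((-1 : ℝ)) ^ (above S i + 1) = (-1) ^ (above S s + 1) := by
        rcases hgaps with hg | hg
        · rw [(hg i hi' hiZ.1).add_one.neg_one_pow, (hg s hs hsS).add_one.neg_one_pow]
        · rw [(hg i hi' hiZ.1).add_one.neg_one_pow, (hg s hs hsS).add_one.neg_one_pow]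
      rw [hpar] at h1
      rw [← hev s hsm, ha] at hAs
      rw [← hev i him, ha]
      -- the values at `i` and at `s` have the same sign
      have h3 : 0 < (∏ z ∈ insert m S, (t i - t z)) * ∏ z ∈ insert m S, (t s - t z) := by
        have h4 := mul_pos h1 h2
        rcases neg_one_pow_eq_or ℝ (above S s + 1) with h | h <;> rw [h] at h4 <;> linarith
      have h5 : 0 < (a * ∏ z ∈ insert m S, (t i - t z)) *
          (∏ z ∈ insert m S, (t s - t z)) ^ 2 := by
        have h4 := mul_pos hAs h3
        linarith
      exact pos_of_mul_pos_left h5 (sq_nonneg _)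
    refine ⟨A, Finset.union_subset (fun i hi => (hmem i).2 (.inl (hSI hi))) fun i hi =>
      (hmem i).2 (.inr hi), ?_, fun i hi => ?_, fun i hi => ?_, fun B hB => ?_⟩
    · rintro rfl
      exact lt_irrefl _ hAs
    · by_cases hiZ : i ∈ S ∪ Finset.Ico m N
      · exact (hAZ i hiZ).ge
      · exact (hpos i hi hiZ).le
    · by_cases hiZ : i ∈ S ∪ Finset.Ico m N
      · exact iff_of_true (hAZ i hiZ) hiZ
      · exact iff_of_false (hpos i hi hiZ).ne' hiZ
    · refine ⟨B (x s) / A (x s), sub_eq_zero.1 (hdet _ (fun i hi => ?_) ?_)⟩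
      · simp [hB i hi, hAZ i hi]
      · simp [hAs.ne']

theorem isFacetSet_iff (hM : IsCurveModel x (2 * k) m N t c) {j : ℕ} (hj : j + 2 * k ≤ m)
    {Z : Finset ℕ} : IsFacetSet x (Finset.Ico j N) Z ↔ IsBoundarySet k j m N Z := by
  refine ⟨fun hZ => ?_, hM.isFacetSet_of_isBoundarySet hj⟩
  have hcard := hM.simplicial (by omega) Z hZ
  obtain ⟨A, hA⟩ := hZ
  exact (hM.card_le_of_supports (by omega) hA.ne_zero hA.subset hA.nonneg hA.eq_zero_iff).2 hcard

end IsCurveModel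

end LexDiamond

namespace LexDiamond

/-! ### Unions of adjacent pairs -/

/-- `S` is a union of `k` disjoint pairs of consecutive elements of `[j, m)`. By Gale's evenness
condition these sets index the facets of the cyclic polytope of dimension `2 k` with vertices
`j, …, m` that avoid the last vertex `m`. -/
def IsPairSet (k j m : ℕ) (S : Finset ℕ) : Prop :=
  S ⊆ Finset.Ico j m ∧ S.card = 2 * k ∧ EvenGaps j m S

/-- `A` is contained in a union of `k` disjoint pairs of consecutive elements of `[j, m)`. -/
def InPairSet (k j m : ℕ) (A : Finset ℕ) : Prop := ∃ S, IsPairSet k j m S ∧ A ⊆ S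

theorem above_insert_of_lt {S : Finset ℕ} {i z : ℕ} (hz : z ∉ S) (hiz : i < z) :
    above (insert z S) i = above S i + 1 := by
  rw [above, Finset.filter_insert, if_pos hiz, Finset.card_insert_of_notMem (by simp [hz]), above]

theorem above_insert_of_le {S : Finset ℕ} {i z : ℕ} (hiz : z ≤ i) :
    above (insert z S) i = above S i := by
  rw [above, Finset.filter_insert, if_neg (not_lt.2 hiz), above]

theorem above_eq_card {S : Finset ℕ} {i : ℕ} (h : ∀ z ∈ S, i < z) : above S i = S.card := by
  rw [above, Finset.filter_true_of_mem h]

theorem above_eq_zero {S : Finset ℕ} {i : ℕ} (h : ∀ z ∈ S, z ≤ i) : above S i = 0 := by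
  rw [above, Finset.filter_false_of_mem fun z hz => not_lt.2 (h z hz), Finset.card_empty]

theorem IsPairSet.notMem_of_lt {k j m : ℕ} {S : Finset ℕ} (h : IsPairSet k j m S) {i : ℕ}
    (hi : i < j) : i ∉ S := fun hS => by
  have := Finset.mem_Ico.1 (h.1 hS)
  omega

theorem IsPairSet.notMem_of_le {k j m : ℕ} {S : Finset ℕ} (h : IsPairSet k j m S) {i : ℕ}
    (hi : m ≤ i) : i ∉ S := fun hS => by
  have := Finset.mem_Ico.1 (h.1 hS)
  omega

theorem IsPairSet.le {k j m : ℕ} {S : Finset ℕ} (h : IsPairSet k j m S) :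
    2 * k ≤ m - j := by
  have := Finset.card_le_card h.1
  rwa [h.2.1, Nat.card_Ico] at this

theorem isPairSet_full {k j m : ℕ} (h : m = j + 2 * k) : IsPairSet k j m (Finset.Ico j m) :=
  ⟨subset_rfl, by rw [Nat.card_Ico]; omega, fun _ hi hi' => absurd hi hi'⟩

theorem isPairSet_zero (j m : ℕ) : IsPairSet 0 j m ∅ :=
  ⟨Finset.empty_subset _, by simp, fun i _ _ => by simp [above]⟩

theorem IsPairSet.succ_left {k j m : ℕ} {S : Finset ℕ} (h : IsPairSet k (j + 1) m S) :
    IsPairSet k j m S := by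
  refine ⟨h.1.trans (Finset.Ico_subset_Ico_left (by omega)), h.2.1, fun i hi hiS => ?_⟩
  rw [Finset.mem_Ico] at hi
  rcases hi.1.eq_or_lt with rfl | hlt
  · rw [above_eq_card fun z hz => (Finset.mem_Ico.1 (h.1 hz)).1, h.2.1]
    exact even_two_mul k
  · exact h.2.2 i (Finset.mem_Ico.2 ⟨hlt, hi.2⟩) hiS

theorem IsPairSet.of_succ_left {k j m : ℕ} {S : Finset ℕ} (h : IsPairSet k j m S) (hj : j ∉ S) :
    IsPairSet k (j + 1) m S := by
  refine ⟨fun i hi => ?_, h.2.1, fun i hi hiS => h.2.2 i ?_ hiS⟩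
  · have h1 := Finset.mem_Ico.1 (h.1 hi)
    have h2 : i ≠ j := fun h => hj (h ▸ hi)
    exact Finset.mem_Ico.2 ⟨by omega, h1.2⟩
  · rw [Finset.mem_Ico] at hi ⊢
    omega

theorem IsPairSet.insert_pair {k j m : ℕ} {S : Finset ℕ} (h : IsPairSet k (j + 2) m S)
    (hjm : j + 2 ≤ m) : IsPairSet (k + 1) j m (insert j (insert (j + 1) S)) := by
  have h1 : j + 1 ∉ S := h.notMem_of_lt (by omega)
  have h0 : j ∉ insert (j + 1) S := by
    rw [Finset.mem_insert, not_or]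
    exact ⟨by omega, h.notMem_of_lt (by omega)⟩
  refine ⟨fun i hi => ?_, ?_, fun i hi hiS => ?_⟩
  · rw [Finset.mem_insert, Finset.mem_insert] at hi
    rw [Finset.mem_Ico]
    rcases hi with rfl | rfl | hi
    · omega
    · omega
    · have := Finset.mem_Ico.1 (h.1 hi)
      omega
  · rw [Finset.card_insert_of_notMem h0, Finset.card_insert_of_notMem h1, h.2.1]
    ring
  · rw [Finset.mem_insert, Finset.mem_insert, not_or, not_or] at hiS
    rw [Finset.mem_Ico] at hi
    rw [above_insert_of_le hi.1, above_insert_of_le (by omega)]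
    exact h.2.2 i (Finset.mem_Ico.2 ⟨by omega, hi.2⟩) hiS.2.2

/-- If the first element belongs to a union of pairs, then so does its successor, and the rest is
again a union of pairs. -/
theorem IsPairSet.exists_of_mem {k j m : ℕ} {S : Finset ℕ} (h : IsPairSet k j m S) (hj : j ∈ S) :
    ∃ k' S', k = k' + 1 ∧ j + 2 ≤ m ∧ IsPairSet k' (j + 2) m S' ∧
      S = insert j (insert (j + 1) S') := by
  have hcard := h.2.1
  have hpos : 0 < S.card := Finset.card_pos.2 ⟨j, hj⟩
  have hle := h.le
  have herase : ∀ z ∈ S.erase j, j + 1 ≤ z := fun z hz => by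
    rw [Finset.mem_erase] at hz
    have := Finset.mem_Ico.1 (h.1 hz.2)
    omega
  have hins := Finset.insert_erase hj
  have hcard' : (S.erase j).card = 2 * k - 1 := by rw [Finset.card_erase_of_mem hj, hcard]
  have hj1 : j + 1 ∈ S := by
    by_contra hj1
    have heven := h.2.2 (j + 1) (Finset.mem_Ico.2 ⟨by omega, by omega⟩) hj1
    rw [← hins, above_insert_of_le (by omega), above_eq_card, hcard', Nat.even_iff] at heven
    · omega
    · intro z hz
      have h1 := herase z hz
      have h2 : z ≠ j + 1 := fun h => hj1 (h ▸ (Finset.mem_erase.1 hz).2)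
      omega
  have hj1' : j + 1 ∈ S.erase j := Finset.mem_erase.2 ⟨by omega, hj1⟩
  have heq : S = insert j (insert (j + 1) ((S.erase j).erase (j + 1))) := by
    rw [Finset.insert_erase hj1', hins]
  refine ⟨k - 1, (S.erase j).erase (j + 1), by omega, by omega, ⟨fun z hz => ?_, ?_,
    fun i hi hiS => ?_⟩, heq⟩
  · rw [Finset.mem_erase] at hz
    have h1 := herase z hz.2
    have h2 := Finset.mem_Ico.1 (h.1 (Finset.mem_erase.1 hz.2).2)
    rw [Finset.mem_Ico]
    omega
  · rw [Finset.card_erase_of_mem hj1', hcard']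
    omega
  · rw [Finset.mem_Ico] at hi
    have := h.2.2 i (Finset.mem_Ico.2 ⟨by omega, hi.2⟩) (by
      rw [heq, Finset.mem_insert, Finset.mem_insert, not_or, not_or]
      exact ⟨by omega, by omega, hiS⟩)
    rwa [heq, above_insert_of_le (by omega), above_insert_of_le (by omega)] at this

theorem InPairSet.mono {k j m : ℕ} {A B : Finset ℕ} (h : InPairSet k j m A) (hBA : B ⊆ A) :
    InPairSet k j m B := by
  obtain ⟨S, hS, hA⟩ := h
  exact ⟨S, hS, hBA.trans hA⟩

theorem InPairSet.subset {k j m : ℕ} {A : Finset ℕ} (h : InPairSet k j m A) :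
    A ⊆ Finset.Ico j m := by
  obtain ⟨S, hS, hA⟩ := h
  exact hA.trans hS.1

theorem InPairSet.card_le {k j m : ℕ} {A : Finset ℕ} (h : InPairSet k j m A) :
    A.card ≤ 2 * k := by
  obtain ⟨S, hS, hA⟩ := h
  exact (Finset.card_le_card hA).trans hS.2.1.le

theorem InPairSet.succ_left {k j m : ℕ} {A : Finset ℕ} (h : InPairSet k (j + 1) m A) :
    InPairSet k j m A := by
  obtain ⟨S, hS, hA⟩ := h
  exact ⟨S, hS.succ_left, hA⟩

theorem inPairSet_full {k j m : ℕ} (h : m = j + 2 * k) {A : Finset ℕ} (hA : A ⊆ Finset.Ico j m) :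
    InPairSet k j m A :=
  ⟨_, isPairSet_full h, hA⟩

theorem inPairSet_zero_iff {j m : ℕ} {A : Finset ℕ} : InPairSet 0 j m A ↔ A = ∅ := by
  constructor
  · intro h
    simpa using h.card_le
  · rintro rfl
    exact ⟨∅, isPairSet_zero j m, subset_rfl⟩

/-- If there is room, a union of pairs can be shifted to the right to avoid the first element. -/
theorem IsPairSet.erase_first {k j m : ℕ} {S : Finset ℕ} (h : IsPairSet k j m S)
    (hm : j + 1 + 2 * k ≤ m) : InPairSet k (j + 1) m (S.erase j) := by
  induction k generalizing j S with
  | zero =>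
    have : S = ∅ := by simpa using h.2.1
    subst this
    exact inPairSet_zero_iff.2 rfl
  | succ k ih =>
    by_cases hj : j ∈ S
    · obtain ⟨k', S', hk, -, hS', rfl⟩ := h.exists_of_mem hj
      obtain rfl : k = k' := by omega
      obtain ⟨S'', hS'', hsub⟩ := ih hS' (by omega)
      refine ⟨_, hS''.insert_pair (j := j + 1) (by omega), fun i hi => ?_⟩
      rw [Finset.mem_erase, Finset.mem_insert, Finset.mem_insert] at hi
      rw [Finset.mem_insert, Finset.mem_insert]
      by_cases h2 : i = j + 1 + 1
      · exact Or.inr (Or.inl h2)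
      · rcases hi.2 with h3 | h3 | h3
        · exact absurd h3 hi.1
        · exact Or.inl h3
        · exact Or.inr (Or.inr (hsub (Finset.mem_erase.2 ⟨h2, h3⟩)))
    · exact ⟨S, h.of_succ_left hj, Finset.erase_subset _ _⟩

theorem inPairSet_succ_left_iff {k j m : ℕ} {A : Finset ℕ} (hj : j ∉ A)
    (hm : j + 1 + 2 * k ≤ m) : InPairSet k j m A ↔ InPairSet k (j + 1) m A := by
  refine ⟨?_, InPairSet.succ_left⟩
  rintro ⟨S, hS, hA⟩
  exact (hS.erase_first hm).mono fun i hi => Finset.mem_erase.2 ⟨fun h => hj (h ▸ hi), hA hi⟩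

theorem InPairSet.insert_pair {k j m : ℕ} {A : Finset ℕ} (h : InPairSet k (j + 2) m A)
    (hjm : j + 2 ≤ m) : InPairSet (k + 1) j m (insert j (insert (j + 1) A)) := by
  obtain ⟨S, hS, hA⟩ := h
  exact ⟨_, hS.insert_pair hjm, Finset.insert_subset_insert _ (Finset.insert_subset_insert _ hA)⟩

theorem InPairSet.of_mem {k j m : ℕ} {A : Finset ℕ} (h : InPairSet (k + 1) j m A) (hj : j ∈ A) :
    InPairSet k (j + 2) m ((A.erase j).erase (j + 1)) := by
  obtain ⟨S, hS, hA⟩ := h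
  obtain ⟨k', S', hk, -, hS', rfl⟩ := hS.exists_of_mem (hA hj)
  obtain rfl : k = k' := by omega
  refine ⟨S', hS', fun i hi => ?_⟩
  rw [Finset.mem_erase, Finset.mem_erase] at hi
  have := hA hi.2.2
  rw [Finset.mem_insert, Finset.mem_insert] at this
  tauto

theorem InPairSet.insert_first {k j m : ℕ} {A : Finset ℕ} (h : InPairSet k (j + 1) m A)
    (hm : j + 2 * (k + 1) ≤ m) : InPairSet (k + 1) j m (insert j A) := by
  obtain ⟨S, hS, hA⟩ := h
  refine ((hS.erase_first (by omega)).insert_pair (by omega)).mono fun i hi => ?_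
  rw [Finset.mem_insert] at hi
  rw [Finset.mem_insert, Finset.mem_insert, Finset.mem_erase]
  rcases hi with hi | hi
  · exact Or.inl hi
  · by_cases h1 : i = j + 1
    · exact Or.inr (Or.inl h1)
    · exact Or.inr (Or.inr ⟨h1, hA hi⟩)

theorem IsPairSet.insert_last {k j m : ℕ} {S : Finset ℕ} (h : IsPairSet k j m S)
    (hm : j + 2 * (k + 1) ≤ m + 1) : InPairSet (k + 1) j (m + 1) (insert m S) := by
  induction hn : m - j using Nat.strong_induction_on generalizing k j S with
  | _ n ih =>
    rcases hm.eq_or_lt with heq | hlt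
    · refine inPairSet_full heq.symm fun i hi => ?_
      rw [Finset.mem_insert] at hi
      rw [Finset.mem_Ico]
      rcases hi with rfl | hi
      · omega
      · have := Finset.mem_Ico.1 (h.1 hi)
        omega
    · by_cases hj : j ∈ S
      · obtain ⟨k', S', rfl, -, hS', rfl⟩ := h.exists_of_mem hj
        refine ((ih (m - (j + 2)) (by omega) hS' (by omega) rfl).insert_pair (by omega)).mono ?_
        intro i
        simp only [Finset.mem_insert]
        tauto
      · exact (ih (m - (j + 1)) (by omega) (h.of_succ_left hj) (by omega) rfl).succ_left

/-- Neighborliness: all sets of at most `k` elements are contained in unions of `k` pairs. -/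
theorem inPairSet_of_card_le {k j m : ℕ} {A : Finset ℕ} (hA : A ⊆ Finset.Ico j m)
    (hcard : A.card ≤ k) (hm : j + 2 * k ≤ m) : InPairSet k j m A := by
  induction hn : m - j using Nat.strong_induction_on generalizing k j A with
  | _ n ih =>
    rcases hm.eq_or_lt with heq | hlt
    · exact inPairSet_full heq.symm hA
    · by_cases hj : j ∈ A
      · have h1 := Finset.card_erase_add_one hj
        obtain ⟨k, rfl⟩ : ∃ k', k = k' + 1 := ⟨k - 1, by omega⟩
        rw [← Finset.insert_erase hj]
        refine (ih (m - (j + 1)) (by omega) (fun i hi => ?_) (by omega) (by omega)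
          rfl).insert_first hm
        rw [Finset.mem_erase] at hi
        have := Finset.mem_Ico.1 (hA hi.2)
        rw [Finset.mem_Ico]
        omega
      · refine (ih (m - (j + 1)) (by omega) (fun i hi => ?_) hcard (by omega) rfl).succ_left
        have h1 := Finset.mem_Ico.1 (hA hi)
        have h2 : i ≠ j := fun h => hj (h ▸ hi)
        rw [Finset.mem_Ico]
        omega

/-! ### Facets as unions of pairs -/

/-- The facets of the polytope spanned by the vertices `j, …, N - 1` in terms of unions of pairs. -/
theorem isBoundarySet_iff {k j m N : ℕ} (hj : j + 2 * (k + 1) ≤ m) {Z : Finset ℕ} :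
    IsBoundarySet (k + 1) j m N Z ↔
      (∃ S, IsPairSet (k + 1) j m S ∧ ∃ s ∈ Finset.Ico m N, Z = S ∪ (Finset.Ico m N).erase s) ∨
      (∃ S, IsPairSet k (j + 1) m S ∧ Z = insert j S ∪ Finset.Ico m N) ∨
      ∃ S, IsPairSet k j (m - 1) S ∧ Z = insert (m - 1) S ∪ Finset.Ico m N := by
  constructor
  · rintro (⟨S, hS, hcard, hgaps, s, hs, rfl⟩ | ⟨S, hS, hcard, hgaps, rfl⟩)
    · exact Or.inl ⟨S, ⟨hS, hcard, hgaps⟩, s, hs, rfl⟩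
    · rcases hgaps with hg | hg
      · have hjS : j ∈ S := by
          by_contra hjS
          have := hg j (Finset.mem_Ico.2 ⟨le_rfl, by omega⟩) hjS
          rw [above_eq_card, Nat.even_iff] at this
          · omega
          · intro z hz
            have h1 := Finset.mem_Ico.1 (hS hz)
            have h2 : z ≠ j := fun h => hjS (h ▸ hz)
            omega
        refine Or.inr (Or.inl ⟨S.erase j, ⟨fun z hz => ?_, ?_, fun i hi hiS => ?_⟩, ?_⟩)
        · rw [Finset.mem_erase] at hz
          have h1 := Finset.mem_Ico.1 (hS hz.2)
          rw [Finset.mem_Ico]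
          omega
        · rw [Finset.card_erase_of_mem hjS]
          omega
        · rw [Finset.mem_Ico] at hi
          have := hg i (Finset.mem_Ico.2 ⟨by omega, hi.2⟩) fun h =>
            hiS (Finset.mem_erase.2 ⟨by omega, h⟩)
          rwa [← Finset.insert_erase hjS, above_insert_of_le (by omega)] at this
        · rw [Finset.insert_erase hjS]
      · have hmS : m - 1 ∈ S := by
          by_contra hmS
          have := hg (m - 1) (Finset.mem_Ico.2 ⟨by omega, by omega⟩) hmS
          rw [above_eq_zero, Nat.odd_iff] at this
          · omega
          · intro z hz
            have h1 := Finset.mem_Ico.1 (hS hz)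
            omega
        refine Or.inr (Or.inr ⟨S.erase (m - 1), ⟨fun z hz => ?_, ?_, fun i hi hiS => ?_⟩, ?_⟩)
        · rw [Finset.mem_erase] at hz
          have h1 := Finset.mem_Ico.1 (hS hz.2)
          rw [Finset.mem_Ico]
          omega
        · rw [Finset.card_erase_of_mem hmS]
          omega
        · rw [Finset.mem_Ico] at hi
          have := hg i (Finset.mem_Ico.2 ⟨by omega, by omega⟩) fun h =>
            hiS (Finset.mem_erase.2 ⟨by omega, h⟩)
          rw [← Finset.insert_erase hmS, above_insert_of_lt (by simp) (by omega)] at this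
          rw [Nat.even_iff]
          rw [Nat.odd_iff] at this
          omega
        · rw [Finset.insert_erase hmS]
  · rintro (⟨S, hS, s, hs, rfl⟩ | ⟨S, hS, rfl⟩ | ⟨S, hS, rfl⟩)
    · exact Or.inl ⟨S, hS.1, hS.2.1, hS.2.2, s, hs, rfl⟩
    · refine Or.inr ⟨insert j S, fun i hi => ?_, ?_, Or.inl fun i hi hiS => ?_, rfl⟩
      · rw [Finset.mem_insert] at hi
        rw [Finset.mem_Ico]
        rcases hi with rfl | hi
        · omega
        · have := Finset.mem_Ico.1 (hS.1 hi)
          omega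
      · rw [Finset.card_insert_of_notMem (hS.notMem_of_lt (by omega)), hS.2.1]
        ring
      · rw [Finset.mem_insert, not_or] at hiS
        rw [Finset.mem_Ico] at hi
        rw [above_insert_of_le hi.1]
        exact hS.2.2 i (Finset.mem_Ico.2 ⟨by omega, hi.2⟩) hiS.2
    · refine Or.inr ⟨insert (m - 1) S, fun i hi => ?_, ?_, Or.inr fun i hi hiS => ?_, rfl⟩
      · rw [Finset.mem_insert] at hi
        rw [Finset.mem_Ico]
        rcases hi with rfl | hi
        · omega
        · have := Finset.mem_Ico.1 (hS.1 hi)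
          omega
      · rw [Finset.card_insert_of_notMem (hS.notMem_of_le le_rfl), hS.2.1]
        ring
      · rw [Finset.mem_insert, not_or] at hiS
        rw [Finset.mem_Ico] at hi
        rw [above_insert_of_lt (hS.notMem_of_le le_rfl) (by omega)]
        exact (hS.2.2 i (Finset.mem_Ico.2 ⟨hi.1, by omega⟩) hiS.2).add_one

/-- The facets that become visible when the vertex `j` is pushed. -/
theorem isBoundarySet_visible_iff {k j m N : ℕ} (hj : j + 1 + 2 * (k + 1) ≤ m)
    {Z : Finset ℕ} :
    (IsBoundarySet (k + 1) (j + 1) m N Z ∧ ¬ IsBoundarySet (k + 1) j m N Z) ↔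
      ∃ S, IsPairSet k (j + 2) m S ∧ Z = insert (j + 1) S ∪ Finset.Ico m N := by
  constructor
  · rintro ⟨h1, h2⟩
    rw [isBoundarySet_iff (by omega)] at h1 h2
    rcases h1 with ⟨S, hS, s, hs, rfl⟩ | h1 | ⟨S, hS, rfl⟩
    · exact absurd (Or.inl ⟨S, hS.succ_left, s, hs, rfl⟩) h2
    · exact h1
    · exact absurd (Or.inr (Or.inr ⟨S, hS.succ_left, rfl⟩)) h2
  · rintro ⟨S, hS, rfl⟩
    refine ⟨(isBoundarySet_iff hj).2 (Or.inr (Or.inl ⟨S, hS, rfl⟩)), ?_⟩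
    have hjS : j ∉ insert (j + 1) S := by
      rw [Finset.mem_insert, not_or]
      exact ⟨by omega, hS.notMem_of_lt (by omega)⟩
    have hsub : insert (j + 1) S ⊆ Finset.Ico j m := fun i hi => by
      rw [Finset.mem_insert] at hi
      rw [Finset.mem_Ico]
      rcases hi with rfl | hi
      · omega
      · have := Finset.mem_Ico.1 (hS.1 hi)
        omega
    have hcard : (insert (j + 1) S).card = 2 * k + 1 := by
      rw [Finset.card_insert_of_notMem (hS.notMem_of_lt (by omega)), hS.2.1]
    rintro (⟨S', hS', -, -, s, hs, heq⟩ | ⟨S', hS', hcard', hgaps, heq⟩)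
    · have h1 : s ∈ S' ∪ (Finset.Ico m N).erase s := heq ▸ Finset.mem_union_right _ hs
      rw [Finset.mem_union] at h1
      rcases h1 with h1 | h1
      · have h2 := Finset.mem_Ico.1 (hS' h1)
        have h3 := Finset.mem_Ico.1 hs
        omega
      · simp at h1
    · have hSS' : S' = insert (j + 1) S := by
        have hinter : ∀ U ⊆ Finset.Ico j m, (U ∪ Finset.Ico m N) ∩ Finset.Ico j m = U :=
          fun U hU => by
            rw [Finset.union_inter_distrib_right, Finset.inter_eq_left.2 hU,
              Finset.disjoint_iff_inter_eq_empty.1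
                (disjoint_of_subset_Ico (subset_refl (Finset.Ico j m)) subset_rfl).symm,
              Finset.union_empty]
        rw [← hinter S' hS', ← heq, hinter _ hsub]
      subst hSS'
      rcases hgaps with hg | hg
      · have := hg j (Finset.mem_Ico.2 ⟨le_rfl, by omega⟩) hjS
        rw [above_eq_card, hcard, Nat.even_iff] at this
        · omega
        · intro z hz
          rw [Finset.mem_insert] at hz
          rcases hz with rfl | hz
          · omega
          · have := Finset.mem_Ico.1 (hS.1 hz)
            omega
      · obtain ⟨i, hi, hiS⟩ : ∃ i ∈ Finset.Ico (j + 1) m, i ∉ insert (j + 1) S := by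
          by_contra! hall
          have := Finset.card_le_card hall
          rw [Nat.card_Ico, hcard] at this
          omega
        rw [Finset.mem_Ico] at hi
        have h1 := hg i (Finset.mem_Ico.2 ⟨by omega, hi.2⟩) hiS
        rw [Finset.mem_insert, not_or] at hiS
        rw [above_insert_of_le hi.1, Nat.odd_iff] at h1
        have h2 := hS.2.2 i (Finset.mem_Ico.2 ⟨by omega, hi.2⟩) hiS.2
        rw [Nat.even_iff] at h2
        omega

end LexDiamond

namespace LexDiamond

open Polynomial

/-! ### Computing `h`-polynomials -/

section HSum

variable {ι : Type*}

theorem hSum_succ {X : Finset (Finset ι)} {n : ℕ} (h : ∀ S ∈ X, S.card ≤ n) :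
    hSum X (n + 1) = (1 - Polynomial.X) * hSum X n := by
  rw [hSum, hSum, Finset.mul_sum]
  refine Finset.sum_congr rfl fun S hS => ?_
  rw [Nat.succ_sub (h S hS), pow_succ]
  ring

theorem hSum_powerset (U : Finset ι) : hSum U.powerset U.card = 1 := by
  rw [hSum, Finset.sum_pow_mul_eq_add_pow]
  simp

variable [DecidableEq ι]

theorem hSum_union {X Y : Finset (Finset ι)} (h : Disjoint X Y) (n : ℕ) :
    hSum (X ∪ Y) n = hSum X n + hSum Y n :=
  Finset.sum_union h

theorem hSum_image_insert {X : Finset (Finset ι)} {v : ι} (h : ∀ S ∈ X, v ∉ S) (n : ℕ) :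
    hSum (X.image (insert v)) (n + 1) = Polynomial.X * hSum X n := by
  have hinj : Set.InjOn (insert v) (X : Set (Finset ι)) := fun S hS S' hS' heq => by
    rw [← Finset.erase_insert (h S hS), heq, Finset.erase_insert (h S' hS')]
  rw [hSum, hSum, Finset.sum_image hinj, Finset.mul_sum]
  refine Finset.sum_congr rfl fun S hS => ?_
  rw [Finset.card_insert_of_notMem (h S hS), Nat.add_sub_add_right, pow_succ]
  ring

/-- The cone over the family `X` with apex `v`. -/
def cone (v : ι) (X : Finset (Finset ι)) : Finset (Finset ι) := X ∪ X.image (insert v)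

theorem mem_cone {v : ι} {X : Finset (Finset ι)} (h : ∀ S ∈ X, v ∉ S) {A : Finset ι} :
    A ∈ cone v X ↔ A.erase v ∈ X := by
  rw [cone, Finset.mem_union, Finset.mem_image]
  constructor
  · rintro (hA | ⟨B, hB, rfl⟩)
    · rwa [Finset.erase_eq_of_notMem (h A hA)]
    · rwa [Finset.erase_insert (h B hB)]
  · intro hA
    by_cases hv : v ∈ A
    · exact Or.inr ⟨_, hA, Finset.insert_erase hv⟩
    · rw [Finset.erase_eq_of_notMem hv] at hA
      exact Or.inl hA

/-- Coning does not change the `h`-polynomial. -/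
theorem hSum_cone {v : ι} {X : Finset (Finset ι)} {n : ℕ} (h : ∀ S ∈ X, v ∉ S)
    (hn : ∀ S ∈ X, S.card ≤ n) : hSum (cone v X) (n + 1) = hSum X n := by
  have hdisj : Disjoint X (X.image (insert v)) := by
    rw [Finset.disjoint_left]
    intro S hS hS'
    obtain ⟨B, -, rfl⟩ := Finset.mem_image.1 hS'
    exact h _ hS (Finset.mem_insert_self _ _)
  rw [cone, hSum_union hdisj, hSum_succ hn, hSum_image_insert h]
  ring

/-- The join of the families `X` and `Y` of subsets of the disjoint sets `V` and `W`. -/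
def join (V W : Finset ι) (X Y : Finset (Finset ι)) : Finset (Finset ι) :=
  (V ∪ W).powerset.filter fun A => A ∩ V ∈ X ∧ A ∩ W ∈ Y

theorem mem_join {V W : Finset ι} {X Y : Finset (Finset ι)} {A : Finset ι} :
    A ∈ join V W X Y ↔ A ⊆ V ∪ W ∧ A ∩ V ∈ X ∧ A ∩ W ∈ Y := by
  rw [join, Finset.mem_filter, Finset.mem_powerset]

/-- The `h`-polynomial is multiplicative under joins. -/
theorem hSum_join {V W : Finset ι} {X Y : Finset (Finset ι)} {n p : ℕ} (hVW : Disjoint V W)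
    (hX : X ⊆ V.powerset) (hY : Y ⊆ W.powerset) (hn : ∀ S ∈ X, S.card ≤ n)
    (hp : ∀ S ∈ Y, S.card ≤ p) : hSum (join V W X Y) (n + p) = hSum X n * hSum Y p := by
  rw [hSum, hSum, hSum, Finset.sum_mul_sum, ← Finset.sum_product']
  have hV : ∀ B ∈ X, ∀ C ∈ Y, (B ∪ C) ∩ V = B := fun B hB C hC => by
    have hB := Finset.mem_powerset.1 (hX hB)
    have hC := Finset.mem_powerset.1 (hY hC)
    rw [Finset.union_inter_distrib_right, Finset.inter_eq_left.2 hB,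
      Finset.disjoint_iff_inter_eq_empty.1 (hVW.symm.mono_left hC), Finset.union_empty]
  have hW : ∀ B ∈ X, ∀ C ∈ Y, (B ∪ C) ∩ W = C := fun B hB C hC => by
    have hB := Finset.mem_powerset.1 (hX hB)
    have hC := Finset.mem_powerset.1 (hY hC)
    rw [Finset.union_inter_distrib_right, Finset.inter_eq_left.2 hC,
      Finset.disjoint_iff_inter_eq_empty.1 (hVW.mono_left hB), Finset.empty_union]
  have hsplit : ∀ A, A ⊆ V ∪ W → A ∩ V ∪ A ∩ W = A := fun A hA => by
    rw [← Finset.inter_union_distrib_left, Finset.inter_eq_left.2 hA]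
  refine Finset.sum_nbij' (fun A => (A ∩ V, A ∩ W)) (fun q => q.1 ∪ q.2) (fun A hA => ?_)
    (fun q hq => ?_) (fun A hA => ?_) (fun q hq => ?_) fun A hA => ?_
  · exact Finset.mem_product.2 (mem_join.1 hA).2
  · rw [Finset.mem_product] at hq
    rw [mem_join, hV _ hq.1 _ hq.2, hW _ hq.1 _ hq.2]
    exact ⟨Finset.union_subset_union (Finset.mem_powerset.1 (hX hq.1))
      (Finset.mem_powerset.1 (hY hq.2)), hq⟩
  · exact hsplit A (mem_join.1 hA).1
  · rw [Finset.mem_product] at hq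
    exact Prod.ext (hV _ hq.1 _ hq.2) (hW _ hq.1 _ hq.2)
  · obtain ⟨hsub, hAX, hAY⟩ := mem_join.1 hA
    have hcard : A.card = (A ∩ V).card + (A ∩ W).card := by
      rw [← Finset.card_union_of_disjoint (hVW.mono Finset.inter_subset_right
        Finset.inter_subset_right), hsplit A hsub]
    have h1 := hn _ hAX
    have h2 := hp _ hAY
    rw [show n + p - A.card = (n - (A ∩ V).card) + (p - (A ∩ W).card) by omega, hcard, pow_add,
      pow_add]
    ring

theorem hSum_ssubsets (U : Finset ι) : hSum U.ssubsets U.card = 1 - Polynomial.X ^ U.card := by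
  have h := hSum_powerset U
  have hdisj : Disjoint U.ssubsets {U} := by simp
  have hunion : U.powerset = U.ssubsets ∪ {U} := by
    ext A
    simp only [Finset.mem_powerset, Finset.mem_union, Finset.mem_ssubsets, Finset.mem_singleton]
    exact subset_iff_ssubset_or_eq
  rw [hunion, hSum_union hdisj] at h
  rw [← h]
  simp [hSum]

/-- A family containing all small sets has the same low `h`-numbers as the full simplex on the same
vertices. -/
theorem X_pow_dvd_hSum_sub_one {V : Finset ι} {Y : Finset (Finset ι)} {n s : ℕ}
    (hYV : Y ⊆ V.powerset) (hs : ∀ A ⊆ V, A.card < s → A ∈ Y) (hn : ∀ A ∈ Y, A.card ≤ n)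
    (hnV : n ≤ V.card) :
    (Polynomial.X : ℤ[X]) ^ s ∣ (1 - Polynomial.X) ^ (V.card - n) * hSum Y n - 1 := by
  have h1 : (1 - Polynomial.X) ^ (V.card - n) * hSum Y n = hSum Y V.card := by
    rw [hSum, hSum, Finset.mul_sum]
    refine Finset.sum_congr rfl fun S hS => ?_
    have := hn S hS
    rw [show V.card - S.card = (V.card - n) + (n - S.card) by omega, pow_add]
    ring
  have h2 : hSum Y V.card - 1 = -hSum (V.powerset \ Y) V.card := by
    rw [← hSum_powerset V, ← Finset.union_sdiff_of_subset hYV,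
      hSum_union Finset.disjoint_sdiff, Finset.union_sdiff_of_subset hYV]
    ring
  rw [h1, h2, dvd_neg]
  refine Finset.dvd_sum fun S hS => ?_
  rw [Finset.mem_sdiff, Finset.mem_powerset] at hS
  have : s ≤ S.card := by
    by_contra! hlt
    exact hS.2 (hs S hS.1 hlt)
  exact (pow_dvd_pow _ this).mul_right _

end HSum

/-- The polynomial `∑ ((q multichoose i)) t ^ i`, over `i ≤ k`. -/
noncomputable def multichoosePoly (k q : ℕ) : ℤ[X] :=
  ∑ i ∈ Finset.range (k + 1), C (q.multichoose i : ℤ) * Polynomial.X ^ i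

theorem multichoosePoly_zero_left (q : ℕ) : multichoosePoly 0 q = 1 := by
  simp [multichoosePoly]

theorem multichoosePoly_zero_right (k : ℕ) : multichoosePoly k 0 = 1 := by
  rw [multichoosePoly, Finset.sum_range_succ']
  simp

theorem multichoosePoly_succ (k q : ℕ) :
    multichoosePoly (k + 1) q =
      multichoosePoly k q + C (q.multichoose (k + 1) : ℤ) * Polynomial.X ^ (k + 1) :=
  Finset.sum_range_succ _ _

/-- Pascal's rule for multiset coefficients. -/
theorem multichoosePoly_succ_succ (k q : ℕ) :
    multichoosePoly (k + 1) (q + 1) =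
      multichoosePoly (k + 1) q + Polynomial.X * multichoosePoly k (q + 1) := by
  rw [multichoosePoly, multichoosePoly, multichoosePoly, Finset.sum_range_succ',
    Finset.sum_range_succ' _ (k + 1), Finset.mul_sum]
  have h : ∀ i ∈ Finset.range (k + 1),
      C ((q + 1).multichoose (i + 1) : ℤ) * Polynomial.X ^ (i + 1) =
        C (q.multichoose (i + 1) : ℤ) * Polynomial.X ^ (i + 1) +
          Polynomial.X * (C ((q + 1).multichoose i : ℤ) * Polynomial.X ^ i) := fun i _ => by
    rw [Nat.multichoose_succ_succ]
    push_cast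
    rw [C_add]
    ring
  rw [Finset.sum_congr rfl h, Finset.sum_add_distrib]
  simp only [Nat.multichoose_zero_right]
  ring

theorem coeff_multichoosePoly (k q i : ℕ) :
    (multichoosePoly k q).coeff i = if i ≤ k then (q.multichoose i : ℤ) else 0 := by
  rw [multichoosePoly, finsetSum_coeff]
  simp [coeff_X_pow]

/-! ### The complexes of faces -/

section Complexes

open Classical in
/-- The simplicial complex on the vertex set `V` generated by the sets with the property `p`. -/
noncomputable def generatedComplex (V : Finset ℕ) (p : Finset ℕ → Prop) : Finset (Finset ℕ) :=
  V.powerset.filter fun A => ∃ Z, p Z ∧ A ⊆ Z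

theorem mem_generatedComplex {V : Finset ℕ} {p : Finset ℕ → Prop} (hp : ∀ Z, p Z → Z ⊆ V)
    {A : Finset ℕ} : A ∈ generatedComplex V p ↔ ∃ Z, p Z ∧ A ⊆ Z := by
  classical
  rw [generatedComplex, Finset.mem_filter, Finset.mem_powerset, and_iff_right_iff_imp]
  rintro ⟨Z, hZ, hA⟩
  exact hA.trans (hp Z hZ)

/-- The subsets of unions of `k` disjoint adjacent pairs in `[j, m)`. -/
noncomputable def pairFaces (k j m : ℕ) : Finset (Finset ℕ) :=
  generatedComplex (Finset.Ico j m) (IsPairSet k j m)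

theorem mem_pairFaces {k j m : ℕ} {A : Finset ℕ} : A ∈ pairFaces k j m ↔ InPairSet k j m A :=
  mem_generatedComplex fun _ hZ => hZ.1

theorem pairFaces_subset (k j m : ℕ) : pairFaces k j m ⊆ (Finset.Ico j m).powerset :=
  fun _ hA => Finset.mem_powerset.2 (mem_pairFaces.1 hA).subset

theorem card_le_of_mem_pairFaces {k j m : ℕ} {A : Finset ℕ} (hA : A ∈ pairFaces k j m) :
    A.card ≤ 2 * k :=
  (mem_pairFaces.1 hA).card_le

theorem notMem_of_mem_pairFaces {k j m : ℕ} {A : Finset ℕ} (hA : A ∈ pairFaces k j m) {i : ℕ}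
    (hi : i < j ∨ m ≤ i) : i ∉ A := fun h => by
  have := Finset.mem_Ico.1 ((mem_pairFaces.1 hA).subset h)
  omega

/-- The subsets of unions of pairs that contain the first element are obtained from smaller such
sets by adding the first element, and possibly the second. -/
theorem pairFaces_succ {k j m : ℕ} (hm : j + 1 + 2 * (k + 1) ≤ m) :
    pairFaces (k + 1) j m =
      pairFaces (k + 1) (j + 1) m ∪
        (cone (j + 1) (pairFaces k (j + 2) m)).image (insert j) := by
  have hcone : ∀ S ∈ pairFaces k (j + 2) m, j + 1 ∉ S := fun S hS =>
    notMem_of_mem_pairFaces hS (by omega)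
  ext A
  rw [Finset.mem_union, Finset.mem_image]
  constructor
  · intro hA
    rw [mem_pairFaces] at hA
    by_cases hj : j ∈ A
    · refine Or.inr ⟨A.erase j, ?_, Finset.insert_erase hj⟩
      rw [mem_cone hcone, mem_pairFaces]
      exact hA.of_mem hj
    · exact Or.inl (mem_pairFaces.2 ((inPairSet_succ_left_iff hj hm).1 hA))
  · rintro (hA | ⟨B, hB, rfl⟩)
    · exact mem_pairFaces.2 (mem_pairFaces.1 hA).succ_left
    · rw [mem_cone hcone, mem_pairFaces] at hB
      refine mem_pairFaces.2 ((hB.insert_pair (by omega)).mono fun i => ?_)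
      simp only [Finset.mem_insert, Finset.mem_erase]
      tauto

theorem hSum_pairFaces {k j m : ℕ} (hm : j + 2 * k ≤ m) :
    hSum (pairFaces k j m) (2 * k) = multichoosePoly k (m - j - 2 * k) := by
  induction hn : m - j using Nat.strong_induction_on generalizing k j with
  | _ n ih =>
    subst hn
    rcases hm.eq_or_lt with heq | hlt
    · have h1 : pairFaces k j m = (Finset.Ico j m).powerset := by
        refine Finset.Subset.antisymm (pairFaces_subset k j m) fun A hA => ?_
        exact mem_pairFaces.2 (inPairSet_full heq.symm (Finset.mem_powerset.1 hA))
      have h2 : 2 * k = (Finset.Ico j m).card := by rw [Nat.card_Ico]; omega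
      rw [h1, show m - j - 2 * k = 0 by omega, multichoosePoly_zero_right, h2, hSum_powerset]
    · rcases k with _ | k
      · have h1 : pairFaces 0 j m = {∅} := by
          ext A
          rw [mem_pairFaces, inPairSet_zero_iff, Finset.mem_singleton]
        rw [h1, multichoosePoly_zero_left]
        simp [hSum]
      · have hcone : ∀ S ∈ pairFaces k (j + 2) m, j + 1 ∉ S := fun S hS =>
          notMem_of_mem_pairFaces hS (by omega)
        have hj : ∀ S ∈ cone (j + 1) (pairFaces k (j + 2) m), j ∉ S := fun S hS hjS => by
          rw [mem_cone hcone] at hS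
          exact notMem_of_mem_pairFaces hS (i := j) (by omega)
            (Finset.mem_erase.2 ⟨by omega, hjS⟩)
        have hdisj : Disjoint (pairFaces (k + 1) (j + 1) m)
            ((cone (j + 1) (pairFaces k (j + 2) m)).image (insert j)) := by
          rw [Finset.disjoint_left]
          intro S hS hS'
          obtain ⟨B, -, rfl⟩ := Finset.mem_image.1 hS'
          exact notMem_of_mem_pairFaces hS (by omega) (Finset.mem_insert_self j B)
        rw [pairFaces_succ (by omega), hSum_union hdisj,
          ih (m - (j + 1)) (by omega) (by omega) rfl,
          show 2 * (k + 1) = 2 * k + 1 + 1 by ring, hSum_image_insert hj,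
          hSum_cone hcone fun S hS => card_le_of_mem_pairFaces hS,
          ih (m - (j + 2)) (by omega) (by omega) rfl,
          show m - j - (2 * k + 1 + 1) = (m - (j + 1) - (2 * k + 1 + 1)) + 1 by omega,
          multichoosePoly_succ_succ,
          show m - (j + 1) - (2 * k + 1 + 1) + 1 = m - (j + 2) - 2 * k by omega]

end Complexes

end LexDiamond

namespace LexDiamond

open Polynomial

/-! ### Boundary complexes, links and antistars -/

section JoinBoundary

variable {ι : Type*} [DecidableEq ι]

/-- The complex of all `A ∪ U` with `A ⊆ V` and `U ⊆ W`, where `A` is a member of `X` if `U ≠ W`,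
and a member of `L` if `U = W`. -/
def joinBoundary (V W : Finset ι) (X L : Finset (Finset ι)) : Finset (Finset ι) :=
  join V W X W.ssubsets ∪ join V W L {W}

theorem mem_joinBoundary {V W : Finset ι} {X L : Finset (Finset ι)} {A : Finset ι} :
    A ∈ joinBoundary V W X L ↔
      A ⊆ V ∪ W ∧ (W ⊆ A → A ∩ V ∈ L) ∧ (¬ W ⊆ A → A ∩ V ∈ X) := by
  rw [joinBoundary, Finset.mem_union, mem_join, mem_join, Finset.mem_ssubsets,
    Finset.mem_singleton, Finset.inter_eq_right]
  have h : A ∩ W ⊂ W ↔ ¬ W ⊆ A :=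
    ⟨fun h hs => h.ne (Finset.inter_eq_right.2 hs),
      fun h => Finset.inter_subset_right.ssubset_of_ne fun he => h (Finset.inter_eq_right.1 he)⟩
  rw [h]
  tauto

theorem hSum_joinBoundary {V W : Finset ι} {X L : Finset (Finset ι)} {n : ℕ}
    (hVW : Disjoint V W) (hX : X ⊆ V.powerset) (hL : L ⊆ V.powerset) (hn : ∀ S ∈ X, S.card ≤ n)
    (hn' : ∀ S ∈ L, S.card ≤ n) :
    hSum (joinBoundary V W X L) (n + W.card) =
      hSum X n * (1 - Polynomial.X ^ W.card) + hSum L n * Polynomial.X ^ W.card := by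
  have hdisj : Disjoint (join V W X W.ssubsets) (join V W L {W}) := by
    rw [Finset.disjoint_left]
    intro A hA hA'
    rw [mem_join] at hA hA'
    have h1 := Finset.mem_ssubsets.1 hA.2.2
    rw [Finset.mem_singleton.1 hA'.2.2] at h1
    exact h1.ne rfl
  have hW : hSum {W} W.card = (Polynomial.X : ℤ[X]) ^ W.card := by simp [hSum]
  rw [joinBoundary, hSum_union hdisj, hSum_join hVW hX
    (fun A hA => Finset.mem_powerset.2 (Finset.mem_ssubsets.1 hA).subset) hn
    (fun A hA => Finset.card_le_card (Finset.mem_ssubsets.1 hA).subset),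
    hSum_join hVW hL (by simp) hn' (by simp), hSum_ssubsets, hW]

end JoinBoundary

section Boundary

theorem IsBoundarySet.subset {k j m N : ℕ} {Z : Finset ℕ} (h : IsBoundarySet k j m N Z)
    (hj : j ≤ m) (hmN : m ≤ N) : Z ⊆ Finset.Ico j N := by
  rw [← Finset.Ico_union_Ico_eq_Ico hj hmN]
  rcases h with ⟨S, hS, -, -, s, -, rfl⟩ | ⟨S, hS, -, -, rfl⟩
  · exact Finset.union_subset_union hS (Finset.erase_subset _ _)
  · exact Finset.union_subset_union hS subset_rfl

theorem subset_union_of_inter_subset {j m N : ℕ} {A S U : Finset ℕ}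
    (hA : A ⊆ Finset.Ico j m ∪ Finset.Ico m N) (hS : A ∩ Finset.Ico j m ⊆ S)
    (hU : A ∩ Finset.Ico m N ⊆ U) : A ⊆ S ∪ U := by
  rw [← Finset.inter_eq_left.2 hA, Finset.inter_union_distrib_left]
  exact Finset.union_subset_union hS hU

/-- The link of the last vertex of the cyclic polytope on the vertices `j, …, m`: the complex
generated by the traces on `[j, m)` of the boundary sets that contain all of `[m, N)`. -/
noncomputable def linkFaces (k j m : ℕ) : Finset (Finset ℕ) :=
  generatedComplex (Finset.Ico j m) fun Z =>
    (∃ S, IsPairSet k (j + 1) m S ∧ Z = insert j S) ∨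
      ∃ S, IsPairSet k j (m - 1) S ∧ Z = insert (m - 1) S

theorem mem_linkFaces {k j m : ℕ} (hj : j < m) {A : Finset ℕ} :
    A ∈ linkFaces k j m ↔ (∃ S, IsPairSet k (j + 1) m S ∧ A ⊆ insert j S) ∨
      ∃ S, IsPairSet k j (m - 1) S ∧ A ⊆ insert (m - 1) S := by
  rw [linkFaces, mem_generatedComplex]
  · constructor
    · rintro ⟨Z, ⟨S, hS, rfl⟩ | ⟨S, hS, rfl⟩, hA⟩
      · exact Or.inl ⟨S, hS, hA⟩
      · exact Or.inr ⟨S, hS, hA⟩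
    · rintro (⟨S, hS, hA⟩ | ⟨S, hS, hA⟩)
      · exact ⟨_, Or.inl ⟨S, hS, rfl⟩, hA⟩
      · exact ⟨_, Or.inr ⟨S, hS, rfl⟩, hA⟩
  · rintro Z (⟨S, hS, rfl⟩ | ⟨S, hS, rfl⟩) i hi
    · rw [Finset.mem_insert] at hi
      rw [Finset.mem_Ico]
      rcases hi with rfl | hi
      · omega
      · have := Finset.mem_Ico.1 (hS.1 hi)
        omega
    · rw [Finset.mem_insert] at hi
      rw [Finset.mem_Ico]
      rcases hi with rfl | hi
      · omega
      · have := Finset.mem_Ico.1 (hS.1 hi)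
        omega

theorem linkFaces_subset (k j m : ℕ) : linkFaces k j m ⊆ (Finset.Ico j m).powerset := by
  classical
  exact Finset.filter_subset _ _

theorem card_le_of_mem_linkFaces {k j m : ℕ} (hj : j < m) {A : Finset ℕ}
    (hA : A ∈ linkFaces k j m) : A.card ≤ 2 * (k + 1) := by
  rcases (mem_linkFaces hj).1 hA with ⟨S, hS, hA⟩ | ⟨S, hS, hA⟩
  · have h1 := Finset.card_le_card hA
    have h2 := Finset.card_insert_le j S
    have h3 := hS.2.1
    omega
  · have h1 := Finset.card_le_card hA
    have h2 := Finset.card_insert_le (m - 1) S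
    have h3 := hS.2.1
    omega

/-- The sets `{m - 1} ∪ S`, with `S` a union of `k` pairs, are contained in unions of `k + 1`
pairs. -/
theorem IsPairSet.insert_pred {k j m : ℕ} {S : Finset ℕ} (hS : IsPairSet k j (m - 1) S)
    (hm : j + 2 * (k + 1) ≤ m) : InPairSet (k + 1) j m (insert (m - 1) S) := by
  have h := hS.insert_last (by omega)
  rwa [show m - 1 + 1 = m by omega] at h

/-- The face complex of the polytope spanned by the vertices `j, …, N - 1`. -/
noncomputable def boundaryFaces (k j m N : ℕ) : Finset (Finset ℕ) :=
  generatedComplex (Finset.Ico j N) (IsBoundarySet k j m N)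

theorem mem_boundaryFaces {k j m N : ℕ} (hj : j ≤ m) (hmN : m ≤ N) {A : Finset ℕ} :
    A ∈ boundaryFaces k j m N ↔ ∃ Z, IsBoundarySet k j m N Z ∧ A ⊆ Z :=
  mem_generatedComplex fun _ hZ => hZ.subset hj hmN

theorem boundaryFaces_eq {k j m N : ℕ} (hj : j + 2 * (k + 1) ≤ m) (hmN : m < N) :
    boundaryFaces (k + 1) j m N = joinBoundary (Finset.Ico j m) (Finset.Ico m N)
      (pairFaces (k + 1) j m) (linkFaces k j m) := by
  ext A
  rw [mem_boundaryFaces (by omega) hmN.le, mem_joinBoundary]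
  constructor
  · rintro ⟨Z, hZ, hA⟩
    refine ⟨?_, fun hT => ?_, fun hT => ?_⟩
    · rw [Finset.Ico_union_Ico_eq_Ico (by omega) hmN.le]
      exact hA.trans (hZ.subset (by omega) hmN.le)
    · rw [mem_linkFaces (by omega)]
      rcases (isBoundarySet_iff hj).1 hZ with ⟨S, hS, s, hs, rfl⟩ | ⟨S, hS, rfl⟩ | ⟨S, hS, rfl⟩
      · exfalso
        have h1 := hA (hT hs)
        rw [Finset.mem_union] at h1
        rcases h1 with h1 | h1
        · exact hS.notMem_of_le (Finset.mem_Ico.1 hs).1 h1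
        · simp at h1
      · left
        refine ⟨S, hS, fun i hi => ?_⟩
        rw [Finset.mem_inter] at hi
        refine (Finset.mem_union.1 (hA hi.1)).resolve_right fun h => ?_
        have h1 := Finset.mem_Ico.1 hi.2
        have h2 := Finset.mem_Ico.1 h
        omega
      · right
        refine ⟨S, hS, fun i hi => ?_⟩
        rw [Finset.mem_inter] at hi
        refine (Finset.mem_union.1 (hA hi.1)).resolve_right fun h => ?_
        have h1 := Finset.mem_Ico.1 hi.2
        have h2 := Finset.mem_Ico.1 h
        omega
    · have hsub : ∀ S U, U ⊆ Finset.Ico m N → A ⊆ S ∪ U → A ∩ Finset.Ico j m ⊆ S :=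
        fun S U hU hA i hi => by
          rw [Finset.mem_inter] at hi
          refine (Finset.mem_union.1 (hA hi.1)).resolve_right fun h => ?_
          have h1 := Finset.mem_Ico.1 hi.2
          have h2 := Finset.mem_Ico.1 (hU h)
          omega
      rw [mem_pairFaces]
      rcases (isBoundarySet_iff hj).1 hZ with ⟨S, hS, s, hs, rfl⟩ | ⟨S, hS, rfl⟩ | ⟨S, hS, rfl⟩
      · exact ⟨S, hS, hsub _ _ (Finset.erase_subset _ _) hA⟩
      · exact (InPairSet.insert_first ⟨S, hS, subset_rfl⟩ hj).mono (hsub _ _ subset_rfl hA)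
      · exact (hS.insert_pred hj).mono (hsub _ _ subset_rfl hA)
  · rintro ⟨hA, hL, hX⟩
    by_cases hT : Finset.Ico m N ⊆ A
    · rcases (mem_linkFaces (by omega)).1 (hL hT) with ⟨S, hS, hAS⟩ | ⟨S, hS, hAS⟩
      · exact ⟨_, (isBoundarySet_iff hj).2 (Or.inr (Or.inl ⟨S, hS, rfl⟩)),
          subset_union_of_inter_subset hA hAS Finset.inter_subset_right⟩
      · exact ⟨_, (isBoundarySet_iff hj).2 (Or.inr (Or.inr ⟨S, hS, rfl⟩)),
          subset_union_of_inter_subset hA hAS Finset.inter_subset_right⟩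
    · obtain ⟨S, hS, hAS⟩ := mem_pairFaces.1 (hX hT)
      obtain ⟨s, hs, hsA⟩ := Finset.not_subset.1 hT
      refine ⟨_, (isBoundarySet_iff hj).2 (Or.inl ⟨S, hS, s, hs, rfl⟩),
        subset_union_of_inter_subset hA hAS fun i hi => ?_⟩
      rw [Finset.mem_inter] at hi
      exact Finset.mem_erase.2 ⟨fun h => hsA (h ▸ hi.1), hi.2⟩

theorem disjoint_Ico (j m N : ℕ) : Disjoint (Finset.Ico j m) (Finset.Ico m N) :=
  disjoint_of_subset_Ico subset_rfl subset_rfl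

theorem hSum_boundaryFaces {k j m N : ℕ} (hj : j + 2 * (k + 1) ≤ m) (hmN : m < N) :
    hSum (boundaryFaces (k + 1) j m N) (2 * (k + 1) + (N - m)) =
      multichoosePoly (k + 1) (m - j - 2 * (k + 1)) * (1 - Polynomial.X ^ (N - m)) +
        hSum (linkFaces k j m) (2 * (k + 1)) * Polynomial.X ^ (N - m) := by
  have h := hSum_joinBoundary (disjoint_Ico j m N) (pairFaces_subset (k + 1) j m)
    (linkFaces_subset k j m) (fun S hS => card_le_of_mem_pairFaces hS)
    (fun S hS => card_le_of_mem_linkFaces (by omega) hS)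
  rw [Nat.card_Ico] at h
  rw [boundaryFaces_eq hj hmN, h, hSum_pairFaces hj]

/-- By neighborliness, the low `h`-numbers of the link of the last vertex of the cyclic polytope
agree with those of its antistar. -/
theorem X_pow_dvd_hSum_linkFaces_sub {k m : ℕ} (hm : 2 * (k + 1) ≤ m) :
    (Polynomial.X : ℤ[X]) ^ (k + 1) ∣
      hSum (linkFaces k 0 m) (2 * (k + 1)) - multichoosePoly (k + 1) (m - 2 * (k + 1)) := by
  have hcard : (Finset.Ico 0 m).card = m := by simp
  have h1 := X_pow_dvd_hSum_sub_one (V := Finset.Ico 0 m) (Y := linkFaces k 0 m)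
    (n := 2 * (k + 1)) (s := k + 1) (linkFaces_subset k 0 m) (fun A hA hlt => ?_)
    (fun A hA => card_le_of_mem_linkFaces (by omega) hA) (by rw [hcard]; exact hm)
  · have h2 := X_pow_dvd_hSum_sub_one (V := Finset.Ico 0 m) (Y := pairFaces (k + 1) 0 m)
      (n := 2 * (k + 1)) (s := k + 1) (pairFaces_subset (k + 1) 0 m)
      (fun A hA hlt => mem_pairFaces.2 (inPairSet_of_card_le hA hlt.le (by omega)))
      (fun A hA => card_le_of_mem_pairFaces hA) (by rw [hcard]; exact hm)
    rw [hSum_pairFaces (by omega), Nat.sub_zero] at h2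
    rw [hcard] at h1 h2
    have h3 := dvd_sub h1 h2
    have h4 : (1 - Polynomial.X) ^ (m - 2 * (k + 1)) * hSum (linkFaces k 0 m) (2 * (k + 1)) - 1 -
        ((1 - Polynomial.X) ^ (m - 2 * (k + 1)) *
          multichoosePoly (k + 1) (m - 2 * (k + 1)) - 1) =
        (1 - Polynomial.X) ^ (m - 2 * (k + 1)) * (hSum (linkFaces k 0 m) (2 * (k + 1)) -
          multichoosePoly (k + 1) (m - 2 * (k + 1))) := by ring
    rw [h4] at h3
    have hcop : IsCoprime (Polynomial.X : ℤ[X]) (1 - Polynomial.X) := ⟨1, 1, by ring⟩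
    exact (hcop.pow (m := k + 1) (n := m - 2 * (k + 1))).dvd_of_dvd_mul_left h3
  · rw [mem_linkFaces (by omega)]
    left
    obtain ⟨S, hS, hsub⟩ : InPairSet k 1 m (A.erase 0) := by
      by_cases h0 : 0 ∈ A
      · refine inPairSet_of_card_le (fun i hi => ?_) ?_ (by omega)
        · rw [Finset.mem_erase] at hi
          have := Finset.mem_Ico.1 (hA hi.2)
          rw [Finset.mem_Ico]
          omega
        · rw [Finset.card_erase_of_mem h0]
          omega
      · rw [Finset.erase_eq_of_notMem h0]
        refine inPairSet_of_card_le (fun i hi => ?_) (by omega) (by omega)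
        have h1 := Finset.mem_Ico.1 (hA hi)
        have h2 : i ≠ 0 := fun h => h0 (h ▸ hi)
        rw [Finset.mem_Ico]
        omega
    refine ⟨S, hS, fun i hi => ?_⟩
    rw [Finset.mem_insert]
    by_cases h0 : i = 0
    · exact Or.inl h0
    · exact Or.inr (hsub (Finset.mem_erase.2 ⟨h0, hi⟩))

/-- The complex of those faces of the polytope spanned by the vertices `j, …, N - 1` that lie in
facets avoiding the vertex `j`. -/
noncomputable def antistarFaces (k j m N : ℕ) : Finset (Finset ℕ) :=
  generatedComplex (Finset.Ico (j + 1) N) fun Z => IsBoundarySet k j m N Z ∧ j ∉ Z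

theorem mem_antistarFaces {k j m N : ℕ} (hj : j ≤ m) (hmN : m ≤ N) {A : Finset ℕ} :
    A ∈ antistarFaces k j m N ↔ ∃ Z, (IsBoundarySet k j m N Z ∧ j ∉ Z) ∧ A ⊆ Z := by
  refine mem_generatedComplex fun Z hZ i hi => ?_
  have h1 := Finset.mem_Ico.1 (hZ.1.subset hj hmN hi)
  have h2 : i ≠ j := fun h => hZ.2 (h ▸ hi)
  rw [Finset.mem_Ico]
  omega

theorem antistarFaces_eq {k j m N : ℕ} (hj : j + 1 + 2 * (k + 1) ≤ m) (hmN : m < N) :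
    antistarFaces (k + 1) j m N = joinBoundary (Finset.Ico (j + 1) m) (Finset.Ico m N)
      (pairFaces (k + 1) (j + 1) m) (cone (m - 1) (pairFaces k (j + 1) (m - 1))) := by
  have hcone : ∀ S ∈ pairFaces k (j + 1) (m - 1), m - 1 ∉ S := fun S hS =>
    notMem_of_mem_pairFaces hS (by omega)
  have hsub : ∀ A S U, U ⊆ Finset.Ico m N → A ⊆ S ∪ U → A ∩ Finset.Ico (j + 1) m ⊆ S :=
    fun A S U hU hA i hi => by
      rw [Finset.mem_inter] at hi
      refine (Finset.mem_union.1 (hA hi.1)).resolve_right fun h => ?_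
      have h1 := Finset.mem_Ico.1 hi.2
      have h2 := Finset.mem_Ico.1 (hU h)
      omega
  ext A
  rw [mem_antistarFaces (by omega) hmN.le, mem_joinBoundary]
  constructor
  · rintro ⟨Z, ⟨hZ, hjZ⟩, hA⟩
    have hA' : A ⊆ Finset.Ico (j + 1) m ∪ Finset.Ico m N := fun i hi => by
      have h1 := Finset.mem_Ico.1 (hZ.subset (by omega) hmN.le (hA hi))
      have h2 : i ≠ j := fun h => hjZ (h ▸ hA hi)
      rw [Finset.Ico_union_Ico_eq_Ico (by omega) hmN.le, Finset.mem_Ico]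
      omega
    rcases (isBoundarySet_iff (by omega)).1 hZ with
      ⟨S, hS, s, hs, rfl⟩ | ⟨S, hS, rfl⟩ | ⟨S, hS, rfl⟩
    · refine ⟨hA', fun hT => ?_, fun _ => ?_⟩
      · exfalso
        have h1 := hA (hT hs)
        rw [Finset.mem_union] at h1
        rcases h1 with h1 | h1
        · exact hS.notMem_of_le (Finset.mem_Ico.1 hs).1 h1
        · simp at h1
      · exact mem_pairFaces.2 ⟨S, hS.of_succ_left fun h => hjZ (Finset.mem_union_left _ h),
          hsub _ _ _ (Finset.erase_subset _ _) hA⟩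
    · exact absurd (Finset.mem_union_left _ (Finset.mem_insert_self j S)) hjZ
    · have hS' : IsPairSet k (j + 1) (m - 1) S := hS.of_succ_left fun h =>
        hjZ (Finset.mem_union_left _ (Finset.mem_insert_of_mem h))
      have hAS := hsub _ _ _ subset_rfl hA
      refine ⟨hA', fun _ => ?_, fun _ => ?_⟩
      · rw [mem_cone hcone, mem_pairFaces]
        refine ⟨S, hS', fun i hi => ?_⟩
        rw [Finset.mem_erase] at hi
        exact (Finset.mem_insert.1 (hAS hi.2)).resolve_left hi.1
      · exact mem_pairFaces.2 ((hS'.insert_pred hj).mono hAS)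
  · rintro ⟨hA, hL, hX⟩
    by_cases hT : Finset.Ico m N ⊆ A
    · have h1 := hL hT
      rw [mem_cone hcone, mem_pairFaces] at h1
      obtain ⟨S, hS, hAS⟩ := h1
      refine ⟨insert (m - 1) S ∪ Finset.Ico m N, ⟨(isBoundarySet_iff (by omega)).2
        (Or.inr (Or.inr ⟨S, hS.succ_left, rfl⟩)), fun h => ?_⟩,
        subset_union_of_inter_subset hA (fun i hi => ?_) Finset.inter_subset_right⟩
      · rw [Finset.mem_union, Finset.mem_insert, Finset.mem_Ico] at h
        have := hS.notMem_of_lt (i := j) (by omega)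
        rcases h with (h | h) | h
        · omega
        · exact this h
        · omega
      · rw [Finset.mem_insert]
        by_cases him : i = m - 1
        · exact Or.inl him
        · exact Or.inr (hAS (Finset.mem_erase.2 ⟨him, hi⟩))
    · obtain ⟨S, hS, hAS⟩ := mem_pairFaces.1 (hX hT)
      obtain ⟨s, hs, hsA⟩ := Finset.not_subset.1 hT
      refine ⟨S ∪ (Finset.Ico m N).erase s, ⟨(isBoundarySet_iff (by omega)).2
        (Or.inl ⟨S, hS.succ_left, s, hs, rfl⟩), fun h => ?_⟩,
        subset_union_of_inter_subset hA hAS fun i hi => ?_⟩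
      · rw [Finset.mem_union, Finset.mem_erase, Finset.mem_Ico] at h
        have := hS.notMem_of_lt (i := j) (by omega)
        rcases h with h | h
        · exact this h
        · omega
      · rw [Finset.mem_inter] at hi
        exact Finset.mem_erase.2 ⟨fun h => hsA (h ▸ hi.1), hi.2⟩

theorem hSum_antistarFaces {k j m N : ℕ} (hj : j + 1 + 2 * (k + 1) ≤ m) (hmN : m < N) :
    hSum (antistarFaces (k + 1) j m N) (2 * (k + 1) + (N - m)) =
      multichoosePoly (k + 1) (m - j - 2 * (k + 1) - 1) -
        C ((m - j - 2 * (k + 1)).multichoose (k + 1) : ℤ) *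
          Polynomial.X ^ (k + 1 + (N - m)) := by
  have hcone : ∀ S ∈ pairFaces k (j + 1) (m - 1), m - 1 ∉ S := fun S hS =>
    notMem_of_mem_pairFaces hS (by omega)
  have hconecard : ∀ S ∈ cone (m - 1) (pairFaces k (j + 1) (m - 1)), S.card ≤ 2 * k + 1 :=
    fun S hS => by
      have h1 := card_le_of_mem_pairFaces ((mem_cone hcone).1 hS)
      have h2 := Finset.pred_card_le_card_erase (s := S) (a := m - 1)
      omega
  have hconesub : cone (m - 1) (pairFaces k (j + 1) (m - 1)) ⊆ (Finset.Ico (j + 1) m).powerset :=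
    fun S hS => by
      have h1 := Finset.mem_powerset.1 (pairFaces_subset _ _ _ ((mem_cone hcone).1 hS))
      rw [Finset.mem_powerset]
      intro i hi
      rw [Finset.mem_Ico]
      by_cases him : i = m - 1
      · omega
      · have := Finset.mem_Ico.1 (h1 (Finset.mem_erase.2 ⟨him, hi⟩))
        omega
  have h := hSum_joinBoundary (disjoint_Ico (j + 1) m N) (pairFaces_subset (k + 1) (j + 1) m)
    hconesub (n := 2 * (k + 1)) (fun S hS => card_le_of_mem_pairFaces hS)
    (fun S hS => (hconecard S hS).trans (by omega))
  rw [Nat.card_Ico] at h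
  rw [antistarFaces_eq hj hmN, h, hSum_pairFaces hj, show 2 * (k + 1) = 2 * k + 1 + 1 by ring,
    hSum_succ hconecard, hSum_cone hcone fun S hS => card_le_of_mem_pairFaces hS,
    hSum_pairFaces (by omega)]
  obtain ⟨p, hp⟩ : ∃ p, m - j - (2 * k + 1 + 1) = p + 1 := ⟨m - j - (2 * k + 1 + 1) - 1, by omega⟩
  rw [hp, show m - (j + 1) - (2 * k + 1 + 1) = p by omega,
    show m - 1 - (j + 1) - 2 * k = p + 1 by omega, show p + 1 - 1 = p by omega]
  have h1 := multichoosePoly_succ_succ k p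
  have h2 := multichoosePoly_succ k (p + 1)
  have h3 : (1 - Polynomial.X) * multichoosePoly k (p + 1) = multichoosePoly (k + 1) p -
      C ((p + 1).multichoose (k + 1) : ℤ) * Polynomial.X ^ (k + 1) := by
    linear_combination h1 - h2
  rw [h3, pow_add]
  ring

end Boundary

end LexDiamond

namespace LexDiamond

open Polynomial

/-! ### The faces of the lexicographic subdivision -/

/-- `Z` indexes a maximal cell of the subdivision of the polytope spanned by the vertices
`s, s + 1, …` obtained by pushing the vertices `s, …, j₀ - 1` and then pulling `j₀`, where `p j F`
says that `F` indexes a facet of the polytope spanned by the vertices `j, j + 1, …`. -/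
def IsLexCell (p : ℕ → Finset ℕ → Prop) (j₀ s : ℕ) (Z : Finset ℕ) : Prop :=
  (∃ j, s ≤ j ∧ j < j₀ ∧ ∃ F, p (j + 1) F ∧ ¬ p j F ∧ Z = insert j F) ∨
    ∃ F, p j₀ F ∧ j₀ ∉ F ∧ Z = insert j₀ F

theorem isLexCell_congr {p q : ℕ → Finset ℕ → Prop} {j₀ s : ℕ}
    (h : ∀ j ≤ j₀, ∀ F, p j F ↔ q j F) {Z : Finset ℕ} :
    IsLexCell p j₀ s Z ↔ IsLexCell q j₀ s Z := by
  refine or_congr ⟨?_, ?_⟩ (exists_congr fun F => by rw [h j₀ le_rfl])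
  · rintro ⟨j, hsj, hj, F, h1, h2, h3⟩
    exact ⟨j, hsj, hj, F, (h _ hj F).1 h1, fun hF => h2 ((h _ hj.le F).2 hF), h3⟩
  · rintro ⟨j, hsj, hj, F, h1, h2, h3⟩
    exact ⟨j, hsj, hj, F, (h _ hj F).2 h1, fun hF => h2 ((h _ hj.le F).1 hF), h3⟩

/-- The first push contributes the pyramids over the visible facets. -/
theorem isLexCell_iff_of_lt {p : ℕ → Finset ℕ → Prop} {j₀ s : ℕ} (hs : s < j₀) {Z : Finset ℕ} :
    IsLexCell p j₀ s Z ↔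
      (∃ F, p (s + 1) F ∧ ¬ p s F ∧ Z = insert s F) ∨ IsLexCell p j₀ (s + 1) Z := by
  constructor
  · rintro (⟨j, hsj, hj, hF⟩ | h)
    · rcases hsj.eq_or_lt with rfl | hlt
      · exact Or.inl hF
      · exact Or.inr (Or.inl ⟨j, hlt, hj, hF⟩)
    · exact Or.inr (Or.inr h)
  · rintro (h | ⟨j, hsj, h⟩ | h)
    · exact Or.inl ⟨s, le_rfl, hs, h⟩
    · exact Or.inl ⟨j, by omega, h⟩
    · exact Or.inr h

theorem isLexCell_self {p : ℕ → Finset ℕ → Prop} {j₀ : ℕ} {Z : Finset ℕ} :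
    IsLexCell p j₀ j₀ Z ↔ ∃ F, p j₀ F ∧ j₀ ∉ F ∧ Z = insert j₀ F := by
  refine or_iff_right ?_
  rintro ⟨j, h1, h2, -⟩
  omega

theorem IsLexCell.subset {p : ℕ → Finset ℕ → Prop} {j₀ s N : ℕ} {Z : Finset ℕ}
    (h : IsLexCell p j₀ s Z) (hp : ∀ j ≤ j₀, ∀ F, p j F → F ⊆ Finset.Ico j N) (hs : s ≤ j₀)
    (hN : j₀ < N) : Z ⊆ Finset.Ico s N := by
  rcases h with ⟨j, hsj, hj, F, hF, -, rfl⟩ | ⟨F, hF, -, rfl⟩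
  · intro i hi
    rw [Finset.mem_Ico]
    rcases Finset.mem_insert.1 hi with rfl | hi
    · omega
    · have := Finset.mem_Ico.1 (hp _ (by omega) F hF hi)
      omega
  · intro i hi
    rw [Finset.mem_Ico]
    rcases Finset.mem_insert.1 hi with rfl | hi
    · omega
    · have := Finset.mem_Ico.1 (hp _ le_rfl F hF hi)
      omega

theorem IsLexCell.card_eq {p : ℕ → Finset ℕ → Prop} {j₀ s N d : ℕ} {Z : Finset ℕ}
    (h : IsLexCell p j₀ s Z) (hp : ∀ j ≤ j₀, ∀ F, p j F → F ⊆ Finset.Ico j N)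
    (hcard : ∀ j ≤ j₀, ∀ F, p j F → F.card = d) : Z.card = d + 1 := by
  rcases h with ⟨j, -, hj, F, hF, -, rfl⟩ | ⟨F, hF, hj, rfl⟩
  · rw [Finset.card_insert_of_notMem, hcard _ hj F hF]
    intro hjF
    have := Finset.mem_Ico.1 (hp _ hj F hF hjF)
    omega
  · rw [Finset.card_insert_of_notMem hj, hcard _ le_rfl F hF]

section LexFaces

/-- The face complex of the lexicographic subdivision of the polytope spanned by the vertices
`s, …, N - 1`. -/
noncomputable def lexFaces (k j₀ s m N : ℕ) : Finset (Finset ℕ) :=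
  generatedComplex (Finset.Ico s N) (IsLexCell (fun j => IsBoundarySet k j m N) j₀ s)

theorem mem_lexFaces {k j₀ s m N : ℕ} (hs : s ≤ j₀) (hj₀ : j₀ ≤ m) (hmN : m < N) {A : Finset ℕ} :
    A ∈ lexFaces k j₀ s m N ↔
      ∃ Z, IsLexCell (fun j => IsBoundarySet k j m N) j₀ s Z ∧ A ⊆ Z :=
  mem_generatedComplex fun _ hZ =>
    hZ.subset (fun _ hj _ hF => hF.subset (hj.trans hj₀) hmN.le) hs (hj₀.trans_lt hmN)

theorem IsBoundarySet.card_eq {k j m N : ℕ} {Z : Finset ℕ} (h : IsBoundarySet k j m N Z)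
    (hmN : m < N) : Z.card + 1 = 2 * k + (N - m) := by
  rcases h with ⟨S, hS, hcard, -, s, hs, rfl⟩ | ⟨S, hS, hcard, -, rfl⟩
  · rw [Finset.card_union_of_disjoint (disjoint_of_subset_Ico hS (Finset.erase_subset _ _)),
      Finset.card_erase_of_mem hs, Nat.card_Ico]
    omega
  · rw [Finset.card_union_of_disjoint (disjoint_of_subset_Ico hS subset_rfl), Nat.card_Ico]
    omega

/-- Pulling the first vertex produces the cone over its antistar. -/
theorem lexFaces_self {k j₀ m N : ℕ} (hj₀ : j₀ ≤ m) (hmN : m < N) :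
    lexFaces k j₀ j₀ m N = cone j₀ (antistarFaces k j₀ m N) := by
  have hcone : ∀ S ∈ antistarFaces k j₀ m N, j₀ ∉ S := fun S hS hj => by
    obtain ⟨Z, hZ, hSZ⟩ := (mem_antistarFaces hj₀ hmN.le).1 hS
    exact hZ.2 (hSZ hj)
  ext A
  rw [mem_lexFaces le_rfl hj₀ hmN, mem_cone hcone, mem_antistarFaces hj₀ hmN.le]
  simp only [isLexCell_self]
  constructor
  · rintro ⟨_, ⟨F, hF, hj, rfl⟩, hA⟩
    refine ⟨F, ⟨hF, hj⟩, fun i hi => ?_⟩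
    rw [Finset.mem_erase] at hi
    exact (Finset.mem_insert.1 (hA hi.2)).resolve_left hi.1
  · rintro ⟨F, ⟨hF, hj⟩, hA⟩
    exact ⟨_, ⟨F, hF, hj, rfl⟩, Finset.subset_insert_iff.2 hA⟩

/-- If only a simplex is left, then pulling does not subdivide it. -/
theorem lexFaces_self_of_eq {k j₀ m N : ℕ} (hm : m = j₀ + 2 * (k + 1)) (hmN : m < N) :
    lexFaces (k + 1) j₀ j₀ m N = (Finset.Ico j₀ N).powerset := by
  classical
  refine Finset.Subset.antisymm (Finset.filter_subset _ _) fun A hA => ?_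
  rw [mem_lexFaces le_rfl (by omega) hmN]
  refine ⟨insert j₀ (insert (m - 1) (Finset.Ico (j₀ + 1) (m - 1)) ∪ Finset.Ico m N),
    isLexCell_self.2 ⟨_, (isBoundarySet_iff hm.ge).2 (Or.inr (Or.inr ⟨_,
      (isPairSet_full (by omega)).succ_left, rfl⟩)), fun h => ?_, rfl⟩, fun i hi => ?_⟩
  · rw [Finset.mem_union, Finset.mem_insert, Finset.mem_Ico, Finset.mem_Ico] at h
    omega
  · have h := Finset.mem_Ico.1 (Finset.mem_powerset.1 hA hi)
    rw [Finset.mem_insert, Finset.mem_union, Finset.mem_insert, Finset.mem_Ico, Finset.mem_Ico]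
    omega

/-- Pushing the vertex `s` adds the pyramids over the complex of visible facets, which is the join
of a cone with a simplex. -/
theorem lexFaces_of_lt {k j₀ s m N : ℕ} (hs : s < j₀) (hj₀ : j₀ + 2 * (k + 1) ≤ m) (hmN : m < N)
    (hridge : ∀ F, IsBoundarySet (k + 1) (s + 1) m N F →
      ∃ Z, IsLexCell (fun j => IsBoundarySet (k + 1) j m N) j₀ (s + 1) Z ∧ F ⊆ Z) :
    lexFaces (k + 1) j₀ s m N = lexFaces (k + 1) j₀ (s + 1) m N ∪
      (join (Finset.Ico (s + 1) m) (Finset.Ico m N) (cone (s + 1) (pairFaces k (s + 2) m))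
        (Finset.Ico m N).powerset).image (insert s) := by
  have hcone : ∀ S ∈ pairFaces k (s + 2) m, s + 1 ∉ S := fun S hS =>
    notMem_of_mem_pairFaces hS (by omega)
  have hvis : ∀ B : Finset ℕ, B ∈ join (Finset.Ico (s + 1) m) (Finset.Ico m N)
      (cone (s + 1) (pairFaces k (s + 2) m)) (Finset.Ico m N).powerset ↔
      ∃ F, (IsBoundarySet (k + 1) (s + 1) m N F ∧ ¬ IsBoundarySet (k + 1) s m N F) ∧ B ⊆ F := by
    intro B
    rw [mem_join, mem_cone hcone, mem_pairFaces, Finset.mem_powerset]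
    simp only [isBoundarySet_visible_iff (show s + 1 + 2 * (k + 1) ≤ m by omega)]
    constructor
    · rintro ⟨hB, ⟨S, hS, hBS⟩, hBT⟩
      refine ⟨_, ⟨S, hS, rfl⟩, subset_union_of_inter_subset hB (fun i hi => ?_) hBT⟩
      rw [Finset.mem_insert]
      by_cases his : i = s + 1
      · exact Or.inl his
      · exact Or.inr (hBS (Finset.mem_erase.2 ⟨his, hi⟩))
    · rintro ⟨_, ⟨S, hS, rfl⟩, hB⟩
      refine ⟨fun i hi => ?_, ⟨S, hS, fun i hi => ?_⟩, Finset.inter_subset_right⟩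
      · have h1 := hB hi
        rw [Finset.mem_union, Finset.mem_insert] at h1
        rw [Finset.mem_union, Finset.mem_Ico]
        rcases h1 with (h1 | h1) | h1
        · exact Or.inl (by omega)
        · have := Finset.mem_Ico.1 (hS.1 h1)
          exact Or.inl (by omega)
        · exact Or.inr h1
      · rw [Finset.mem_erase, Finset.mem_inter, Finset.mem_Ico] at hi
        have h1 := hB hi.2.1
        rw [Finset.mem_union, Finset.mem_insert, Finset.mem_Ico] at h1
        rcases h1 with (h1 | h1) | h1
        · exact absurd h1 hi.1
        · exact h1
        · omega
  have hsub : ∀ Z, IsLexCell (fun j => IsBoundarySet (k + 1) j m N) j₀ (s + 1) Z → s ∉ Z := by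
    intro Z hZ hsZ
    have := Finset.mem_Ico.1 (hZ.subset (N := N)
      (fun j hj F hF => hF.subset (by omega) hmN.le) hs (by omega) hsZ)
    omega
  ext A
  rw [Finset.mem_union, mem_lexFaces hs.le (by omega) hmN, mem_lexFaces hs (by omega) hmN,
    Finset.mem_image]
  constructor
  · rintro ⟨Z, hZ, hA⟩
    rcases (isLexCell_iff_of_lt hs).1 hZ with ⟨F, hF, hF', rfl⟩ | hZ
    · by_cases hsA : s ∈ A
      · exact Or.inr ⟨A.erase s, (hvis _).2 ⟨F, ⟨hF, hF'⟩, Finset.subset_insert_iff.1 hA⟩,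
          Finset.insert_erase hsA⟩
      · obtain ⟨Z, hZ, hFZ⟩ := hridge F hF
        exact Or.inl ⟨Z, hZ, ((Finset.subset_insert_iff_of_notMem hsA).1 hA).trans hFZ⟩
    · exact Or.inl ⟨Z, hZ, hA⟩
  · rintro (⟨Z, hZ, hA⟩ | ⟨B, hB, rfl⟩)
    · exact ⟨Z, (isLexCell_iff_of_lt hs).2 (Or.inr hZ), hA⟩
    · obtain ⟨F, hF, hBF⟩ := (hvis B).1 hB
      exact ⟨_, (isLexCell_iff_of_lt hs).2 (Or.inl ⟨F, hF.1, hF.2, rfl⟩),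
        Finset.insert_subset_insert _ hBF⟩

theorem hSum_lexFaces_self {k j₀ m N : ℕ} (hj₀ : j₀ + 2 * (k + 1) ≤ m) (hmN : m < N) :
    hSum (lexFaces (k + 1) j₀ j₀ m N) (2 * (k + 1) + (N - m) + 1) =
      (1 - Polynomial.X) * multichoosePoly (k + 1) (m - j₀ - 2 * (k + 1)) +
        C ((m - j₀ - 2 * (k + 1)).multichoose (k + 1) : ℤ) *
          (Polynomial.X ^ (k + 2) - Polynomial.X ^ (k + 1 + (N - m))) := by
  rcases hj₀.eq_or_lt with heq | hlt
  · have hcard : 2 * (k + 1) + (N - m) = (Finset.Ico j₀ N).card := by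
      rw [Nat.card_Ico]
      omega
    rw [lexFaces_self_of_eq heq.symm hmN, hcard,
      hSum_succ fun S hS => Finset.card_le_card (Finset.mem_powerset.1 hS), hSum_powerset,
      show m - j₀ - 2 * (k + 1) = 0 by omega, multichoosePoly_zero_right]
    simp
  · have hcone : ∀ S ∈ antistarFaces (k + 1) j₀ m N, j₀ ∉ S := fun S hS hj => by
      obtain ⟨Z, hZ, hSZ⟩ := (mem_antistarFaces (by omega) hmN.le).1 hS
      exact hZ.2 (hSZ hj)
    have hcard : ∀ S ∈ antistarFaces (k + 1) j₀ m N, S.card ≤ 2 * (k + 1) + (N - m) :=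
      fun S hS => by
        obtain ⟨Z, hZ, hSZ⟩ := (mem_antistarFaces (by omega) hmN.le).1 hS
        have h1 := Finset.card_le_card hSZ
        have h2 := hZ.1.card_eq hmN
        omega
    rw [lexFaces_self (by omega) hmN, hSum_cone hcone hcard, hSum_antistarFaces (by omega) hmN]
    obtain ⟨p, hp⟩ : ∃ p, m - j₀ - 2 * (k + 1) = p + 1 := ⟨m - j₀ - 2 * (k + 1) - 1, by omega⟩
    rw [hp, Nat.add_sub_cancel]
    have h1 := multichoosePoly_succ_succ k p
    have h2 := multichoosePoly_succ k (p + 1)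
    linear_combination Polynomial.X * h2 - h1

/-- Each push raises the number of multisets that are counted by one more element, up to the
correction term that the pulling at the end has produced. -/
theorem hSum_lexFaces {k j₀ s m N : ℕ} (hs : s ≤ j₀) (hj₀ : j₀ + 2 * (k + 1) ≤ m) (hmN : m < N)
    (hridge : ∀ j ≤ j₀, ∀ F, IsBoundarySet (k + 1) j m N F →
      ∃ Z, IsLexCell (fun j => IsBoundarySet (k + 1) j m N) j₀ j Z ∧ F ⊆ Z) :
    hSum (lexFaces (k + 1) j₀ s m N) (2 * (k + 1) + (N - m) + 1) =
      (1 - Polynomial.X) * multichoosePoly (k + 1) (m - s - 2 * (k + 1)) +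
        C ((m - j₀ - 2 * (k + 1)).multichoose (k + 1) : ℤ) *
          (Polynomial.X ^ (k + 2) - Polynomial.X ^ (k + 1 + (N - m))) := by
  induction hs using Nat.decreasingInduction with
  | self => exact hSum_lexFaces_self hj₀ hmN
  | of_succ s hs ih =>
    have hcone : ∀ S ∈ pairFaces k (s + 2) m, s + 1 ∉ S := fun S hS =>
      notMem_of_mem_pairFaces hS (by omega)
    have hpair : ∀ S ∈ pairFaces k (s + 2) m, S.card ≤ 2 * k := fun S hS =>
      card_le_of_mem_pairFaces hS
    set Y := join (Finset.Ico (s + 1) m) (Finset.Ico m N) (cone (s + 1) (pairFaces k (s + 2) m))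
        (Finset.Ico m N).powerset with hY
    have hsY : ∀ B ∈ Y, s ∉ B := fun B hB hsB => by
      have h1 := (mem_join.1 hB).1 hsB
      rw [Finset.mem_union, Finset.mem_Ico, Finset.mem_Ico] at h1
      omega
    have hconecard : ∀ S ∈ cone (s + 1) (pairFaces k (s + 2) m), S.card ≤ 2 * k + 1 :=
      fun S hS => by
        have h1 := hpair _ ((mem_cone hcone).1 hS)
        have h2 := Finset.pred_card_le_card_erase (s := S) (a := s + 1)
        omega
    have hconesub : cone (s + 1) (pairFaces k (s + 2) m) ⊆ (Finset.Ico (s + 1) m).powerset :=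
      fun S hS => by
        have h1 := Finset.mem_powerset.1 (pairFaces_subset _ _ _ ((mem_cone hcone).1 hS))
        rw [Finset.mem_powerset]
        intro i hi
        rw [Finset.mem_Ico]
        by_cases his : i = s + 1
        · omega
        · have := Finset.mem_Ico.1 (h1 (Finset.mem_erase.2 ⟨his, hi⟩))
          omega
    have hYsum : hSum Y (2 * k + 1 + (N - m)) = multichoosePoly k (m - (s + 2) - 2 * k) := by
      have h := hSum_join (disjoint_Ico (s + 1) m N) hconesub
        (subset_refl (Finset.Ico m N).powerset) hconecard
        fun S hS => Finset.card_le_card (Finset.mem_powerset.1 hS)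
      rw [hSum_powerset, mul_one, Nat.card_Ico, hSum_cone hcone hpair,
        hSum_pairFaces (by omega)] at h
      exact h
    have hYcard : ∀ B ∈ Y, B.card ≤ 2 * k + 1 + (N - m) := fun B hB => by
      obtain ⟨h1, h2, -⟩ := mem_join.1 hB
      have h3 := hconecard _ h2
      have h4 : B.card ≤ (B ∩ Finset.Ico (s + 1) m).card + (Finset.Ico m N).card := by
        refine le_trans (Finset.card_le_card ?_) (Finset.card_union_le _ _)
        exact subset_union_of_inter_subset h1 subset_rfl Finset.inter_subset_right
      rw [Nat.card_Ico] at h4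
      omega
    have hYimage : ∀ B ∈ Y.image (insert s), B.card ≤ 2 * k + 1 + (N - m) + 1 := fun B hB => by
      obtain ⟨B', hB', rfl⟩ := Finset.mem_image.1 hB
      have h1 := Finset.card_insert_le s B'
      have h2 := hYcard B' hB'
      omega
    have hdisj : Disjoint (lexFaces (k + 1) j₀ (s + 1) m N) (Y.image (insert s)) := by
      classical
      rw [Finset.disjoint_left]
      intro B hB hB'
      obtain ⟨B', -, rfl⟩ := Finset.mem_image.1 hB'
      have h1 := Finset.mem_Ico.1 (Finset.mem_powerset.1 (Finset.mem_filter.1 hB).1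
        (Finset.mem_insert_self s B'))
      omega
    rw [lexFaces_of_lt hs hj₀ hmN (hridge (s + 1) hs), ← hY, hSum_union hdisj, ih,
      show 2 * (k + 1) + (N - m) + 1 = 2 * k + 1 + (N - m) + 1 + 1 by ring, hSum_succ hYimage,
      hSum_image_insert hsY, hYsum]
    obtain ⟨p, hp⟩ : ∃ p, m - s - 2 * (k + 1) = p + 1 := ⟨m - s - 2 * (k + 1) - 1, by omega⟩
    rw [hp, show m - (s + 1) - 2 * (k + 1) = p by omega, show m - (s + 2) - 2 * k = p + 1 by omega]
    linear_combination (Polynomial.X - 1) * multichoosePoly_succ_succ k p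

end LexFaces

end LexDiamond

namespace LexDiamond

open Module Filter

/-! ### Lexicographic heights -/

section Push

variable {ι E : Type*} [DecidableEq ι] [NormedAddCommGroup E] [NormedSpace ℝ E]
  [FiniteDimensional ℝ E] {x : ι → E} {w : ι → ℝ} {I : Finset ι} {o : ι}

/-- Adding a point with a very large height pushes it: the old cells are kept, and the new ones are
the pyramids over the facets that are visible from the new point. -/
theorem HighApex.isLowerCell_push_iff (h : HighApex x w I o (w o)) (hs : Simplicial x I)
    (hs' : Simplicial x (insert o I)) (hI : Spans x I) (ho : o ∉ I) {Z : Finset ι} :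
    IsLowerCell x w (insert o I) Z ↔
      (∃ F, IsFacetSet x I F ∧ ¬ IsFacetSet x (insert o I) F ∧ Z = insert o F) ∨
        IsLowerCell x w I Z := by
  by_cases hoZ : o ∈ Z
  · have h1 : ¬ IsLowerCell x w I Z := fun hZ => ho (hZ.1 hoZ)
    rw [or_iff_left h1]
    constructor
    · intro hZ
      have hsub : Z.erase o ⊆ I := Finset.subset_insert_iff.1 hZ.1
      rw [← Finset.insert_erase hoZ, h.isLowerCell_insert_iff hs hs' hI ho hsub] at hZ
      exact ⟨_, hZ.1, hZ.2, (Finset.insert_erase hoZ).symm⟩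
    · rintro ⟨F, hF, hF', rfl⟩
      exact (h.isLowerCell_insert_iff hs hs' hI ho hF.isFaceSet.1).2 ⟨hF, hF'⟩
  · rw [h.isLowerCell_iff hoZ, or_iff_right]
    rintro ⟨F, -, -, rfl⟩
    exact hoZ (Finset.mem_insert_self _ _)

end Push

section Heights

variable {E : Type*} [NormedAddCommGroup E] [NormedSpace ℝ E] [FiniteDimensional ℝ E]
  {x : ℕ → E} {N j₀ : ℕ}

/-- Lexicographic heights are found from the last vertex backwards: each vertex that is pushed gets
a height that is large compared with the later ones. -/
theorem exists_lexHeights (hs : ∀ j ≤ j₀, Simplicial x (Finset.Ico j N))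
    (hI : ∀ j ≤ j₀, Spans x (Finset.Ico j N)) (hN : j₀ < N) {s : ℕ} (hsj : s ≤ j₀) :
    ∃ w : ℕ → ℝ, (∀ i j, s ≤ i → i < j → j < j₀ → w j < w i) ∧ (∀ i, s ≤ i → i < j₀ → 0 < w i) ∧
      w j₀ < 0 ∧ (∀ i, j₀ < i → w i = 0) ∧
      ∀ Z, IsLowerCell x w (Finset.Ico s N) Z ↔
        IsLexCell (fun j => IsFacetSet x (Finset.Ico j N)) j₀ s Z := by
  induction hsj using Nat.decreasingInduction with
  | self =>
    refine ⟨fun i => if i = j₀ then -1 else 0, fun i j h1 h2 h3 => by omega,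
      fun i h1 h2 => by omega, by simp, fun i hi => if_neg hi.ne', fun Z => ?_⟩
    rw [isLexCell_self]
    exact isLowerCell_pull_iff (hs _ le_rfl) (hI _ le_rfl) (Finset.mem_Ico.2 ⟨le_rfl, hN⟩)
      (by simp) fun i _ hi => if_neg hi
  | of_succ s hsj ih =>
    obtain ⟨w, hanti, hpos, hneg, hzero, hw⟩ := ih
    obtain ⟨w₀, hapex, hw₀, hlarge⟩ := ((eventually_highApex x w (Finset.Ico (s + 1) N) s).and
      ((eventually_gt_atTop 0).and ((eventually_all_finset (Finset.Ico (s + 1) N)).2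
        fun i _ => eventually_gt_atTop (w i)))).exists
    obtain ⟨u, hupdate, hself⟩ : ∃ u : ℕ → ℝ, (∀ i, s < i → u i = w i) ∧ u s = w₀ :=
      ⟨Function.update w s w₀, fun i hi => Function.update_of_ne hi.ne' _ _,
        Function.update_self _ _ _⟩
    have hagree : ∀ i ∈ Finset.Ico (s + 1) N, w i = u i := fun i hi =>
      (hupdate i (Finset.mem_Ico.1 hi).1).symm
    have hIco : Finset.Ico s N = insert s (Finset.Ico (s + 1) N) :=
      (Finset.insert_Ico_add_one_left_eq_Ico (by omega)).symm
    refine ⟨u, fun i j h1 h2 h3 => ?_, fun i h1 h2 => ?_, ?_, fun i hi => ?_,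
      fun Z => ?_⟩
    · rw [hupdate j (by omega)]
      rcases h1.eq_or_lt with rfl | hlt
      · rw [hself]
        exact hlarge j (Finset.mem_Ico.2 ⟨h2, by omega⟩)
      · rw [hupdate i hlt]
        exact hanti i j hlt h2 h3
    · rcases h1.eq_or_lt with rfl | hlt
      · rwa [hself]
      · rw [hupdate i hlt]
        exact hpos i hlt h2
    · rwa [hupdate j₀ hsj]
    · rw [hupdate i (by omega)]
      exact hzero i hi
    · have hapex' := hapex.congr hagree
      rw [← hself] at hapex'
      have hs' := hs s (by omega)
      rw [hIco] at hs'
      rw [isLexCell_iff_of_lt hsj, ← hw, hIco, hapex'.isLowerCell_push_iff (hs _ hsj) hs'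
        (hI _ hsj) (by simp)]
      exact or_congr Iff.rfl
        ⟨fun h => h.congr fun i hi => (hagree i hi).symm, fun h => h.congr hagree⟩

/-- Each facet lies in a cell of the lexicographic subdivision. -/
theorem exists_isLexCell_superset (hs : ∀ j ≤ j₀, Simplicial x (Finset.Ico j N))
    (hI : ∀ j ≤ j₀, Spans x (Finset.Ico j N)) (hN : j₀ < N) {s : ℕ} (hsj : s ≤ j₀) {F : Finset ℕ}
    (hF : IsFacetSet x (Finset.Ico s N) F) :
    ∃ Z, IsLexCell (fun j => IsFacetSet x (Finset.Ico j N)) j₀ s Z ∧ F ⊆ Z := by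
  obtain ⟨w, -, -, -, -, hw⟩ := exists_lexHeights hs hI hN hsj
  obtain ⟨Z, hZ, hFZ⟩ := exists_isLowerCell_superset (hs s hsj) (hI s hsj) w hF
  exact ⟨Z, (hw Z).1 hZ, hFZ⟩

end Heights

/-! ### Subdivisions in terms of index sets -/

section Translation

variable {E : Type*} [NormedAddCommGroup E] [NormedSpace ℝ E] {x : ℕ → E} {N : ℕ}

/-- Points that are faces of the polytope they span are in convex position. -/
theorem mem_hull_iff_mem {ι : Type*} {x : ι → E} {I Z : Finset ι} {i : ι}
    (h : IsFaceSet x I {i}) (hZ : Z ⊆ I) : x i ∈ hull x Z ↔ i ∈ Z := by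
  refine ⟨fun hi => ?_, mem_hull⟩
  obtain ⟨hiI, A, hA, hA0⟩ := h
  by_contra hiZ
  have hpos := affine_pos_of_mem_hull (A := A) (fun j hj => lt_of_le_of_ne (hA j (hZ hj))
    fun h0 => hiZ (Finset.mem_singleton.1 ((hA0 j (hZ hj)).1 h0.symm) ▸ hj)) hi
  exact hpos.ne' ((hA0 i (Finset.singleton_subset_iff.1 hiI)).2 (Finset.mem_singleton_self i))

theorem hull_injOn {ι : Type*} {x : ι → E} {I Z Z' : Finset ι} (h : ∀ i ∈ I, IsFaceSet x I {i})
    (hZ : Z ⊆ I) (hZ' : Z' ⊆ I) (heq : hull x Z = hull x Z') : Z = Z' := by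
  ext i
  constructor
  · exact fun hi => (mem_hull_iff_mem (h i (hZ hi)) hZ').1 (heq ▸ mem_hull hi)
  · exact fun hi => (mem_hull_iff_mem (h i (hZ' hi)) hZ).1 (heq ▸ mem_hull hi)

theorem convexHull_insert_hull {ι : Type*} [DecidableEq ι] (x : ι → E) (i : ι) (Z : Finset ι) :
    convexHull ℝ (insert (x i) (hull x Z)) = hull x (insert i Z) := by
  rw [hull, Set.insert_eq, convexHull_convexHull_union_right, hull, Finset.coe_insert,
    Set.image_insert_eq, Set.insert_eq]

theorem tailPolytope_eq {v : Fin N → E} (hx : ∀ i : Fin N, x i = v i) (j : ℕ) :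
    tailPolytope v j = hull x (Finset.Ico j N) := by
  rw [tailPolytope, hull]
  congr 1
  ext y
  constructor
  · rintro ⟨i, hi, rfl⟩
    exact ⟨i, Finset.mem_coe.2 (Finset.mem_Ico.2 ⟨hi, i.isLt⟩), hx i⟩
  · rintro ⟨i, hi, rfl⟩
    have hi := Finset.mem_Ico.1 (Finset.mem_coe.1 hi)
    exact ⟨⟨i, hi.2⟩, hi.1, (hx ⟨i, hi.2⟩).symm⟩

theorem mem_inducedCells_iff {v : Fin N → E} {w : Fin N → ℝ} {w' : ℕ → ℝ}
    (hx : ∀ i : Fin N, x i = v i) (hw : ∀ i : Fin N, w' i = w i) {S : Set E} :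
    S ∈ inducedCells v w ↔ ∃ Z, IsLowerCell x w' (Finset.Ico 0 N) Z ∧ S = hull x Z := by
  classical
  constructor
  · rintro ⟨hS, l, hl, rfl⟩
    have hZ : v '' {i | l (v i) = w i} =
        x '' ((Finset.Ico 0 N).filter fun i => l (x i) = w' i : Finset ℕ) := by
      ext y
      constructor
      · rintro ⟨i, hi, rfl⟩
        refine ⟨i, Finset.mem_coe.2 (Finset.mem_filter.2
          ⟨Finset.mem_Ico.2 ⟨Nat.zero_le _, i.isLt⟩, ?_⟩), hx i⟩
        rw [hx, hw]
        exact hi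
      · rintro ⟨i, hi, rfl⟩
        obtain ⟨h1, h2⟩ := Finset.mem_filter.1 (Finset.mem_coe.1 hi)
        have hiN := (Finset.mem_Ico.1 h1).2
        have h3 := hx ⟨i, hiN⟩
        have h4 := hw ⟨i, hiN⟩
        refine ⟨⟨i, hiN⟩, ?_, h3.symm⟩
        rw [Set.mem_ofPred_eq, ← h3, ← h4]
        exact h2
    refine ⟨_, ⟨Finset.filter_subset _ _, ?_, l, fun i hi => ?_, fun i hi => ?_⟩, by rw [hZ, hull]⟩
    · rw [spans_iff_affineSpan, ← hZ, ← affineSpan_convexHull]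
      exact hS
    · have hiN := (Finset.mem_Ico.1 hi).2
      have h := hl ⟨i, hiN⟩
      rwa [← hx, ← hw] at h
    · rw [Finset.mem_filter, and_iff_right hi]
  · rintro ⟨Z, ⟨hZI, hsp, l, hl, hlZ⟩, rfl⟩
    refine ⟨?_, l, fun i => ?_, ?_⟩
    · rw [hull, affineSpan_convexHull]
      exact spans_iff_affineSpan.1 hsp
    · rw [← hx, ← hw]
      exact hl i (Finset.mem_Ico.2 ⟨Nat.zero_le _, i.isLt⟩)
    · rw [hull]
      congr 1
      ext y
      constructor
      · rintro ⟨i, hi, rfl⟩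
        have hiN := (Finset.mem_Ico.1 (hZI (Finset.mem_coe.1 hi))).2
        have h3 := hx ⟨i, hiN⟩
        have h4 := hw ⟨i, hiN⟩
        refine ⟨⟨i, hiN⟩, ?_, h3.symm⟩
        rw [Set.mem_ofPred_eq, ← h3, ← h4]
        exact (hlZ i (hZI (Finset.mem_coe.1 hi))).2 (Finset.mem_coe.1 hi)
      · rintro ⟨i, hi, rfl⟩
        refine ⟨i, Finset.mem_coe.2 ((hlZ i (Finset.mem_Ico.2 ⟨Nat.zero_le _, i.isLt⟩)).1 ?_),
          hx i⟩
        rw [hx, hw]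
        exact hi

theorem mem_lexCells_iff [FiniteDimensional ℝ E] {v : Fin N → E} {a : ℕ}
    (hx : ∀ i : Fin N, x i = v i) (hv : ∀ i ∈ Finset.Ico 0 N, IsFaceSet x (Finset.Ico 0 N) {i})
    (hs : ∀ j < a, Simplicial x (Finset.Ico j N)) (hI : ∀ j < a, Spans x (Finset.Ico j N))
    (ha : 1 ≤ a) (haN : a ≤ N) {S : Set E} :
    S ∈ lexCells v a ↔
      ∃ Z, IsLexCell (fun j => IsFacetSet x (Finset.Ico j N)) (a - 1) 0 Z ∧ S = hull x Z := by
  have hfacet : ∀ j < a, ∀ F, IsFacet (tailPolytope v j) F ↔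
      ∃ Z, IsFacetSet x (Finset.Ico j N) Z ∧ F = hull x Z := fun j hj F => by
    rw [tailPolytope_eq hx, (hs j hj).isFacet_iff (hI j hj)]
  have hsub : ∀ j Z, IsFacetSet x (Finset.Ico j N) Z → Z ⊆ Finset.Ico 0 N := fun j Z hZ =>
    hZ.isFaceSet.1.trans (Finset.Ico_subset_Ico_left (Nat.zero_le _))
  have hfacet' : ∀ j < a, ∀ Z ⊆ Finset.Ico 0 N,
      IsFacet (tailPolytope v j) (hull x Z) ↔ IsFacetSet x (Finset.Ico j N) Z :=
    fun j hj Z hZ => by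
      rw [hfacet j hj]
      constructor
      · rintro ⟨Z', hZ', heq⟩
        rwa [hull_injOn hv hZ (hsub j Z' hZ') heq]
      · exact fun h => ⟨Z, h, rfl⟩
  constructor
  · rintro (⟨j, hj, F, hF, hF', rfl⟩ | ⟨j, hj, F, hF, hF', rfl⟩)
    · obtain ⟨Z, hZ, rfl⟩ := (hfacet _ hj F).1 hF
      refine ⟨_, Or.inl ⟨j, Nat.zero_le _, by omega, Z, hZ, fun h => hF' ?_, rfl⟩, ?_⟩
      · exact (hfacet' j (by omega) Z (hsub _ _ hZ)).2 h
      · rw [← hx, convexHull_insert_hull]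
    · obtain ⟨Z, hZ, rfl⟩ := (hfacet _ (by omega) F).1 hF
      obtain rfl : a = j + 1 := hj.symm
      refine ⟨_, Or.inr ⟨Z, hZ, fun h => hF' ?_, rfl⟩, ?_⟩
      · rw [← hx]
        exact mem_hull h
      · rw [← hx, convexHull_insert_hull, Nat.add_sub_cancel]
  · rintro ⟨_, ⟨j, -, hj, F, hF, hF', rfl⟩ | ⟨F, hF, hF', rfl⟩, rfl⟩
    · have hja : j + 1 < a := by omega
      refine Or.inl ⟨⟨j, by omega⟩, hja, hull x F, ?_, fun h => hF' ?_, ?_⟩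
      · exact (hfacet' _ hja F (hsub _ _ hF)).2 hF
      · exact (hfacet' _ (by omega) F (hsub _ _ hF)).1 h
      · rw [← hx, convexHull_insert_hull]
    · have haN' : a - 1 ∈ Finset.Ico 0 N := Finset.mem_Ico.2 ⟨Nat.zero_le _, by omega⟩
      refine Or.inr ⟨⟨a - 1, by omega⟩, Nat.sub_add_cancel ha, hull x F, ?_, fun h => hF' ?_, ?_⟩
      · exact (hfacet' _ (show a - 1 < a by omega) F (hsub _ _ hF)).2 hF
      · rw [← hx] at h
        exact (mem_hull_iff_mem (hv _ haN') (hsub _ _ hF)).1 h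
      · rw [← hx, convexHull_insert_hull]

/-- For points in convex position, the subdivision is determined by the index sets of its cells. -/
theorem IsLexHeights.isLowerCell_iff [FiniteDimensional ℝ E] {v : Fin N → E} {a : ℕ}
    {w : Fin N → ℝ} {w' : ℕ → ℝ} (h : IsLexHeights v a w) (hx : ∀ i : Fin N, x i = v i)
    (hw : ∀ i : Fin N, w' i = w i)
    (hv : ∀ i ∈ Finset.Ico 0 N, IsFaceSet x (Finset.Ico 0 N) {i})
    (hs : ∀ j < a, Simplicial x (Finset.Ico j N)) (hI : ∀ j < a, Spans x (Finset.Ico j N))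
    (ha : 1 ≤ a) (haN : a ≤ N) {Z : Finset ℕ} :
    IsLowerCell x w' (Finset.Ico 0 N) Z ↔
      IsLexCell (fun j => IsFacetSet x (Finset.Ico j N)) (a - 1) 0 Z := by
  have hsub : ∀ Z, IsLexCell (fun j => IsFacetSet x (Finset.Ico j N)) (a - 1) 0 Z →
      Z ⊆ Finset.Ico 0 N := fun Z hZ =>
    hZ.subset (fun j _ F hF => hF.isFaceSet.1) (Nat.zero_le _) (by omega)
  have hind := h.induces
  constructor
  · intro hZ
    have h1 : hull x Z ∈ inducedCells v w := (mem_inducedCells_iff hx hw).2 ⟨Z, hZ, rfl⟩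
    rw [hind, mem_lexCells_iff hx hv hs hI ha haN] at h1
    obtain ⟨Z', hZ', heq⟩ := h1
    rwa [hull_injOn hv hZ.1 (hsub Z' hZ') heq]
  · intro hZ
    have h1 : hull x Z ∈ lexCells v a :=
      (mem_lexCells_iff hx hv hs hI ha haN).2 ⟨Z, hZ, rfl⟩
    rw [← hind, mem_inducedCells_iff hx hw] at h1
    obtain ⟨Z', hZ', heq⟩ := h1
    rwa [hull_injOn hv (hsub Z hZ) hZ'.1 heq]

theorem exists_isLexHeights [FiniteDimensional ℝ E] {v : Fin N → E} {a : ℕ}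
    (hx : ∀ i : Fin N, x i = v i)
    (hv : ∀ i ∈ Finset.Ico 0 N, IsFaceSet x (Finset.Ico 0 N) {i})
    (hs : ∀ j < a, Simplicial x (Finset.Ico j N)) (hI : ∀ j < a, Spans x (Finset.Ico j N))
    (ha : 1 ≤ a) (haN : a ≤ N) : ∃ w : Fin N → ℝ, IsLexHeights v a w := by
  obtain ⟨w, hanti, hpos, hneg, hzero, hw⟩ := exists_lexHeights (j₀ := a - 1)
    (fun j hj => hs j (by omega)) (fun j hj => hI j (by omega)) (by omega) (Nat.zero_le _)
  refine ⟨fun i => w i, fun i j hij hj => hanti i j (Nat.zero_le _) hij (by omega),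
    fun i hi => hpos i (Nat.zero_le _) (by omega), fun i hi => ?_, fun i hi => hzero i (by omega),
    ?_⟩
  · rwa [show (i : ℕ) = a - 1 by omega]
  · ext S
    rw [mem_inducedCells_iff hx fun _ => rfl, mem_lexCells_iff hx hv hs hI ha haN]
    exact exists_congr fun Z => and_congr_left' (hw Z)

theorem diamond_eq {v : Fin N → E} {w : Fin N → ℝ} {w' : ℕ → ℝ} (hx : ∀ i : Fin N, x i = v i)
    (hw : ∀ i : Fin N, w' i = w i) :
    diamond v w (w' N, x N) = hull (lift w' x) (insert N (Finset.Ico 0 N)) := by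
  rw [diamond, hull, Finset.coe_insert, Set.image_insert_eq]
  congr 2
  ext p
  constructor
  · rintro ⟨i, rfl⟩
    refine ⟨i, Finset.mem_coe.2 (Finset.mem_Ico.2 ⟨Nat.zero_le _, i.isLt⟩), ?_⟩
    rw [lift, hx, hw]
  · rintro ⟨i, hi, rfl⟩
    have hiN := (Finset.mem_Ico.1 (Finset.mem_coe.1 hi)).2
    exact ⟨⟨i, hiN⟩, Prod.ext (hw ⟨i, hiN⟩).symm (hx ⟨i, hiN⟩).symm⟩

end Translation

end LexDiamond

namespace LexDiamond

open Module Filter Polynomial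

/-! ### The `g`-vector of the diamond -/

theorem gNum_eq_coeff {E : Type*} [NormedAddCommGroup E] [NormedSpace ℝ E] (P : Set E) (i : ℕ) :
    gNum P i = ((1 - Polynomial.X) * hPoly P).coeff i := by
  rcases i with _ | i
  · simp [gNum, hNum, sub_mul]
  · simp [gNum, hNum, sub_mul, coeff_X_mul]

namespace IsCurveModel

variable {E : Type*} [NormedAddCommGroup E] [NormedSpace ℝ E] [FiniteDimensional ℝ E] {x : ℕ → E}
  {k m N : ℕ} {t c : ℕ → ℝ}

/-- All vertices of a McMullen–Walkup polytope lie in facets, and are therefore vertices. -/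
theorem isFaceSet_singleton (hM : IsCurveModel x (2 * (k + 1)) m N t c) (hm : 2 * (k + 1) ≤ m)
    {i : ℕ} (hi : i ∈ Finset.Ico 0 N) : IsFaceSet x (Finset.Ico 0 N) {i} := by
  have hmN := hM.m_lt
  obtain ⟨Z, hZ, hiZ⟩ : ∃ Z, IsBoundarySet (k + 1) 0 m N Z ∧ i ∈ Z := by
    rcases lt_or_ge i m with hlt | hge
    · obtain ⟨S, hS, hiS⟩ := inPairSet_of_card_le (k := k + 1) (j := 0) (m := m) (A := {i})
        (by rw [Finset.singleton_subset_iff, Finset.mem_Ico]; omega) (by simp) (by omega)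
      exact ⟨_, (isBoundarySet_iff (by omega)).2
        (Or.inl ⟨S, hS, m, Finset.mem_Ico.2 ⟨le_rfl, hmN⟩, rfl⟩),
        Finset.mem_union_left _ (hiS (Finset.mem_singleton_self i))⟩
    · obtain ⟨S, hS, -⟩ := inPairSet_of_card_le (k := k) (j := 1) (m := m) (A := ∅) (by simp)
        (by simp) (by omega)
      exact ⟨_, (isBoundarySet_iff (by omega)).2 (Or.inr (Or.inl ⟨S, hS, rfl⟩)),
        Finset.mem_union_right _ (Finset.mem_Ico.2 ⟨hge, (Finset.mem_Ico.1 hi).2⟩)⟩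
  exact (hM.simplicial (by omega)).isFaceSet ((hM.isFacetSet_iff (by omega)).2 hZ)
    (Finset.singleton_subset_iff.2 hiZ)

section Diamond

variable {w : ℕ → ℝ} {j₀ : ℕ}

theorem isLexCell_iff (hM : IsCurveModel x (2 * k) m N t c) (hj₀ : j₀ + 2 * k ≤ m) {s : ℕ}
    {Z : Finset ℕ} : IsLexCell (fun j => IsFacetSet x (Finset.Ico j N)) j₀ s Z ↔
      IsLexCell (fun j => IsBoundarySet k j m N) j₀ s Z :=
  isLexCell_congr fun _ hj _ => hM.isFacetSet_iff (by omega)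

theorem exists_isLexCell_superset (hM : IsCurveModel x (2 * k) m N t c) (hj₀ : j₀ + 2 * k ≤ m)
    {s : ℕ} (hs : s ≤ j₀) {F : Finset ℕ} (hF : IsBoundarySet k s m N F) :
    ∃ Z, IsLexCell (fun j => IsBoundarySet k j m N) j₀ s Z ∧ F ⊆ Z := by
  have hmN := hM.m_lt
  obtain ⟨Z, hZ, hFZ⟩ := LexDiamond.exists_isLexCell_superset (x := x) (N := N) (j₀ := j₀)
    (fun j hj => hM.simplicial (by omega)) (fun j hj => hM.spans (by omega)) (by omega) hs
    ((hM.isFacetSet_iff (by omega)).2 hF)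
  exact ⟨Z, (hM.isLexCell_iff hj₀).1 hZ, hFZ⟩

theorem simplicial_diamond (hM : IsCurveModel x (2 * k) m N t c) (hj₀ : j₀ + 2 * k ≤ m)
    (hw : ∀ Z, IsLowerCell x w (Finset.Ico 0 N) Z ↔
      IsLexCell (fun j => IsFacetSet x (Finset.Ico j N)) j₀ 0 Z)
    (hapex : HighApex x w (Finset.Ico 0 N) N (w N)) :
    Simplicial (lift w x) (insert N (Finset.Ico 0 N)) := by
  refine hapex.simplicial_lift (hM.simplicial (by omega)) (hM.spans (by omega)) (by simp)
    fun Z hZ => ((hw Z).1 hZ).card_eq (fun j _ F hF => hF.isFaceSet.1)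
      fun j hj F hF => hM.simplicial (by omega) F hF

/-- The boundary complex of the diamond consists of the lexicographic subdivision and of the cone
over the boundary complex of the polytope. -/
theorem mem_diamondFaces_iff (hM : IsCurveModel x (2 * k) m N t c) (hj₀ : j₀ + 2 * k ≤ m)
    (hw : ∀ Z, IsLowerCell x w (Finset.Ico 0 N) Z ↔
      IsLexCell (fun j => IsFacetSet x (Finset.Ico j N)) j₀ 0 Z)
    (hapex : HighApex x w (Finset.Ico 0 N) N (w N)) (S : Finset ℕ) :
    S ∈ lexFaces k j₀ 0 m N ∪ (boundaryFaces k 0 m N).image (insert N) ↔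
      ∃ Z, IsFacetSet (lift w x) (insert N (Finset.Ico 0 N)) Z ∧ S ⊆ Z := by
  have hmN := hM.m_lt
  have hs := hM.simplicial (Nat.zero_le m)
  have hI := hM.spans (j := 0) (by omega)
  have hN : N ∉ Finset.Ico 0 N := by simp
  have hsub : ∀ Z, IsLexCell (fun j => IsBoundarySet k j m N) j₀ 0 Z → N ∉ Z := fun Z hZ h =>
    hN (hZ.subset (fun j _ F hF => hF.subset (by omega) hmN.le) (Nat.zero_le _) (by omega) h)
  have hlower : ∀ Z, N ∉ Z → (IsFacetSet (lift w x) (insert N (Finset.Ico 0 N)) Z ↔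
      IsLexCell (fun j => IsBoundarySet k j m N) j₀ 0 Z) := fun Z hZ => by
    rw [hapex.isFacetSet_iff hs hI hN hZ, hw, hM.isLexCell_iff hj₀]
  rw [Finset.mem_union, mem_lexFaces (Nat.zero_le _) (by omega) hmN, Finset.mem_image]
  simp only [mem_boundaryFaces (Nat.zero_le m) hmN.le]
  constructor
  · rintro (⟨Z, hZ, hSZ⟩ | ⟨B, ⟨F, hF, hBF⟩, rfl⟩)
    · exact ⟨Z, (hlower Z (hsub Z hZ)).2 hZ, hSZ⟩
    · have hF' := (hM.isFacetSet_iff (by omega)).2 hF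
      exact ⟨_, (hapex.isFacetSet_insert_iff hs hI hN hF'.isFaceSet.1).2 hF',
        Finset.insert_subset_insert _ hBF⟩
  · rintro ⟨Z, hZ, hSZ⟩
    by_cases hNZ : N ∈ Z
    · have hZsub : Z.erase N ⊆ Finset.Ico 0 N :=
        Finset.subset_insert_iff.1 hZ.isFaceSet.1
      rw [← Finset.insert_erase hNZ, hapex.isFacetSet_insert_iff hs hI hN hZsub,
        hM.isFacetSet_iff (by omega)] at hZ
      by_cases hNS : N ∈ S
      · exact Or.inr ⟨S.erase N, ⟨_, hZ, Finset.erase_subset_erase _ hSZ⟩,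
          Finset.insert_erase hNS⟩
      · obtain ⟨Z', hZ', hsub'⟩ := hM.exists_isLexCell_superset hj₀ (Nat.zero_le _) hZ
        refine Or.inl ⟨Z', hZ', fun i hi => hsub' (Finset.mem_erase.2 ⟨?_, hSZ hi⟩)⟩
        rintro rfl
        exact hNS hi
    · exact Or.inl ⟨Z, (hlower Z hNZ).1 hZ, hSZ⟩

/-- The pushed and pulled part and the cone over the boundary have `h`-polynomials whose sum
collapses, up to terms of degree above half the dimension. -/
theorem exists_hPoly_diamond (hM : IsCurveModel x (2 * (k + 1)) m N t c)
    (hj₀ : j₀ + 2 * (k + 1) ≤ m)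
    (hw : ∀ Z, IsLowerCell x w (Finset.Ico 0 N) Z ↔
      IsLexCell (fun j => IsFacetSet x (Finset.Ico j N)) j₀ 0 Z)
    (hapex : HighApex x w (Finset.Ico 0 N) N (w N)) :
    ∃ R : ℤ[X], (1 - Polynomial.X) * hPoly (hull (lift w x) (insert N (Finset.Ico 0 N))) =
      multichoosePoly (k + 1) (m - 2 * (k + 1)) +
        C ((m - j₀ - 2 * (k + 1)).multichoose (k + 1) : ℤ) * Polynomial.X ^ (k + 2) +
        R * Polynomial.X ^ (k + 1 + (N - m)) := by
  have hmN := hM.m_lt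
  have hN : N ∉ Finset.Ico 0 N := by simp
  have hfinrank : finrank ℝ (ℝ × E) = 2 * (k + 1) + (N - m) := by
    have := hM.finrank_eq
    rw [finrank_prod, finrank_self]
    omega
  have hbound : ∀ S ∈ boundaryFaces (k + 1) 0 m N, N ∉ S := fun S hS h => by
    obtain ⟨Z, hZ, hSZ⟩ := (mem_boundaryFaces (Nat.zero_le m) hmN.le).1 hS
    exact hN (hZ.subset (Nat.zero_le m) hmN.le (hSZ h))
  have hdisj : Disjoint (lexFaces (k + 1) j₀ 0 m N)
      ((boundaryFaces (k + 1) 0 m N).image (insert N)) := by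
    rw [Finset.disjoint_left]
    intro S hS hS'
    obtain ⟨B, -, rfl⟩ := Finset.mem_image.1 hS'
    obtain ⟨Z, hZ, hSZ⟩ := (mem_lexFaces (Nat.zero_le _) (by omega) hmN).1 hS
    exact hN (hZ.subset (fun j _ F hF => hF.subset (by omega) hmN.le) (Nat.zero_le _) (by omega)
      (hSZ (Finset.mem_insert_self N B)))
  have hX := hM.mem_diamondFaces_iff hj₀ hw hapex
  have hsimp := hM.simplicial_diamond hj₀ hw hapex
  have hcard : ∀ S ∈ lexFaces (k + 1) j₀ 0 m N ∪ (boundaryFaces (k + 1) 0 m N).image (insert N),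
      S.card ≤ 2 * (k + 1) + (N - m) := fun S hS => by
    obtain ⟨Z, hZ, hSZ⟩ := (hX S).1 hS
    rw [← hfinrank, ← hsimp Z hZ]
    exact Finset.card_le_card hSZ
  obtain ⟨R, hR⟩ := X_pow_dvd_hSum_linkFaces_sub (k := k) (m := m) (by omega)
  refine ⟨Polynomial.X * R - C ((m - j₀ - 2 * (k + 1)).multichoose (k + 1) : ℤ), ?_⟩
  rw [hsimp.hPoly_eq (hapex.spans_lift (hM.spans (by omega))) hX, hfinrank, ← hSum_succ hcard,
    hSum_union hdisj, hSum_image_insert hbound, hSum_boundaryFaces (by omega) hmN,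
    hSum_lexFaces (Nat.zero_le _) hj₀ hmN fun j hj F hF =>
      hM.exists_isLexCell_superset hj₀ hj hF, Nat.sub_zero, eq_add_of_sub_eq hR, pow_add]
  ring

end Diamond

end IsCurveModel

end LexDiamond

theorem proposition5p2 (k d n a : ℕ) (hk : 1 ≤ k) (hd : 2 * k + 2 ≤ d) (hn : d ≤ n)
    (ha : 1 ≤ a) (han : a ≤ n - d + 1)
    (P : LexDiamond.MWPolytope (2 * k) (d - 2) (n - 1)) :
    (∃ w : Fin (n - 1) → ℝ, LexDiamond.IsLexHeights P.vertex a w) ∧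
    ∀ w : Fin (n - 1) → ℝ, LexDiamond.IsLexHeights P.vertex a w →
      ∀ v₀ : EuclideanSpace ℝ (Fin (d - 2)), ∃ W : ℝ, ∀ w₀ : ℝ, W < w₀ →
        LexDiamond.IsSimplicialPolytope (d - 1) (LexDiamond.diamond P.vertex w (w₀, v₀)) ∧
        ∀ i : ℕ, i ≤ (d - 1) / 2 →
          LexDiamond.gNum (LexDiamond.diamond P.vertex w (w₀, v₀)) i =
            if i ≤ k then ((n - d).multichoose i : ℤ)
            else if i = k + 1 then ((n - d + 1 - a).multichoose k : ℤ)
            else 0 := by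
  obtain ⟨κ, rfl⟩ : ∃ κ, k = κ + 1 := ⟨k - 1, by omega⟩
  obtain ⟨m, hm⟩ : ∃ m, m = n - 1 - (d - 2) + 2 * (κ + 1) - 1 := ⟨_, rfl⟩
  have hmodel : ∀ v₀, ∃ t c, LexDiamond.IsCurveModel (P.point v₀) (2 * (κ + 1)) m (n - 1) t c :=
    fun v₀ => hm ▸ P.exists_isCurveModel v₀
  have hpoint : ∀ v₀, ∀ i : Fin (n - 1), P.point v₀ i = P.vertex i := fun v₀ i => by
    simp [LexDiamond.MWPolytope.point]
  refine ⟨?_, fun w hw v₀ => ?_⟩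
  · obtain ⟨t, c, hM⟩ := hmodel 0
    exact LexDiamond.exists_isLexHeights (hpoint 0)
      (fun i hi => hM.isFaceSet_singleton (by omega) hi) (fun j hj => hM.simplicial (by omega))
      (fun j hj => hM.spans (by omega)) ha (by omega)
  · obtain ⟨t, c, hM⟩ := hmodel v₀
    obtain ⟨W, hW⟩ := Filter.eventually_atTop.1 (LexDiamond.eventually_highApex (P.point v₀)
      (fun i => if h : i < n - 1 then w ⟨i, h⟩ else 0) (Finset.Ico 0 (n - 1)) (n - 1))
    refine ⟨W, fun w₀ hw₀ => ?_⟩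
    obtain ⟨u, hu, huN⟩ : ∃ u : ℕ → ℝ, (∀ i : Fin (n - 1), u i = w i) ∧ u (n - 1) = w₀ :=
      ⟨fun i => if h : i < n - 1 then w ⟨i, h⟩ else w₀, fun i => by simp, by simp⟩
    have hapex : LexDiamond.HighApex (P.point v₀) u (Finset.Ico 0 (n - 1)) (n - 1)
        (u (n - 1)) := by
      rw [huN]
      refine (hW w₀ hw₀.le).congr fun i hi => ?_
      have hi := (Finset.mem_Ico.1 hi).2
      rw [dif_pos hi, ← hu ⟨i, hi⟩]
    have hcells := fun Z => hw.isLowerCell_iff (hpoint v₀) hu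
      (fun i hi => hM.isFaceSet_singleton (by omega) hi) (fun j hj => hM.simplicial (by omega))
      (fun j hj => hM.spans (by omega)) ha (by omega) (Z := Z)
    have hj₀ : a - 1 + 2 * (κ + 1) ≤ m := by omega
    have hdiamond := LexDiamond.diamond_eq (hpoint v₀) hu
    rw [huN, show P.point v₀ (n - 1) = v₀ by simp [LexDiamond.MWPolytope.point]] at hdiamond
    rw [hdiamond]
    constructor
    · have h := (hM.simplicial_diamond hj₀ hcells hapex).isSimplicialPolytope
        (hapex.spans_lift (hM.spans (by omega)))
      rwa [Module.finrank_prod, Module.finrank_self, finrank_euclideanSpace_fin,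
        show 1 + (d - 2) = d - 1 by omega] at h
    · intro i hi
      obtain ⟨R, hR⟩ := hM.exists_hPoly_diamond hj₀ hcells hapex
      rw [LexDiamond.gNum_eq_coeff, hR, Polynomial.coeff_add, Polynomial.coeff_add,
        Polynomial.coeff_C_mul_X_pow, Polynomial.coeff_mul_X_pow',
        if_neg (show ¬ κ + 1 + (n - 1 - m) ≤ i by omega),
        LexDiamond.coeff_multichoosePoly, show m - 2 * (κ + 1) = n - d by omega,
        show m - (a - 1) - 2 * (κ + 1) = n - d + 1 - a by omega]
      split_ifs <;> omega
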